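/- **Setting.** Identify $\mathbb R^4$ with the quaternions via $x=x^0+ix^1+jx^2+kx^3$, and $\mathfrak{su}(2)$ with the imaginary quaternions, with basis $i,j,k$. Let $U\subset\mathbb R^4$ be an open ball centred at $0$, and let $A_0$ be the connection form, in a smooth gauge over $U$, of an anti-self-dual $SU(2)$-connection (flat metric), with curvature $F_0=dA_0+A_0\wedge A_0$. For an $\mathfrak{su}(2)$-valued 2-form $F$ at a point, $\mathrm{Mat}(F)$ is the real $3\times3$ matrix whose columns are half the coefficients of $F^-=\tfrac12(F-*F)$ along $\omega_1=dx^0dx^1-dx^2dx^3$, $\omega_2=dx^0dx^2-dx^3dx^1$, $\omega_3=dx^0dx^3-dx^1dx^2$. The form $F$ is *reducible* if the components $F^-_{ij}$ are all colinear (equivalently, $\mathrm{Mat}(F)$ has rank at most $1$). For $y\in\mathbb R^4$, $\lambda>0$ and $m\in SO(3)$, let $F_{\rm std}=F_{\rm std}^{(y,\lambda,m)}$ be the curvature on $\mathbb R^4\setminus\{y\}$ of the standard instanton of centre $y$ and size $\lambda$ in the radial gauge that is singular at $y$ and regular at infinity, with gluing angle $m$. That is, take the connection form $\mathrm{Im}\big(\overline{(x-y)}\,dx\big)/(\lambda^2+|x-y|^2)$,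 replace it by $\phi A\phi^{-1}-(d\phi)\phi^{-1}$ with $\phi(x)=(x-y)/|x-y|$, and apply the rotation $m^{-1}$ of $\mathfrak{su}(2)=\mathbb R^3$. Let $K>0$, $\alpha\in(0,2)$. For $L>0$ put $p=(L,0,0,0)$, $q=(-L,0,0,0)$ and $B=U\times(0,KL^\alpha)\times SO(3)$, with the product orientation, where $SO(3)$ is oriented by the basis of its Lie algebra consisting of the infinitesimal right-handed rotations about the three coordinate axes. Let $\tilde\nu_p$ be the set of $(y,\lambda,m)\in B$ with $y\neq p$ for which $F_0(p)+F_{\rm std}(p)$ is reducible, and define $\tilde\nu_q$ likewise at $q$. Thus $\tilde\nu_p$ is the preimage of the $3\times 3$ matrices of rank at most $1$ under $(y,\lambda,m)\mapsto\mathrm{Mat}(F_0(p)+F_{\rm std}(p))$. The matrices of rank exactly $1$ form a submanifold of codimension $4$, whose normal space at $W$ is $\mathrm{Hom}(\ker W,\mathbb R^3/\mathrm{im}\,W)$. This space is canonically oriented, because both $\ker W$ and $\mathbb R^3/\mathrm{im}\,W$ are $2$-dimensional. Where this map is transverse to the matrices of rank $1$, $\tilde\nu_p$ is a submanifold of codimension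 $4$, co-oriented by pull-back; similarly for $\tilde\nu_q$. (The opposite choice of co-orientation of the rank-one matrices leads to the same intersection numbers.) **Theorem 2.1.** Fix $K>0$, $\alpha\in(0,2)$ and a background connection $A_0$ as above. If the three singular values of $\mathrm{Mat}(F_0(0))$ are distinct, then for all sufficiently small $L>0$ the sets $\tilde\nu_p$ and $\tilde\nu_q$ intersect in exactly six points. At each of these points $\mathrm{Mat}(F_0+F_{\rm std})$ has rank exactly $1$ at $p$ and at $q$, $\tilde\nu_p$ and $\tilde\nu_q$ are smooth of codimension $4$ in the above sense, they intersect transversely, and their local intersection number is $+1$. -/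

import Mathlib

open scoped Quaternion ContDiff Topology

namespace BubbleModel

noncomputable section

/-! ### Connections and curvature on domains of `ℝ⁴ = ℍ`

A point of `ℝ⁴` is a quaternion `x⁰ + i x¹ + j x² + k x³`; the Lie algebra `𝔰𝔲(2)` is the space of
imaginary quaternions, with the commutator as its bracket. -/

/-- The standard basis `1, i, j, k` of `ℝ⁴ = ℍ`. -/
def e : Fin 4 → ℍ := ![⟨1, 0, 0, 0⟩, ⟨0, 1, 0, 0⟩, ⟨0, 0, 1, 0⟩, ⟨0, 0, 0, 1⟩]

/-- A quaternion-valued `1`-form `∑ A μ dx^μ` on `ℝ⁴`, given by its components. -/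
abbrev OneForm : Type := Fin 4 → ℍ → ℍ

/-- The value at one point of a quaternion-valued `2`-form `½ ∑ F μ ν dx^μ ∧ dx^ν`. -/
abbrev TwoFormAt : Type := Fin 4 → Fin 4 → ℍ

/-- The curvature `dA + A ∧ A` of a connection form `A` at the point `x`. -/
def curvature (A : OneForm) (x : ℍ) : TwoFormAt := fun μ ν =>
  fderiv ℝ (A ν) x (e μ) - fderiv ℝ (A μ) x (e ν) + (A μ x * A ν x - A ν x * A μ x)

/-- The Hodge star on `2`-forms of Euclidean `ℝ⁴`, `(*F)_{μν} = ½ ∑ ε_{μνρσ} F_{ρσ}`. -/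
def hodgeStar (F : TwoFormAt) : TwoFormAt := fun μ ν =>
  (1 / 2 : ℝ) • ∑ τ : Equiv.Perm (Fin 4),
    if τ 0 = μ ∧ τ 1 = ν then ((Equiv.Perm.sign τ : ℤ) : ℝ) • F (τ 2) (τ 3) else 0

/-- The anti-self-dual part `F⁻ = (F - *F)/2`. -/
def asdPart (F : TwoFormAt) : TwoFormAt := (1 / 2 : ℝ) • (F - hodgeStar F)

/-- `A` is the connection form, in a smooth gauge over `U`, of an anti-self-dual connection. -/
structure IsASDConnectionOn (A : OneForm) (U : Set ℍ) : Prop where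
  smooth : ∀ μ, ContDiffOn ℝ ∞ (A μ) U
  imaginary : ∀ μ, ∀ x ∈ U, (A μ x).re = 0
  asd : ∀ x ∈ U, hodgeStar (curvature A x) = -curvature A x

/-- The three coordinates of the imaginary part of a quaternion, in the basis `i, j, k`. -/
def imCoord (a : ℍ) : Fin 3 → ℝ := ![a.imI, a.imJ, a.imK]

/-- The matrix `Mat(F)`: its columns are half the `ω₁, ω₂, ω₃` components of `F⁻`, where
`ω₁ = dx⁰dx¹ - dx²dx³`, `ω₂ = dx⁰dx² - dx³dx¹`, `ω₃ = dx⁰dx³ - dx¹dx²`. -/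
def curvatureMatrix (F : TwoFormAt) : Matrix (Fin 3) (Fin 3) ℝ :=
  Matrix.of fun a i => (1 / 2) * imCoord (asdPart F 0 i.succ) a

/-- `F` is reducible: the components of `F⁻` are all colinear elements of the Lie algebra. -/
def IsReducible (F : TwoFormAt) : Prop :=
  Module.finrank ℝ
    (Submodule.span ℝ (Set.range fun ij : Fin 4 × Fin 4 => asdPart F ij.1 ij.2)) ≤ 1

/-- The three singular values of a `3 × 3` real matrix, with multiplicity. -/
def singularValues (M : Matrix (Fin 3) (Fin 3) ℝ) (i : Fin 3) : ℝ :=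
  (Matrix.toEuclideanLin M).singularValues i

/-! ### The standard instanton -/

/-- The group `SO(3)`. -/
abbrev SO3 : Type := Matrix.specialOrthogonalGroup (Fin 3) ℝ

/-- The standard instanton `Im (x̄ dx / (1 + |x|²))` of size `1`, centred at the origin. -/
def stdInstanton : OneForm := fun μ x => (1 + ‖x‖ ^ 2)⁻¹ • (star x * e μ).im

/-- The standard instanton of size `lam` and centre `y`, in its regular gauge: the pull-back of
`stdInstanton` under `x ↦ (x - y) / lam`. -/
def regularInstanton (y : ℍ) (lam : ℝ) : OneForm := fun μ x =>
  lam⁻¹ • stdInstanton μ (lam⁻¹ • (x - y))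

/-- The gauge change `φ(x) = (x - y)/|x - y|`, with values in the unit quaternions. -/
def radialMap (y : ℍ) (x : ℍ) : ℍ := ‖x - y‖⁻¹ • (x - y)

/-- The connection form `φ A φ⁻¹ - (dφ) φ⁻¹`, for which the curvature `F` becomes `φ F φ⁻¹`. -/
def gaugeTransform (φ : ℍ → ℍ) (A : OneForm) : OneForm := fun μ x =>
  φ x * A μ x * (φ x)⁻¹ - fderiv ℝ φ x (e μ) * (φ x)⁻¹

/-- The action of `SO(3)`, the adjoint group of `SU(2)`, on imaginary quaternions. -/
def rotate (m : SO3) (a : ℍ) : ℍ :=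
  let w := (m : Matrix (Fin 3) (Fin 3) ℝ).mulVec (imCoord a)
  ⟨0, w 0, w 1, w 2⟩

/-- Bubble data `(y, lam, m)`: centre, size and gluing angle. -/
abbrev BubbleData : Type := ℍ × ℝ × SO3

/-- The standard instanton with data `b = (y, lam, m)` in the radial gauge that is singular at `y`
and regular at infinity, with gluing angle `m`. If `m` is the rotation `a ↦ g a g⁻¹`, this is the
regular gauge transformed first by `φ⁻¹` and then by the constant `g`. -/
def singularInstanton (b : BubbleData) : OneForm := fun μ x =>
  rotate b.2.2⁻¹ (gaugeTransform (radialMap b.1) (regularInstanton b.1 b.2.1) μ x)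

/-- The curvature `F_std` of the standard instanton with data `b`. -/
def Fstd (b : BubbleData) (x : ℍ) : TwoFormAt := curvature (singularInstanton b) x

/-- The set `B = U × (0, K L^α) × SO(3)` of data of small bubbles. -/
def smallBubbles (U : Set ℍ) (K α L : ℝ) : Set BubbleData :=
  {b | b.1 ∈ U ∧ 0 < b.2.1 ∧ b.2.1 < K * L ^ α}

/-- The set of small bubbles for which `F_0 + F_std` is (defined and) reducible at `x`. -/
def nu (A₀ : OneForm) (U : Set ℍ) (K α L : ℝ) (x : ℍ) : Set BubbleData :=
  {b | b ∈ smallBubbles U K α L ∧ b.1 ≠ x ∧ IsReducible (curvature A₀ x + Fstd b x)}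

/-! ### Transversality and local intersection numbers

`B` is an oriented `8`-manifold, with the product orientation; `SO(3)` is oriented by the basis of
its Lie algebra given by the infinitesimal rotations about the three coordinate axes (that is, by
`i, j, k` in `𝔰𝔲(2)`). The set `nu` at `x` is the preimage of the matrices of rank at most `1` under
the map `totalMatrix` from `B` to `3 × 3` matrices. The matrices of rank exactly `1` form a
`5`-dimensional submanifold, with tangent space `{X | X (ker W) ⊆ im W}` at `W` and with normal
space `Hom (ker W, ℝ³ / im W)`. -/

/-- The matrix of `F_0 + F_std` at `x`, as a function of the bubble data. -/
def totalMatrix (A₀ : OneForm) (x : ℍ) (b : BubbleData) : Matrix (Fin 3) (Fin 3) ℝ :=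
  curvatureMatrix (curvature A₀ x + Fstd b x)

/-- The right-handed rotations by the angle `t` about the three coordinate axes. -/
def axisRotationMatrix (t : ℝ) : Fin 3 → Matrix (Fin 3) (Fin 3) ℝ :=
  ![!![1, 0, 0; 0, Real.cos t, -Real.sin t; 0, Real.sin t, Real.cos t],
    !![Real.cos t, 0, Real.sin t; 0, 1, 0; -Real.sin t, 0, Real.cos t],
    !![Real.cos t, -Real.sin t, 0; Real.sin t, Real.cos t, 0; 0, 0, 1]]

theorem axisRotationMatrix_mem (t : ℝ) (a : Fin 3) :
    axisRotationMatrix t a ∈ Matrix.specialOrthogonalGroup (Fin 3) ℝ := by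
  have h := Real.sin_sq_add_cos_sq t
  rw [Matrix.mem_specialOrthogonalGroup_iff, Matrix.mem_orthogonalGroup_iff]
  fin_cases a <;> refine ⟨?_, ?_⟩
  all_goals first
    | (ext i j
       fin_cases i <;> fin_cases j <;>
         simp [axisRotationMatrix, Matrix.mul_apply, Fin.sum_univ_three] <;>
         nlinarith [h])
    | (simp [axisRotationMatrix, Matrix.det_fin_three]
       nlinarith [h])

/-- `axisRotationMatrix` as an element of `SO(3)`. -/
def axisRotation (t : ℝ) (a : Fin 3) : SO3 := ⟨axisRotationMatrix t a, axisRotationMatrix_mem t a⟩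

/-- A positively oriented local parametrization of the `8`-manifold of bubble data, which sends `0`
to `b`. -/
def bubbleChart (b : BubbleData) (v : Fin 8 → ℝ) : BubbleData :=
  (b.1 + ⟨v 0, v 1, v 2, v 3⟩, b.2.1 + v 4,
    b.2.2 * axisRotation (v 5) 0 * axisRotation (v 6) 1 * axisRotation (v 7) 2)

/-- The differential at `b` of a matrix-valued function `E` of the bubble data, with the tangent
space at `b` identified with `ℝ⁸` through `bubbleChart b`. -/
def differential (E : BubbleData → Matrix (Fin 3) (Fin 3) ℝ) (b : BubbleData) :
    (Fin 8 → ℝ) →ₗ[ℝ] Matrix (Fin 3) (Fin 3) ℝ where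
  toFun v := Matrix.of fun a i => fderiv ℝ (fun w => E (bubbleChart b w) a i) 0 v
  map_add' v w := by ext a i; simp
  map_smul' c v := by ext a i; simp

/-- The tangent space `{X | X (ker W) ⊆ im W}`, at a matrix `W` of rank `1`, to the matrices of
rank `1`. -/
def rankOneTangent (W : Matrix (Fin 3) (Fin 3) ℝ) : Submodule ℝ (Matrix (Fin 3) (Fin 3) ℝ) where
  carrier := {X | ∀ k, W.mulVec k = 0 → ∃ c, X.mulVec k = W.mulVec c}
  zero_mem' k _ := ⟨0, by simp⟩
  add_mem' {X Y} hX hY k hk := by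
    obtain ⟨c, hc⟩ := hX k hk
    obtain ⟨d, hd⟩ := hY k hk
    exact ⟨c + d, by rw [Matrix.add_mulVec, Matrix.mulVec_add, hc, hd]⟩
  smul_mem' r X hX k hk := by
    obtain ⟨c, hc⟩ := hX k hk
    exact ⟨r • c, by rw [Matrix.smul_mulVec, Matrix.mulVec_smul, hc]⟩

/-- `{E of rank ≤ 1}` is at `b` a smooth submanifold of codimension `4`, cut out transversely:
`E b` has rank exactly `1`, and `E` is at `b` transverse to the matrices of rank `1`. -/
def IsSmoothPoint (E : BubbleData → Matrix (Fin 3) (Fin 3) ℝ) (b : BubbleData) : Prop :=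
  (E b).rank = 1 ∧ LinearMap.range (differential E b) ⊔ rankOneTangent (E b) = ⊤

/-- The tangent space at a smooth point `b` to `{E of rank ≤ 1}`. -/
def tangentAt (E : BubbleData → Matrix (Fin 3) (Fin 3) ℝ) (b : BubbleData) :
    Submodule ℝ (Fin 8 → ℝ) :=
  (rankOneTangent (E b)).comap (differential E b)

/-- `{E of rank ≤ 1}` and `{E' of rank ≤ 1}` are smooth at `b` and meet transversely there. -/
def IsTransverseAt (E E' : BubbleData → Matrix (Fin 3) (Fin 3) ℝ) (b : BubbleData) : Prop :=
  IsSmoothPoint E b ∧ IsSmoothPoint E' b ∧ tangentAt E b ⊔ tangentAt E' b = ⊤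

/-- `k` is a basis of the kernel of the rank-one matrix `W`, and `f` a basis of the linear forms
that vanish on its image. -/
structure IsNormalFrame (W : Matrix (Fin 3) (Fin 3) ℝ) (f k : Fin 2 → Fin 3 → ℝ) : Prop where
  indep_form : LinearIndependent ℝ f
  indep_ker : LinearIndependent ℝ k
  form_image : ∀ i, W.vecMul (f i) = 0
  ker : ∀ j, W.mulVec (k j) = 0

/-- The coordinates of the class of `X` in the normal space `Hom (ker W, ℝ³ / im W)`, in the frame
`f, k`. Any two frames give the same orientation of this normal space, since a change of bases with
matrices `C` and `D` acts on it with determinant `(det C)² (det D)²`: this is its canonical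
orientation, by which the matrices of rank `1` are co-oriented. -/
def normalCoord (f k : Fin 2 → Fin 3 → ℝ) (X : Matrix (Fin 3) (Fin 3) ℝ) : Fin 4 → ℝ :=
  ![f 0 ⬝ᵥ X.mulVec (k 0), f 0 ⬝ᵥ X.mulVec (k 1), f 1 ⬝ᵥ X.mulVec (k 0), f 1 ⬝ᵥ X.mulVec (k 1)]

/-- The matrix, in a positive basis of the tangent space to the bubble data at `b` and in positive
bases of the normal spaces, of the map from that tangent space to the direct sum of the normal
spaces at `b` to `{E of rank ≤ 1}` and to `{E' of rank ≤ 1}`. -/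
def intersectionMatrix (E E' : BubbleData → Matrix (Fin 3) (Fin 3) ℝ) (b : BubbleData)
    (f k f' k' : Fin 2 → Fin 3 → ℝ) : Matrix (Fin 8) (Fin 8) ℝ :=
  Matrix.of fun r c => (Fin.append (normalCoord f k (differential E b (Pi.single c 1)))
    (normalCoord f' k' (differential E' b (Pi.single c 1))) : Fin (4 + 4) → ℝ) r

/-- `{E of rank ≤ 1}` and `{E' of rank ≤ 1}`, co-oriented by pulling back the co-orientation of the
matrices of rank `1`, meet transversely at `b` with local intersection number `n`: the isomorphism
of the tangent space of the bubble data with the sum of the two normal spaces has sign `n`. (The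
number would be the same for the opposite co-orientation of the matrices of rank `1`.) -/
def HasLocalIntersectionNumber (E E' : BubbleData → Matrix (Fin 3) (Fin 3) ℝ) (b : BubbleData)
    (n : ℤ) : Prop :=
  IsTransverseAt E E' b ∧
    ∀ f k f' k' : Fin 2 → Fin 3 → ℝ, IsNormalFrame (E b) f k → IsNormalFrame (E' b) f' k' →
      ((SignType.sign (intersectionMatrix E E' b f k f' k').det : SignType) : ℤ) = n

end

end BubbleModel

open BubbleModel

open scoped Quaternion ContDiff Topology
open Filter

namespace BubbleModel

noncomputable section

/-! In the radial gauge the matrix of the standard instanton at `x` is `σ Q`, where `σ = λ²/(λ² + |x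
- y|²)²` and `Q = m⁻¹ Ad(x - y)` is a rotation (`totalMatrix_eq_scale`). Reducibility therefore asks
when `M + σ Q` has rank at most one, `M` being the background matrix. On the kernel plane `M = -σ
Q`, so `M` is a similarity of ratio `σ` there. If the singular values are distinct, `σ` must be the
middle one and the plane one of the two "circular section" planes through the middle singular
vector. The plane determines the rotation. Hence there are exactly two admissible rotations `R i` at
`p` and two, `R' j`, at `q` (`IsSpectralFrame.rank_rot_le`, `IsSpectralFrame.eq_of_rank_le`).

Fix `i`, `j` and a unit quaternion `g` with `Ad g = (R' j)⁻¹ (R i)` and `Re g ≥ 0`. The scales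
prescribe `|p - y|² = λ(a - λ)` and `|q - y|² = λ(b - λ)`, with `a`, `b` the inverse square roots of
the middle singular values at `p`, `q`. Eliminating `m` from the two rotations gives `p - y = t (q -
y) g` with `t` real. As `p - q = 2L` is real, the law of cosines leaves one equation for `λ`, namely
`sideSq a b c λ = (2L)²` with `c = ± Re g`; its solution determines `y` and then `m`. For small `λ`
and `c < 1` the left side increases. If `c` stays away from `1`, it reaches the order `L ^ α`, much
more than `L²`, below the size bound, so there is exactly one solution: this covers six of the eight
choices of `i`, `j` and the sign. For `i = j` and sign `+`, differentiability of the spectral data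
in `L` gives `a - b = O(L)` and `1 - c = O(L²)`, so the left side is `λ O(L²) < 4L²` and there is no
solution (`ncard_isMatched`, `ncard_nu_inter`).

For the sign, a variation of the bubble changes `σ Q` by `δ Q + σ ζ × Q`, so the intersection matrix
is a block diagonal matrix times the differential of the pairs `(δ, ζ)` at the two points. Each
block has determinant `-σ³` times a square, nonzero because the spectrum is simple
(`det_normalMatrix_neg`); the second factor has positive determinant because `λ` is smaller than
both distances (`det_dataMatrix_pos`). The product is positive, which also yields transversality
(`isTransverseAt_of_det`). -/

/-! ### The Hodge star in coordinates, and reducibility as a rank condition. -/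

theorem decomposeFin_symm_two {n : ℕ} (p : Fin (n + 3)) (τ : Equiv.Perm (Fin (n + 2))) :
    Equiv.Perm.decomposeFin.symm (p, τ) 2 = Equiv.swap 0 p (τ 1).succ :=
  Equiv.Perm.decomposeFin_symm_apply_succ τ p 1

theorem decomposeFin_symm_three {n : ℕ} (p : Fin (n + 4)) (τ : Equiv.Perm (Fin (n + 3))) :
    Equiv.Perm.decomposeFin.symm (p, τ) 3 = Equiv.swap 0 p (τ 2).succ :=
  Equiv.Perm.decomposeFin_symm_apply_succ τ p 2

/-- The sum over the 24 permutations is unfolded through `Equiv.Perm.decomposeFin`; off the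
diagonal, two permutations with opposite signs survive in each entry. -/
theorem hodgeStar_apply (F : TwoFormAt) (μ ν : Fin 4) :
    hodgeStar F μ ν = (1 / 2 : ℝ) • (![![0, F 2 3 - F 3 2, F 3 1 - F 1 3, F 1 2 - F 2 1],
      ![F 3 2 - F 2 3, 0, F 0 3 - F 3 0, F 2 0 - F 0 2],
      ![F 1 3 - F 3 1, F 3 0 - F 0 3, 0, F 0 1 - F 1 0],
      ![F 2 1 - F 1 2, F 0 2 - F 2 0, F 1 0 - F 0 1, 0]] : Fin 4 → Fin 4 → ℍ) μ ν := by
  unfold hodgeStar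
  congr 1
  simp only [Finset.univ_perm_fin_succ, Finset.sum_map, Equiv.toEmbedding_apply,
    ← Finset.univ_product_univ, Finset.sum_product, Fin.sum_univ_succ, Finset.univ_unique,
    Finset.sum_singleton, Equiv.Perm.decomposeFin.symm_sign, Equiv.Perm.decomposeFin_symm_apply_one,
    Equiv.Perm.decomposeFin_symm_apply_zero, decomposeFin_symm_two, decomposeFin_symm_three,
    Equiv.swap_apply_def, Fin.succ_zero_eq_one, Fin.succ_one_eq_two]
  fin_cases μ <;> fin_cases ν <;> simp [sub_eq_add_neg, add_comm] <;> exact add_comm _ _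

theorem asdPart_zero_succ (F : TwoFormAt) (hF : ∀ μ ν, F ν μ = -F μ ν) (i : Fin 3) :
    asdPart F 0 i.succ = (1 / 2 : ℝ) • (![F 0 1 - F 2 3, F 0 2 - F 3 1, F 0 3 - F 1 2] i) := by
  have h : asdPart F 0 i.succ = (1 / 2 : ℝ) • (F 0 i.succ - hodgeStar F 0 i.succ) := rfl
  rw [h, hodgeStar_apply]
  congr 1
  fin_cases i
  · simp [hF 2 3]; module
  · simp [hF 3 1]; module
  · simp [hF 1 2]; module

/-- The imaginary quaternion with given coordinates. -/
def ofIm : (Fin 3 → ℝ) →ₗ[ℝ] ℍ where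
  toFun w := ⟨0, w 0, w 1, w 2⟩
  map_add' v w := by
    ext
    · exact (add_zero (0 : ℝ)).symm
    all_goals rfl
  map_smul' c v := by
    ext
    · exact (mul_zero c).symm
    all_goals rfl

theorem ofIm_injective : Function.Injective ofIm := fun v w h => by
  ext i
  have h1 := congrArg QuaternionAlgebra.imI h
  have h2 := congrArg QuaternionAlgebra.imJ h
  have h3 := congrArg QuaternionAlgebra.imK h
  fin_cases i
  exacts [h1, h2, h3]

theorem ofIm_imCoord {a : ℍ} (ha : a.re = 0) : ofIm (imCoord a) = a := by
  ext
  · exact ha.symm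
  all_goals rfl

/-- Skew-symmetric with imaginary components. -/
structure IsSkewIm (F : TwoFormAt) : Prop where
  skew : ∀ μ ν, F ν μ = -F μ ν
  im : ∀ μ ν, (F μ ν).re = 0

theorem IsSkewIm.diag {F : TwoFormAt} (hF : IsSkewIm F) (μ : Fin 4) : F μ μ = 0 :=
  by
  have h := hF.skew μ μ
  have h2 : (2 : ℝ) • F μ μ = 0 := by rw [two_smul]; nth_rewrite 1 [h]; simp
  simpa using h2

theorem IsSkewIm.add {F G : TwoFormAt} (hF : IsSkewIm F) (hG : IsSkewIm G) : IsSkewIm (F + G) where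
  skew μ ν := by simp [hF.skew μ ν, hG.skew μ ν, add_comm]
  im μ ν := by simp [hF.im, hG.im]

theorem curvatureMatrix_col {F : TwoFormAt} (hF : IsSkewIm F) (i : Fin 3) :
    ofIm ((curvatureMatrix F).col i) = (1 / 2 : ℝ) • asdPart F 0 i.succ := by
  have : (curvatureMatrix F).col i = (1 / 2 : ℝ) • imCoord (asdPart F 0 i.succ) := by
    ext a; rfl
  rw [this, map_smul, ofIm_imCoord]
  rw [asdPart_zero_succ F hF.skew]
  fin_cases i <;> simp [hF.im]

/-- Up to sign, the only nonzero components of `F⁻` are the three `F⁻ 0 i`, which are twice the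
columns of the matrix read as imaginary quaternions. The two spans thus correspond under the
injective map `ofIm`. -/
theorem isReducible_iff_rank {F : TwoFormAt} (hF : IsSkewIm F) :
    IsReducible F ↔ (curvatureMatrix F).rank ≤ 1 := by
  have key : Submodule.span ℝ (Set.range fun ij : Fin 4 × Fin 4 => asdPart F ij.1 ij.2) =
      (Submodule.span ℝ (Set.range (curvatureMatrix F).col)).map ofIm := by
    have hcol : ∀ i : Fin 3, asdPart F 0 i.succ ∈
        (Submodule.span ℝ (Set.range (curvatureMatrix F).col)).map ofIm := fun i => by
      have : asdPart F 0 i.succ = ofIm ((2 : ℝ) • (curvatureMatrix F).col i) := by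
        rw [map_smul, curvatureMatrix_col hF, smul_smul]; norm_num
      rw [this]
      exact Submodule.mem_map_of_mem (Submodule.smul_mem _ _ (Submodule.subset_span ⟨i, rfl⟩))
    have hs : ∀ μ ν, asdPart F μ ν = (1 / 2 : ℝ) • (F μ ν - hodgeStar F μ ν) := fun _ _ => rfl
    have hpos : ∀ μ ν (i : Fin 3), asdPart F μ ν = asdPart F 0 i.succ ∨
        asdPart F μ ν = - asdPart F 0 i.succ → asdPart F μ ν ∈
        (Submodule.span ℝ (Set.range (curvatureMatrix F).col)).map ofIm := by
      rintro μ ν i (h | h) <;> rw [h]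
      · exact hcol i
      · exact Submodule.neg_mem _ (hcol i)
    have h0 : ∀ μ, asdPart F μ μ ∈
        (Submodule.span ℝ (Set.range (curvatureMatrix F).col)).map ofIm := fun μ => by
      have : asdPart F μ μ = 0 := by
        rw [hs, hodgeStar_apply, hF.diag]; fin_cases μ <;> simp
      rw [this]; exact Submodule.zero_mem _
    have a1 := asdPart_zero_succ F hF.skew 0
    have a2 := asdPart_zero_succ F hF.skew 1
    have a3 := asdPart_zero_succ F hF.skew 2
    apply le_antisymm
    · rw [Submodule.span_le]
      rintro _ ⟨⟨μ, ν⟩, rfl⟩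
      have s1 := hF.skew 0 1
      have s2 := hF.skew 0 2
      have s3 := hF.skew 0 3
      have s4 := hF.skew 2 3
      have s5 := hF.skew 3 1
      have s6 := hF.skew 1 2
      fin_cases μ <;> fin_cases ν
      · exact h0 0
      · exact hcol 0
      · exact hcol 1
      · exact hcol 2
      · refine hpos 1 0 0 (.inr ?_)
        rw [a1, hs, hodgeStar_apply]; simp [s1, s4]; module
      · exact h0 1
      · refine hpos 1 2 2 (.inr ?_)
        rw [a3, hs, hodgeStar_apply]; simp [s3]; module
      · refine hpos 1 3 1 (.inl ?_)
        rw [a2, hs, hodgeStar_apply]; simp [s2, s5]; module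
      · refine hpos 2 0 1 (.inr ?_)
        rw [a2, hs, hodgeStar_apply]; simp [s2, s5]; module
      · refine hpos 2 1 2 (.inl ?_)
        rw [a3, hs, hodgeStar_apply]; simp [s3, s6]; module
      · exact h0 2
      · refine hpos 2 3 0 (.inr ?_)
        rw [a1, hs, hodgeStar_apply]; simp [s1]; module
      · refine hpos 3 0 2 (.inr ?_)
        rw [a3, hs, hodgeStar_apply]; simp [s3, s6]; module
      · refine hpos 3 1 1 (.inr ?_)
        rw [a2, hs, hodgeStar_apply]; simp [s2]; module
      · refine hpos 3 2 0 (.inl ?_)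
        rw [a1, hs, hodgeStar_apply]; simp [s1, s4]; module
      · exact h0 3
    · rw [Submodule.map_span, Submodule.span_le]
      rintro _ ⟨_, ⟨i, rfl⟩, rfl⟩
      rw [curvatureMatrix_col hF]
      exact Submodule.smul_mem _ _ (Submodule.subset_span ⟨(0, i.succ), rfl⟩)
  rw [IsReducible, key, Matrix.rank_eq_finrank_span_cols,
    ← (Submodule.equivMapOfInjective ofIm ofIm_injective _).finrank_eq]

/-! ### Rotations of the Lie algebra and their action on curvature. -/

/-- Entrywise these are the relations "each column is the cross product of the next two", the source
of all compatibilities of rotations with commutators and cross products below. -/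
theorem SO3.adjugate (m : SO3) :
    (m : Matrix (Fin 3) (Fin 3) ℝ).adjugate = (m : Matrix (Fin 3) (Fin 3) ℝ).transpose := by
  obtain ⟨h1, h2⟩ := Matrix.mem_specialOrthogonalGroup_iff.1 m.2
  have h3 : (m : Matrix (Fin 3) (Fin 3) ℝ) * (m : Matrix (Fin 3) (Fin 3) ℝ).transpose = 1 :=
    (Matrix.mem_orthogonalGroup_iff _ _).1 h1
  have h4 := Matrix.adjugate_mul (m : Matrix (Fin 3) (Fin 3) ℝ)
  rw [h2, one_smul] at h4
  calc _ = (m : Matrix (Fin 3) (Fin 3) ℝ).adjugate * (m * (m : Matrix (Fin 3) (Fin 3) ℝ).transpose) := by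
        rw [h3, mul_one]
    _ = _ := by rw [← mul_assoc, h4, one_mul]

/-- `imCoord` as a linear map. -/
def imCoordₗ : ℍ →ₗ[ℝ] (Fin 3 → ℝ) where
  toFun := imCoord
  map_add' a b := by ext i; fin_cases i <;> rfl
  map_smul' c a := by ext i; fin_cases i <;> rfl

/-- `rotate m` as a continuous linear map. -/
def rotateL (m : SO3) : ℍ →L[ℝ] ℍ :=
  (ofIm ∘ₗ (Matrix.toLin' (m : Matrix (Fin 3) (Fin 3) ℝ)) ∘ₗ imCoordₗ).toContinuousLinearMap

theorem rotateL_apply (m : SO3) (a : ℍ) : rotateL m a = rotate m a := rfl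

theorem imCoord_rotate (m : SO3) (a : ℍ) :
    imCoord (rotate m a) = (m : Matrix (Fin 3) (Fin 3) ℝ).mulVec (imCoord a) := by
  ext i; fin_cases i <;> rfl

theorem rotate_re (m : SO3) (a : ℍ) : (rotate m a).re = 0 := rfl

theorem rotate_imI (m : SO3) (a : ℍ) :
    (rotate m a).imI = (m : Matrix (Fin 3) (Fin 3) ℝ).mulVec (imCoord a) 0 := rfl

theorem rotate_imJ (m : SO3) (a : ℍ) :
    (rotate m a).imJ = (m : Matrix (Fin 3) (Fin 3) ℝ).mulVec (imCoord a) 1 := rfl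

theorem rotate_imK (m : SO3) (a : ℍ) :
    (rotate m a).imK = (m : Matrix (Fin 3) (Fin 3) ℝ).mulVec (imCoord a) 2 := rfl

/-- A commutator of quaternions is twice the cross product of the imaginary parts, and rotations of
determinant one preserve cross products. -/
theorem rotate_commutator (m : SO3) (a b : ℍ) :
    rotate m a * rotate m b - rotate m b * rotate m a = rotate m (a * b - b * a) := by
  have h := m.adjugate
  rw [Matrix.adjugate_fin_three] at h
  generalize hm : (m : Matrix (Fin 3) (Fin 3) ℝ) = A at h
  have e := fun i j => congrFun (congrFun h i) j
  have e00 := e 0 0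
  have e01 := e 0 1
  have e02 := e 0 2
  have e10 := e 1 0
  have e11 := e 1 1
  have e12 := e 1 2
  have e20 := e 2 0
  have e21 := e 2 1
  have e22 := e 2 2
  simp at e00 e01 e02 e10 e11 e12 e20 e21 e22
  ext
  · simp [rotate_re, rotate_imI, rotate_imJ, rotate_imK]
    ring
  · simp [rotate_re, rotate_imI, rotate_imJ, rotate_imK, hm, imCoord, Matrix.mulVec, dotProduct, Fin.sum_univ_three]
    linear_combination 2 * (a.imJ * b.imK - a.imK * b.imJ) * e00 +
      2 * (a.imK * b.imI - a.imI * b.imK) * e10 + 2 * (a.imI * b.imJ - a.imJ * b.imI) * e20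
  · simp [rotate_re, rotate_imI, rotate_imJ, rotate_imK, hm, imCoord, Matrix.mulVec, dotProduct, Fin.sum_univ_three]
    linear_combination 2 * (a.imJ * b.imK - a.imK * b.imJ) * e01 +
      2 * (a.imK * b.imI - a.imI * b.imK) * e11 + 2 * (a.imI * b.imJ - a.imJ * b.imI) * e21
  · simp [rotate_re, rotate_imI, rotate_imJ, rotate_imK, hm, imCoord, Matrix.mulVec, dotProduct, Fin.sum_univ_three]
    linear_combination 2 * (a.imJ * b.imK - a.imK * b.imJ) * e02 +
      2 * (a.imK * b.imI - a.imI * b.imK) * e12 + 2 * (a.imI * b.imJ - a.imJ * b.imI) * e22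

theorem curvature_rotate (m : SO3) (A : OneForm) (x : ℍ)
    (hA : ∀ μ, DifferentiableAt ℝ (A μ) x) :
    curvature (fun μ x => rotate m (A μ x)) x = fun μ ν => rotate m (curvature A x μ ν) := by
  funext μ ν
  have hd : ∀ μ v, fderiv ℝ (fun x => rotate m (A μ x)) x v = rotateL m (fderiv ℝ (A μ) x v) := by
    intro μ v
    have := ((rotateL m).hasFDerivAt.comp x (hA μ).hasFDerivAt).fderiv
    change fderiv ℝ ((rotateL m) ∘ (A μ)) x v = _
    rw [this]; rfl
  simp only [curvature, hd, rotate_commutator]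
  simp only [← rotateL_apply, map_sub, map_add]

theorem curvature_congr {A B : OneForm} {x : ℍ} (h : ∀ μ, A μ =ᶠ[𝓝 x] B μ) :
    curvature A x = curvature B x := by
  funext μ ν
  simp only [curvature, (h _).fderiv_eq, (h _).eq_of_nhds]

/-! ### The instanton in the radial gauge and its curvature matrix. -/

/-- The linear map `u ↦ Im (e μ ū)`. -/
def radialForm (μ : Fin 4) : ℍ →L[ℝ] ℍ :=
  LinearMap.toContinuousLinearMap
    { toFun := fun u => (e μ * star u).im
      map_add' := fun u v => by simp [mul_add]
      map_smul' := fun c u => by simp }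

theorem radialForm_apply (μ : Fin 4) (u : ℍ) : radialForm μ u = (e μ * star u).im := rfl

theorem normSq_eq_norm_sq (u : ℍ) : Quaternion.normSq u = ‖u‖ ^ 2 := by
  rw [Quaternion.normSq_eq_norm_mul_self, sq]

theorem hasFDerivAt_radialMap {y x : ℍ} (hx : x ≠ y) :
    HasFDerivAt (radialMap y) (‖x - y‖⁻¹ • ContinuousLinearMap.id ℝ ℍ -
      ((‖x - y‖ ^ 3)⁻¹ • innerSL ℝ (x - y)).smulRight (x - y)) x := by
  have h0 : x - y ≠ 0 := sub_ne_zero.2 hx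
  have hn : ‖x - y‖ ≠ 0 := norm_ne_zero_iff.2 h0
  have h1 : HasFDerivAt (fun x => x - y) (ContinuousLinearMap.id ℝ ℍ) x :=
    (hasFDerivAt_id x).sub_const y
  have h2 := h1.norm_sq.sqrt (by positivity)
  simp only [Real.sqrt_sq (norm_nonneg _)] at h2
  have h3 := ((hasDerivAt_inv hn).comp_hasFDerivAt x h2).smul h1
  refine h3.congr_fderiv ?_
  ext1 v
  simp only [add_apply, smul_apply,
    sub_apply, ContinuousLinearMap.smulRight_apply,
    ContinuousLinearMap.comp_apply, ContinuousLinearMap.id_apply]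
  rw [sub_eq_add_neg (‖x - y‖⁻¹ • v), ← neg_smul]
  congr 2
  simp only [smul_eq_mul, nsmul_eq_mul, Nat.cast_ofNat]
  field_simp

/-- With `u = x - y` and `N = |u|²`, the conjugated form is `Im(e ū)/(λ² + N)` and the pure gauge
term is `Im(e ū)/N`. The coefficient is the difference of the two factors. -/
theorem gaugeTransform_eq {y x : ℍ} {lam : ℝ} (hx : x ≠ y) (hl : lam ≠ 0) (μ : Fin 4) :
    gaugeTransform (radialMap y) (regularInstanton y lam) μ x =
      (-lam ^ 2 / (‖x - y‖ ^ 2 * (lam ^ 2 + ‖x - y‖ ^ 2))) • radialForm μ (x - y) := by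
  have h0 : x - y ≠ 0 := sub_ne_zero.2 hx
  have hn : ‖x - y‖ ≠ 0 := norm_ne_zero_iff.2 h0
  unfold gaugeTransform
  rw [(hasFDerivAt_radialMap hx).fderiv]
  simp only [regularInstanton, stdInstanton, radialMap, radialForm_apply]
  generalize x - y = u at *
  have hi : (‖u‖⁻¹ • u)⁻¹ = ‖u‖⁻¹ • star u := by
    rw [Quaternion.inv_def, Quaternion.normSq_smul, normSq_eq_norm_sq, Quaternion.star_smul, smul_smul]
    congr 1
    field_simp
  rw [hi]
  have hin : innerSL ℝ u (e μ) = (e μ * star u).re := by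
    rw [innerSL_apply_apply, real_inner_comm, Quaternion.inner_def]
  have key : u * (star u * e μ).im * star u = ‖u‖ ^ 2 • (e μ * star u).im := by
    rw [← normSq_eq_norm_sq, Quaternion.normSq_def']
    generalize e μ = v
    ext <;> simp <;> ring
  have hself : u * star u = (‖u‖ ^ 2) • (1 : ℍ) := by
    rw [Quaternion.self_mul_star, normSq_eq_norm_sq, ← Quaternion.coe_one, Quaternion.smul_coe, mul_one]
  simp only [sub_apply, smul_apply,
    ContinuousLinearMap.id_apply, ContinuousLinearMap.smulRight_apply, hin, Quaternion.star_smul,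
    smul_mul_assoc, mul_smul_comm, Quaternion.im_smul, sub_mul, key, hself, norm_smul, norm_inv, mul_pow,
    inv_pow, Real.norm_eq_abs, sq_abs]
  generalize e μ * star u = w
  have hp : lam ^ 2 + ‖u‖ ^ 2 ≠ 0 := by positivity
  ext
  · simp
    field_simp
    simp
  all_goals
    simp
    field_simp
    ring

theorem e_zero : e 0 = 1 := by ext <;> simp <;> rfl

/-- The matrix of `a ↦ u a ū` on imaginary quaternions. -/
def conjMatrix (u : ℍ) : Matrix (Fin 3) (Fin 3) ℝ :=
  !![u.re ^ 2 + u.imI ^ 2 - u.imJ ^ 2 - u.imK ^ 2, 2 * (u.imI * u.imJ - u.re * u.imK),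
      2 * (u.imI * u.imK + u.re * u.imJ);
    2 * (u.imI * u.imJ + u.re * u.imK), u.re ^ 2 - u.imI ^ 2 + u.imJ ^ 2 - u.imK ^ 2,
      2 * (u.imJ * u.imK - u.re * u.imI);
    2 * (u.imI * u.imK - u.re * u.imJ), 2 * (u.imJ * u.imK + u.re * u.imI),
      u.re ^ 2 - u.imI ^ 2 - u.imJ ^ 2 + u.imK ^ 2]

/-- The standard instanton in the radial gauge. -/
def radialInstanton (y : ℍ) (lam : ℝ) : OneForm := fun μ x =>
  (-lam ^ 2 / (‖x - y‖ ^ 2 * (lam ^ 2 + ‖x - y‖ ^ 2))) • radialForm μ (x - y)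

theorem hasFDerivAt_radialInstanton {y x : ℍ} {lam : ℝ} (hx : x ≠ y) (μ : Fin 4) :
    HasFDerivAt (radialInstanton y lam μ)
      ((-lam ^ 2 / (‖x - y‖ ^ 2 * (lam ^ 2 + ‖x - y‖ ^ 2))) • radialForm μ +
        ((2 * (lam ^ 2 * (lam ^ 2 + 2 * ‖x - y‖ ^ 2) /
          (‖x - y‖ ^ 2 * (lam ^ 2 + ‖x - y‖ ^ 2)) ^ 2)) • innerSL ℝ (x - y)).smulRight
            (radialForm μ (x - y))) x := by
  have h0 : x - y ≠ 0 := sub_ne_zero.2 hx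
  have hn : ‖x - y‖ ≠ 0 := norm_ne_zero_iff.2 h0
  have h1 : HasFDerivAt (fun x => x - y) (ContinuousLinearMap.id ℝ ℍ) x :=
    (hasFDerivAt_id x).sub_const y
  have hN := h1.norm_sq
  have hc : HasDerivAt (fun N : ℝ => -lam ^ 2 / (N * (lam ^ 2 + N)))
      (lam ^ 2 * (lam ^ 2 + 2 * ‖x - y‖ ^ 2) / (‖x - y‖ ^ 2 * (lam ^ 2 + ‖x - y‖ ^ 2)) ^ 2)
      (‖x - y‖ ^ 2) := by
    have hp : ‖x - y‖ ^ 2 * (lam ^ 2 + ‖x - y‖ ^ 2) ≠ 0 := by positivity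
    have := (hasDerivAt_const (‖x - y‖ ^ 2) (-lam ^ 2)).fun_div
      ((hasDerivAt_id' (‖x - y‖ ^ 2)).fun_mul ((hasDerivAt_id' (‖x - y‖ ^ 2)).const_add (lam ^ 2))) hp
    refine this.congr_deriv ?_
    congr 1
    ring
  refine ((hc.comp_hasFDerivAt x hN).smul ((radialForm μ).hasFDerivAt.comp x h1)).congr_fderiv ?_
  ext1 v
  simp [two_mul, add_smul, mul_add]

theorem curvature_radialInstanton {y x : ℍ} {lam : ℝ} (hx : x ≠ y) (μ ν : Fin 4) :
    curvature (radialInstanton y lam) x μ ν =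
      (-lam ^ 2 / (‖x - y‖ ^ 2 * (lam ^ 2 + ‖x - y‖ ^ 2))) •
        (radialForm ν (e μ) - radialForm μ (e ν)) +
      (2 * (lam ^ 2 * (lam ^ 2 + 2 * ‖x - y‖ ^ 2) /
          (‖x - y‖ ^ 2 * (lam ^ 2 + ‖x - y‖ ^ 2)) ^ 2)) •
        ((e μ * star (x - y)).re • radialForm ν (x - y) -
          (e ν * star (x - y)).re • radialForm μ (x - y)) +
      (-lam ^ 2 / (‖x - y‖ ^ 2 * (lam ^ 2 + ‖x - y‖ ^ 2))) ^ 2 •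
        (radialForm μ (x - y) * radialForm ν (x - y) -
          radialForm ν (x - y) * radialForm μ (x - y)) := by
  have hin : ∀ μ, innerSL ℝ (x - y) (e μ) = (e μ * star (x - y)).re := fun μ => by
    rw [innerSL_apply_apply, real_inner_comm, Quaternion.inner_def]
  simp only [curvature, (hasFDerivAt_radialInstanton hx _).fderiv, add_apply, smul_apply,
    ContinuousLinearMap.smulRight_apply, hin, radialInstanton, smul_mul_assoc, mul_smul_comm,
    smul_smul, smul_eq_mul]
  module

theorem isSkewIm_curvature {A : OneForm} {x : ℍ} (hA : ∀ μ, DifferentiableAt ℝ (A μ) x)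
    (hre : ∀ μ, ∀ᶠ z in 𝓝 x, (A μ z).re = 0) : IsSkewIm (curvature A x) where
  skew μ ν := by simp only [curvature]; abel
  im μ ν := by
    have h : ∀ μ v, (fderiv ℝ (A μ) x v).re = 0 := fun μ v => by
      let reL : ℍ →L[ℝ] ℝ := LinearMap.toContinuousLinearMap
        { toFun := fun q => q.re
          map_add' := fun _ _ => rfl
          map_smul' := fun _ _ => rfl }
      have h1 := reL.hasFDerivAt.comp x (hA μ).hasFDerivAt
      have h2 : HasFDerivAt (reL ∘ A μ) (0 : ℍ →L[ℝ] ℝ) x :=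
        (hasFDerivAt_const (0 : ℝ) x).congr_of_eventuallyEq (hre μ)
      exact DFunLike.congr_fun (h1.unique h2) v
    have h3 : ∀ a b : ℍ, (a * b - b * a).re = 0 := fun a b => by simp; ring
    simp [curvature, h, h3]

theorem e_one_re : (e 1).re = 0 := rfl
theorem e_one_imI : (e 1).imI = 1 := rfl
theorem e_one_imJ : (e 1).imJ = 0 := rfl
theorem e_one_imK : (e 1).imK = 0 := rfl
theorem e_two_re : (e 2).re = 0 := rfl
theorem e_two_imI : (e 2).imI = 0 := rfl
theorem e_two_imJ : (e 2).imJ = 1 := rfl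
theorem e_two_imK : (e 2).imK = 0 := rfl
theorem e_three_re : (e 3).re = 0 := rfl
theorem e_three_imI : (e 3).imI = 0 := rfl
theorem e_three_imJ : (e 3).imJ = 0 := rfl
theorem e_three_imK : (e 3).imK = 1 := rfl

theorem curvatureMatrix_apply (F : TwoFormAt) (hF : ∀ μ ν, F ν μ = -F μ ν) (a i : Fin 3) :
    curvatureMatrix F a i =
      (1 / 4) * imCoord (![F 0 1 - F 2 3, F 0 2 - F 3 1, F 0 3 - F 1 2] i) a := by
  have : curvatureMatrix F a i = (1 / 2) * imCoordₗ (asdPart F 0 i.succ) a := rfl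
  rw [this, asdPart_zero_succ F hF, map_smul, Pi.smul_apply, smul_eq_mul, ← mul_assoc]
  norm_num
  rfl

/-- Conceptually, in the regular gauge the matrix is `λ²/(λ² + N)²` times the identity, and the
gauge change conjugates by `u/|u|`, whose rotation matrix is `conjMatrix u / N`. The proof is the
direct computation in the singular gauge. -/
theorem curvatureMatrix_radialInstanton {y x : ℍ} {lam : ℝ} (hx : x ≠ y) (hl : lam ≠ 0) :
    curvatureMatrix (curvature (radialInstanton y lam) x) =
      (lam ^ 2 / ((lam ^ 2 + ‖x - y‖ ^ 2) ^ 2 * ‖x - y‖ ^ 2)) • conjMatrix (x - y) := by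
  have hn : ‖x - y‖ ≠ 0 := norm_ne_zero_iff.2 (sub_ne_zero.2 hx)
  ext a i
  rw [curvatureMatrix_apply _ (fun μ ν => by simp only [curvature]; abel)]
  simp only [curvature_radialInstanton hx, radialForm_apply]
  generalize x - y = u at *
  have hN : ‖u‖ ^ 2 = u.re ^ 2 + u.imI ^ 2 + u.imJ ^ 2 + u.imK ^ 2 := by
    rw [← normSq_eq_norm_sq, Quaternion.normSq_def']
  have hN0 : ‖u‖ ^ 2 ≠ 0 := by positivity
  have hp : lam ^ 2 + ‖u‖ ^ 2 ≠ 0 := by positivity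
  generalize ‖u‖ ^ 2 = N at *
  rw [e_zero]
  fin_cases a <;> fin_cases i <;>
  · simp [imCoord, conjMatrix, e_one_re, e_one_imI, e_one_imJ, e_one_imK, e_two_re, e_two_imI,
      e_two_imJ, e_two_imK, e_three_re, e_three_imI, e_three_imJ, e_three_imK]
    field_simp
    subst hN
    ring

theorem curvatureMatrix_add (F G : TwoFormAt) :
    curvatureMatrix (F + G) = curvatureMatrix F + curvatureMatrix G := by
  have h : asdPart (F + G) = asdPart F + asdPart G := by
    have : hodgeStar (F + G) = hodgeStar F + hodgeStar G := by
      funext μ ν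
      simp only [hodgeStar, Pi.add_apply, ← smul_add, ← Finset.sum_add_distrib]
      congr 1
      refine Finset.sum_congr rfl fun τ _ => ?_
      split_ifs <;> simp
    simp only [asdPart, this, ← smul_add]
    congr 1
    abel
  ext a i
  have key : ∀ H : TwoFormAt, curvatureMatrix H a i = (1 / 2) * imCoordₗ (asdPart H 0 i.succ) a :=
    fun _ => rfl
  simp only [key, h, Pi.add_apply, map_add, Matrix.add_apply]
  ring

theorem radialForm_re (μ : Fin 4) (u : ℍ) : (radialForm μ u).re = 0 := by
  rw [radialForm_apply]; rfl

theorem Fstd_eq {b : BubbleData} {x : ℍ} (hx : x ≠ b.1) (hl : b.2.1 ≠ 0) :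
    Fstd b x = fun μ ν => rotate b.2.2⁻¹ (curvature (radialInstanton b.1 b.2.1) x μ ν) := by
  rw [← curvature_rotate _ _ _ fun μ => (hasFDerivAt_radialInstanton hx μ).differentiableAt]
  refine curvature_congr fun μ => ?_
  filter_upwards [isOpen_ne.mem_nhds hx] with z hz
  rw [singularInstanton, gaugeTransform_eq hz hl]
  rfl

theorem isSkewIm_Fstd {b : BubbleData} {x : ℍ} (hx : x ≠ b.1) (hl : b.2.1 ≠ 0) :
    IsSkewIm (Fstd b x) := by
  have h : IsSkewIm (curvature (radialInstanton b.1 b.2.1) x) :=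
    isSkewIm_curvature (fun μ => (hasFDerivAt_radialInstanton hx μ).differentiableAt)
      fun μ => .of_forall fun z => by simp [radialInstanton, radialForm_re]
  rw [Fstd_eq hx hl]
  exact ⟨fun μ ν => by rw [h.skew, ← rotateL_apply, ← rotateL_apply, map_neg],
    fun μ ν => rfl⟩

theorem curvatureMatrix_rotate (m : SO3) (F : TwoFormAt) (hF : ∀ μ ν, F ν μ = -F μ ν) :
    curvatureMatrix (fun μ ν => rotate m (F μ ν)) =
      (m : Matrix (Fin 3) (Fin 3) ℝ) * curvatureMatrix F := by
  ext a i
  rw [curvatureMatrix_apply _ fun μ ν => by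
    rw [hF, ← rotateL_apply, ← rotateL_apply, map_neg]]
  have h1 : ![rotate m (F 0 1) - rotate m (F 2 3), rotate m (F 0 2) - rotate m (F 3 1),
      rotate m (F 0 3) - rotate m (F 1 2)] i =
      rotate m (![F 0 1 - F 2 3, F 0 2 - F 3 1, F 0 3 - F 1 2] i) := by
    simp only [← rotateL_apply, ← map_sub]
    fin_cases i <;> rfl
  rw [h1, imCoord_rotate]
  simp only [Matrix.mul_apply, curvatureMatrix_apply F hF, Matrix.mulVec, dotProduct,
    Finset.mul_sum]
  exact Finset.sum_congr rfl fun j _ => by ring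

theorem SO3.coe_inv (m : SO3) :
    ((m⁻¹ : SO3) : Matrix (Fin 3) (Fin 3) ℝ) = (m : Matrix (Fin 3) (Fin 3) ℝ).transpose := rfl

theorem totalMatrix_eq (A₀ : OneForm) {b : BubbleData} {x : ℍ} (hx : x ≠ b.1) (hl : b.2.1 ≠ 0) :
    totalMatrix A₀ x b = curvatureMatrix (curvature A₀ x) +
      (b.2.1 ^ 2 / ((b.2.1 ^ 2 + ‖x - b.1‖ ^ 2) ^ 2 * ‖x - b.1‖ ^ 2)) •
        ((b.2.2 : Matrix (Fin 3) (Fin 3) ℝ).transpose * conjMatrix (x - b.1)) := by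
  rw [totalMatrix, curvatureMatrix_add, Fstd_eq hx hl,
    curvatureMatrix_rotate _ _ fun μ ν => by simp only [curvature]; abel,
    curvatureMatrix_radialInstanton hx hl, SO3.coe_inv, Matrix.mul_smul]

/-! ### Linear algebra of the normal space to the rank-one matrices at `M + σ Q`. -/

/-- The matrix of the cross product with `z`. -/
def crossMat (z : Fin 3 → ℝ) : Matrix (Fin 3) (Fin 3) ℝ :=
  !![0, -z 2, z 1; z 2, 0, -z 0; -z 1, z 0, 0]

theorem crossMat_mulVec (z v : Fin 3 → ℝ) : (crossMat z).mulVec v = crossProduct z v := by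
  ext i
  fin_cases i <;> simp [crossMat, cross_apply, Matrix.mulVec, dotProduct, Fin.sum_univ_three] <;> ring

theorem SO3.transpose_mul_self (m : SO3) :
    (m : Matrix (Fin 3) (Fin 3) ℝ).transpose * (m : Matrix (Fin 3) (Fin 3) ℝ) = 1 :=
  (Matrix.mem_orthogonalGroup_iff' _ _).1 (Matrix.mem_specialOrthogonalGroup_iff.1 m.2).1

theorem SO3.mul_transpose_self (m : SO3) :
    (m : Matrix (Fin 3) (Fin 3) ℝ) * (m : Matrix (Fin 3) (Fin 3) ℝ).transpose = 1 :=
  (Matrix.mem_orthogonalGroup_iff _ _).1 (Matrix.mem_specialOrthogonalGroup_iff.1 m.2).1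

theorem SO3.det_eq (m : SO3) : (m : Matrix (Fin 3) (Fin 3) ℝ).det = 1 :=
  (Matrix.mem_specialOrthogonalGroup_iff.1 m.2).2

theorem SO3.cross_mulVec (m : SO3) (v w : Fin 3 → ℝ) :
    crossProduct ((m : Matrix (Fin 3) (Fin 3) ℝ).mulVec v)
      ((m : Matrix (Fin 3) (Fin 3) ℝ).mulVec w) =
      (m : Matrix (Fin 3) (Fin 3) ℝ).mulVec (crossProduct v w) := by
  have h := m.adjugate
  rw [Matrix.adjugate_fin_three] at h
  generalize (m : Matrix (Fin 3) (Fin 3) ℝ) = A at h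
  have e := fun i j => congrFun (congrFun h i) j
  have e00 := e 0 0
  have e01 := e 0 1
  have e02 := e 0 2
  have e10 := e 1 0
  have e11 := e 1 1
  have e12 := e 1 2
  have e20 := e 2 0
  have e21 := e 2 1
  have e22 := e 2 2
  simp at e00 e01 e02 e10 e11 e12 e20 e21 e22
  ext i
  fin_cases i <;> simp [cross_apply, Matrix.mulVec, dotProduct, Fin.sum_univ_three]
  · linear_combination (v 1 * w 2 - v 2 * w 1) * e00 + (v 2 * w 0 - v 0 * w 2) * e10 +
      (v 0 * w 1 - v 1 * w 0) * e20
  · linear_combination (v 1 * w 2 - v 2 * w 1) * e01 + (v 2 * w 0 - v 0 * w 2) * e11 +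
      (v 0 * w 1 - v 1 * w 0) * e21
  · linear_combination (v 1 * w 2 - v 2 * w 1) * e02 + (v 2 * w 0 - v 0 * w 2) * e12 +
      (v 0 * w 1 - v 1 * w 0) * e22

theorem SO3.crossMat_mul (m : SO3) (z : Fin 3 → ℝ) :
    crossMat ((m : Matrix (Fin 3) (Fin 3) ℝ).mulVec z) * (m : Matrix (Fin 3) (Fin 3) ℝ) =
      (m : Matrix (Fin 3) (Fin 3) ℝ) * crossMat z := by
  apply Matrix.ext_of_mulVec_single
  intro i
  rw [← Matrix.mulVec_mulVec, ← Matrix.mulVec_mulVec, crossMat_mulVec, crossMat_mulVec,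
    m.cross_mulVec]

/-- The matrix of `(δ, ζ) ↦ (fᵢ · (δ κⱼ + σ ζ × κⱼ))`. -/
def normalMatrix (σ : ℝ) (f κ : Fin 2 → Fin 3 → ℝ) : Matrix (Fin 4) (Fin 4) ℝ :=
  Matrix.of fun r => (fun i j => ![f i ⬝ᵥ κ j, σ * crossProduct (κ j) (f i) 0,
    σ * crossProduct (κ j) (f i) 1, σ * crossProduct (κ j) (f i) 2] : Fin 2 → Fin 2 → Fin 4 → ℝ)
      (![0, 0, 1, 1] r) (![0, 1, 0, 1] r)

/-- The sign does not depend on the frames: the determinant is `-σ³` times a squared length. Two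
such factors, one for each point, cancel their signs. -/
theorem det_normalMatrix (σ : ℝ) (f κ : Fin 2 → Fin 3 → ℝ) :
    (normalMatrix σ f κ).det = -σ ^ 3 *
      (crossProduct (crossProduct (f 0) (f 1)) (crossProduct (κ 0) (κ 1)) ⬝ᵥ
       crossProduct (crossProduct (f 0) (f 1)) (crossProduct (κ 0) (κ 1))) := by
  simp [normalMatrix, Matrix.det_succ_row_zero, Fin.sum_univ_succ, cross_apply,
    Fin.succAbove, dotProduct]
  ring

/-- The triple product identity `f · (ζ × κ) = ζ · (κ × f)` makes the four normal coordinates linear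
in the four parameters `δ` and `ζ`. -/
theorem normalCoord_eq (σ δ : ℝ) (f k : Fin 2 → Fin 3 → ℝ) (ζ : Fin 3 → ℝ)
    (Q : Matrix (Fin 3) (Fin 3) ℝ) :
    normalCoord f k (δ • Q + σ • (crossMat ζ * Q)) =
      (normalMatrix σ f fun j => Q.mulVec (k j)).mulVec ![δ, ζ 0, ζ 1, ζ 2] := by
  have h : ∀ i j, f i ⬝ᵥ (δ • Q + σ • (crossMat ζ * Q)).mulVec (k j) =
      ![f i ⬝ᵥ Q.mulVec (k j), σ * crossProduct (Q.mulVec (k j)) (f i) 0,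
        σ * crossProduct (Q.mulVec (k j)) (f i) 1, σ * crossProduct (Q.mulVec (k j)) (f i) 2] ⬝ᵥ
      ![δ, ζ 0, ζ 1, ζ 2] := fun i j => by
    rw [Matrix.add_mulVec, Matrix.smul_mulVec, Matrix.smul_mulVec, ← Matrix.mulVec_mulVec,
      crossMat_mulVec]
    generalize Q.mulVec (k j) = u
    simp [dotProduct, Fin.sum_univ_succ, cross_apply]
    ring
  ext r
  fin_cases r
  exacts [h 0 0, h 0 1, h 1 0, h 1 1]

/-- A division-free form of "`a` is the multiple `(a · b)/(b · b)` of `b`". -/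
theorem dot_mul_dot_of_cross_eq_zero {a b : Fin 3 → ℝ} (h : crossProduct a b = 0) (w : Fin 3 → ℝ) :
    (b ⬝ᵥ b) * (a ⬝ᵥ w) = (a ⬝ᵥ b) * (b ⬝ᵥ w) := by
  have h0 := congrFun h 0
  have h1 := congrFun h 1
  have h2 := congrFun h 2
  simp [cross_apply] at h0 h1 h2
  simp only [dotProduct, Fin.sum_univ_three]
  linear_combination (w 1 * b 2 - w 2 * b 1) * h0 + (w 2 * b 0 - w 0 * b 2) * h1 +
    (w 0 * b 1 - w 1 * b 0) * h2

theorem cross_cross_eq_zero {z a b : Fin 3 → ℝ} (ha : a ⬝ᵥ z = 0) (hb : b ⬝ᵥ z = 0) :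
    crossProduct z (crossProduct a b) = 0 := by
  simp only [dotProduct, Fin.sum_univ_three] at ha hb
  ext i
  fin_cases i <;> simp [cross_apply]
  · linear_combination (a 0) * hb - (b 0) * ha
  · linear_combination (a 1) * hb - (b 1) * ha
  · linear_combination (a 2) * hb - (b 2) * ha

theorem eq_zero_of_dot_cross {z a b : Fin 3 → ℝ} (ha : a ⬝ᵥ z = 0) (hb : b ⬝ᵥ z = 0)
    (hab : crossProduct a b ⬝ᵥ z = 0) (h : crossProduct a b ≠ 0) : z = 0 := by
  have h1 := dot_mul_dot_of_cross_eq_zero (cross_cross_eq_zero ha hb) z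
  rw [hab, mul_zero] at h1
  have h2 : crossProduct a b ⬝ᵥ crossProduct a b ≠ 0 := fun h0 => h (dotProduct_self_eq_zero.1 h0)
  exact dotProduct_self_eq_zero.1 ((mul_eq_zero.1 h1).resolve_left h2)

theorem cross_ne_zero_of_linearIndependent {f : Fin 2 → Fin 3 → ℝ} (h : LinearIndependent ℝ f) :
    crossProduct (f 0) (f 1) ≠ 0 := by
  rw [crossProduct_ne_zero_iff_linearIndependent]
  rwa [← List.ofFn_inj.1 (by simp : List.ofFn f = List.ofFn ![f 0, f 1])]

/-- The singular values of `M` are distinct: the eigenspaces of `Mᵀ M` are lines. -/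
def HasSimpleSpectrum (M : Matrix (Fin 3) (Fin 3) ℝ) : Prop :=
  ∀ (μ : ℝ) (u w : Fin 3 → ℝ), (M.transpose * M).mulVec u = μ • u →
    (M.transpose * M).mulVec w = μ • w → crossProduct u w = 0

theorem SO3.dot_mulVec (m : SO3) (v w : Fin 3 → ℝ) :
    (m : Matrix (Fin 3) (Fin 3) ℝ).mulVec v ⬝ᵥ (m : Matrix (Fin 3) (Fin 3) ℝ).mulVec w = v ⬝ᵥ w := by
  rw [Matrix.dotProduct_mulVec, ← Matrix.mulVec_transpose, Matrix.mulVec_mulVec,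
    m.transpose_mul_self, Matrix.one_mulVec]

theorem dot_transpose_mul_self (M : Matrix (Fin 3) (Fin 3) ℝ) (v w : Fin 3 → ℝ) :
    v ⬝ᵥ (M.transpose * M).mulVec w = M.mulVec v ⬝ᵥ M.mulVec w := by
  rw [← Matrix.mulVec_mulVec, Matrix.dotProduct_mulVec, Matrix.vecMul_transpose]

/-- The first cross product spans the image of `W = M + σ Q`. If it were parallel to `Q n`, with `n`
normal to the kernel plane, then `W n` would be orthogonal to `Q k`, hence `M n` to `M k`, for all
`k` in that plane. As `M = -σ Q` on the plane, the plane would consist of eigenvectors of `Mᵀ M` for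
`σ²`, a double eigenvalue. -/
theorem normal_cross_ne_zero {M : Matrix (Fin 3) (Fin 3) ℝ} (hM : HasSimpleSpectrum M) {σ : ℝ}
    (Q : SO3) {f k : Fin 2 → Fin 3 → ℝ}
    (h : IsNormalFrame (M + σ • (Q : Matrix (Fin 3) (Fin 3) ℝ)) f k) :
    crossProduct (crossProduct (f 0) (f 1))
      (crossProduct ((Q : Matrix (Fin 3) (Fin 3) ℝ).mulVec (k 0))
        ((Q : Matrix (Fin 3) (Fin 3) ℝ).mulVec (k 1))) ≠ 0 := by
  intro h0
  rw [Q.cross_mulVec] at h0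
  have hF := cross_ne_zero_of_linearIndependent h.indep_form
  have hn := cross_ne_zero_of_linearIndependent h.indep_ker
  set F := crossProduct (f 0) (f 1) with hFdef
  set n := crossProduct (k 0) (k 1) with hndef
  have hkn : ∀ j, k j ⬝ᵥ n = 0 := by
    rw [Fin.forall_fin_two]; exact ⟨dot_self_cross _ _, dot_cross_self _ _⟩
  have hMk : ∀ j, M.mulVec (k j) = -(σ • (Q : Matrix (Fin 3) (Fin 3) ℝ).mulVec (k j)) := fun j => by
    have := h.ker j
    rw [Matrix.add_mulVec, Matrix.smul_mulVec] at this
    exact eq_neg_of_add_eq_zero_left this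
  set W := M + σ • (Q : Matrix (Fin 3) (Fin 3) ℝ) with hW
  have hMn : M.mulVec n = W.mulVec n - σ • (Q : Matrix (Fin 3) (Fin 3) ℝ).mulVec n := by
    rw [hW, Matrix.add_mulVec, Matrix.smul_mulVec]; simp
  have hfW : ∀ i, f i ⬝ᵥ W.mulVec n = 0 := fun i => by
    rw [Matrix.dotProduct_mulVec, h.form_image, zero_dotProduct]
  have hWk : ∀ j, W.mulVec n ⬝ᵥ (Q : Matrix (Fin 3) (Fin 3) ℝ).mulVec (k j) = 0 := fun j => by
    have h1 := dot_mul_dot_of_cross_eq_zero h0 ((Q : Matrix (Fin 3) (Fin 3) ℝ).mulVec (k j))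
    rw [Q.dot_mulVec, Q.dot_mulVec, dotProduct_comm n (k j), hkn, mul_zero] at h1
    have h2 := (mul_eq_zero.1 h1).resolve_left fun h0 => hn (dotProduct_self_eq_zero.1 h0)
    have h3 := dot_mul_dot_of_cross_eq_zero (cross_cross_eq_zero (hfW 0) (hfW 1))
      ((Q : Matrix (Fin 3) (Fin 3) ℝ).mulVec (k j))
    rw [← hFdef, h2, mul_zero] at h3
    exact (mul_eq_zero.1 h3).resolve_left fun h0 => hF (dotProduct_self_eq_zero.1 h0)
  have heig : ∀ j, (M.transpose * M).mulVec (k j) = σ ^ 2 • k j := fun j => by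
    rw [← sub_eq_zero]
    have hk : ∀ i, k i ⬝ᵥ ((M.transpose * M).mulVec (k j) - σ ^ 2 • k j) = 0 := fun i => by
      rw [dotProduct_sub, dot_transpose_mul_self, hMk, hMk, dotProduct_smul, neg_dotProduct_neg,
        smul_dotProduct, dotProduct_smul, Q.dot_mulVec]
      simp only [smul_eq_mul]; ring
    refine eq_zero_of_dot_cross (hk 0) (hk 1) ?_ hn
    rw [← hndef, dotProduct_sub, dot_transpose_mul_self, hMk, hMn, dotProduct_smul,
      dotProduct_comm n, hkn, dotProduct_neg, dotProduct_smul, sub_dotProduct, smul_dotProduct, hWk,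
      Q.dot_mulVec, dotProduct_comm n, hkn]
    simp
  exact hn (hM _ _ _ (heig 0) (heig 1))

/-- Otherwise `M` would be a multiple of a rotation, with all singular values equal. This upgrades
rank at most one to rank exactly one. -/
theorem add_smul_ne_zero {M : Matrix (Fin 3) (Fin 3) ℝ} (hM : HasSimpleSpectrum M) (σ : ℝ)
    (Q : SO3) : M + σ • (Q : Matrix (Fin 3) (Fin 3) ℝ) ≠ 0 := by
  intro h
  have h1 : M = -(σ • (Q : Matrix (Fin 3) (Fin 3) ℝ)) := eq_neg_of_add_eq_zero_left h
  have h2 : ∀ v, (M.transpose * M).mulVec v = σ ^ 2 • v := fun v => by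
    rw [h1, Matrix.transpose_neg, Matrix.transpose_smul, neg_mul_neg, Matrix.smul_mul,
      Matrix.mul_smul, Q.transpose_mul_self, smul_smul, Matrix.smul_mulVec, Matrix.one_mulVec, sq]
  have h3 := congrFun (hM _ _ _ (h2 ![1, 0, 0]) (h2 ![0, 1, 0])) 2
  simp [cross_apply] at h3

theorem det_normalMatrix_neg {M : Matrix (Fin 3) (Fin 3) ℝ} (hM : HasSimpleSpectrum M) {σ : ℝ}
    (hσ : 0 < σ) (Q : SO3) {f k : Fin 2 → Fin 3 → ℝ}
    (h : IsNormalFrame (M + σ • (Q : Matrix (Fin 3) (Fin 3) ℝ)) f k) :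
    (normalMatrix σ f fun j => (Q : Matrix (Fin 3) (Fin 3) ℝ).mulVec (k j)).det < 0 := by
  rw [det_normalMatrix]
  have h1 := normal_cross_ne_zero hM Q h
  set z := crossProduct (crossProduct (f 0) (f 1))
      (crossProduct ((Q : Matrix (Fin 3) (Fin 3) ℝ).mulVec (k 0))
        ((Q : Matrix (Fin 3) (Fin 3) ℝ).mulVec (k 1)))
  have h2 : 0 ≤ z ⬝ᵥ z := by
    simp only [dotProduct, Fin.sum_univ_three]; nlinarith [sq_nonneg (z 0), sq_nonneg (z 1), sq_nonneg (z 2)]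
  have h3 : 0 < z ⬝ᵥ z := lt_of_le_of_ne h2 fun h0 => h1 (dotProduct_self_eq_zero.1 h0.symm)
  have : 0 < σ ^ 3 * (z ⬝ᵥ z) := by positivity
  linarith

/-! ### Conjugation by quaternions, and the bubble as a scale times a rotation. -/

theorem norm_sq_eq (u : ℍ) : ‖u‖ ^ 2 = u.re ^ 2 + u.imI ^ 2 + u.imJ ^ 2 + u.imK ^ 2 := by
  rw [← normSq_eq_norm_sq, Quaternion.normSq_def']

theorem conjMatrix_mul (u v : ℍ) : conjMatrix (u * v) = conjMatrix u * conjMatrix v := by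
  ext i j
  fin_cases i <;> fin_cases j <;>
    simp [conjMatrix, Matrix.mul_apply, Fin.sum_univ_three] <;> ring

theorem conjMatrix_star (u : ℍ) : conjMatrix (star u) = (conjMatrix u).transpose := by
  ext i j
  fin_cases i <;> fin_cases j <;> simp [conjMatrix] <;> ring

theorem conjMatrix_smul (t : ℝ) (u : ℍ) : conjMatrix (t • u) = t ^ 2 • conjMatrix u := by
  ext i j
  fin_cases i <;> fin_cases j <;> simp [conjMatrix] <;> ring

theorem conjMatrix_one : conjMatrix 1 = 1 := by
  ext i j
  fin_cases i <;> fin_cases j <;> simp [conjMatrix]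

theorem conjMatrix_mul_transpose (u : ℍ) :
    conjMatrix u * (conjMatrix u).transpose = (‖u‖ ^ 2) ^ 2 • 1 := by
  have : u * star u = (‖u‖ ^ 2) • (1 : ℍ) := by
    rw [Quaternion.self_mul_star, normSq_eq_norm_sq, ← Quaternion.coe_one, Quaternion.smul_coe,
      mul_one]
  rw [← conjMatrix_star, ← conjMatrix_mul, this, conjMatrix_smul, conjMatrix_one]

theorem det_conjMatrix (u : ℍ) : (conjMatrix u).det = (‖u‖ ^ 2) ^ 3 := by
  rw [norm_sq_eq]
  simp [conjMatrix, Matrix.det_fin_three]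
  ring

theorem conjSO3_mem {u : ℍ} (hu : u ≠ 0) :
    (‖u‖ ^ 2)⁻¹ • conjMatrix u ∈ Matrix.specialOrthogonalGroup (Fin 3) ℝ := by
  have hn : ‖u‖ ≠ 0 := norm_ne_zero_iff.2 hu
  rw [Matrix.mem_specialOrthogonalGroup_iff, Matrix.mem_orthogonalGroup_iff]
  constructor
  · change _ * ((‖u‖ ^ 2)⁻¹ • conjMatrix u).transpose = 1
    rw [Matrix.transpose_smul, Matrix.smul_mul, Matrix.mul_smul, conjMatrix_mul_transpose,
      smul_smul, smul_smul]
    field_simp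
    simp
  · rw [Matrix.det_smul, det_conjMatrix, Fintype.card_fin]
    field_simp

open Classical in
/-- The rotation `a ↦ u a u⁻¹` of imaginary quaternions. -/
def conjSO3 (u : ℍ) : SO3 := if h : u = 0 then 1 else ⟨(‖u‖ ^ 2)⁻¹ • conjMatrix u, conjSO3_mem h⟩

theorem coe_conjSO3 {u : ℍ} (hu : u ≠ 0) :
    (conjSO3 u : Matrix (Fin 3) (Fin 3) ℝ) = (‖u‖ ^ 2)⁻¹ • conjMatrix u := by
  rw [conjSO3, dif_neg hu]

/-- The scale of the curvature at squared distance `N` from the centre. -/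
def bubbleScale (lam N : ℝ) : ℝ := lam ^ 2 / (lam ^ 2 + N) ^ 2

/-- This separates the bubble into a positive scale, which sees only the size and the distance, and
a rotation, which sees only the gluing angle and the direction. -/
theorem totalMatrix_eq_scale (A₀ : OneForm) {b : BubbleData} {x : ℍ} (hx : b.1 ≠ x)
    (hl : b.2.1 ≠ 0) :
    totalMatrix A₀ x b = curvatureMatrix (curvature A₀ x) + bubbleScale b.2.1 (‖x - b.1‖ ^ 2) •
      ((b.2.2⁻¹ * conjSO3 (x - b.1) : SO3) : Matrix (Fin 3) (Fin 3) ℝ) := by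
  have hu : x - b.1 ≠ 0 := sub_ne_zero.2 hx.symm
  rw [totalMatrix_eq A₀ hx.symm hl, Submonoid.coe_mul, coe_conjSO3 hu, SO3.coe_inv,
    Matrix.mul_smul, smul_smul, bubbleScale]
  congr 2
  have hn : ‖x - b.1‖ ≠ 0 := norm_ne_zero_iff.2 hu
  have : b.2.1 ^ 2 + ‖x - b.1‖ ^ 2 ≠ 0 := by positivity
  field_simp

/-! ### The differential of the total matrix in the coordinates of `bubbleChart`. -/

/-- The derivative of the scale along the coordinates of `bubbleChart`. -/
def scaleDeriv (P : ℍ) (lam : ℝ) : Fin 4 ⊕ Fin 4 → ℝ :=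
  Sum.elim (fun μ => 2 * lam ^ 2 / (lam ^ 2 + ‖P‖ ^ 2) ^ 3 * (2 * (e μ * star P).re))
    ![2 * lam ^ 2 / (lam ^ 2 + ‖P‖ ^ 2) ^ 3 * ((‖P‖ ^ 2 - lam ^ 2) / lam), 0, 0, 0]

/-- The infinitesimal rotation along the coordinates of `bubbleChart`. -/
def rotationDeriv (m : SO3) (P : ℍ) : Fin 4 ⊕ Fin 4 → Fin 3 → ℝ :=
  Sum.elim (fun μ => (m : Matrix (Fin 3) (Fin 3) ℝ).transpose.mulVec
      ((-(2 / ‖P‖ ^ 2)) • imCoord (e μ * star P)))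
    ![0, -Pi.single 0 1, -Pi.single 1 1, -Pi.single 2 1]

theorem axisRotation_zero (a : Fin 3) : axisRotation 0 a = 1 := by
  apply Subtype.ext
  change axisRotationMatrix 0 a = 1
  fin_cases a <;> ext i j <;> fin_cases i <;> fin_cases j <;> simp [axisRotationMatrix]

/-- Since `fderiv` is zero where there is no derivative, this is what allows the columns of
`differential` to be computed along coordinate lines. -/
theorem differentiableAt_bubbleChart (A₀ : OneForm) {b : BubbleData} {x : ℍ} (hx : b.1 ≠ x)
    (hl : b.2.1 ≠ 0) (a i : Fin 3) :
    DifferentiableAt ℝ (fun w => totalMatrix A₀ x (bubbleChart b w) a i) 0 := by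
  have hN : ∀ w : Fin 8 → ℝ, ‖x - (bubbleChart b w).1‖ ^ 2 =
      (x.re - (b.1.re + w 0)) ^ 2 + (x.imI - (b.1.imI + w 1)) ^ 2 +
        (x.imJ - (b.1.imJ + w 2)) ^ 2 + (x.imK - (b.1.imK + w 3)) ^ 2 := fun w => by
    rw [norm_sq_eq]; rfl
  have h0 : (bubbleChart b 0) = b := by
    refine Prod.ext ?_ (Prod.ext ?_ ?_)
    · exact add_zero b.1
    · simp [bubbleChart]
    · simp [bubbleChart, axisRotation_zero]
  have hNd : Differentiable ℝ fun w : Fin 8 → ℝ => ‖x - (bubbleChart b w).1‖ ^ 2 := by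
    simp only [hN]; fun_prop
  have hN0 : ‖x - (bubbleChart b 0).1‖ ^ 2 ≠ 0 := by
    rw [h0]; exact pow_ne_zero _ (norm_ne_zero_iff.2 (sub_ne_zero.2 hx.symm))
  have hld : Differentiable ℝ fun w : Fin 8 → ℝ => (bubbleChart b w).2.1 := by
    simp only [bubbleChart]; fun_prop
  have hl0 : (bubbleChart b 0).2.1 ≠ 0 := by rw [h0]; exact hl
  have hC : ∀ j k, Differentiable ℝ fun w : Fin 8 → ℝ => conjMatrix (x - (bubbleChart b w).1) j k := by
    intro j k
    have h1 : ∀ w, (x - (bubbleChart b w).1).re = x.re - (b.1.re + w 0) := fun _ => rfl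
    have h2 : ∀ w, (x - (bubbleChart b w).1).imI = x.imI - (b.1.imI + w 1) := fun _ => rfl
    have h3 : ∀ w, (x - (bubbleChart b w).1).imJ = x.imJ - (b.1.imJ + w 2) := fun _ => rfl
    have h4 : ∀ w, (x - (bubbleChart b w).1).imK = x.imK - (b.1.imK + w 3) := fun _ => rfl
    fin_cases j <;> fin_cases k <;> simp only [conjMatrix, h1, h2, h3, h4] <;> simp <;> fun_prop
  have hR : ∀ j k, Differentiable ℝ fun w : Fin 8 → ℝ =>
      ((bubbleChart b w).2.2 : Matrix (Fin 3) (Fin 3) ℝ) j k := by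
    have hax : ∀ (d : Fin 8) (c j k : Fin 3), Differentiable ℝ fun w : Fin 8 → ℝ =>
        axisRotationMatrix (w d) c j k := by
      intro d c j k
      fin_cases c <;> fin_cases j <;> fin_cases k <;> simp [axisRotationMatrix] <;> fun_prop
    have hmul : ∀ A B : (Fin 8 → ℝ) → Matrix (Fin 3) (Fin 3) ℝ,
        (∀ j k, Differentiable ℝ fun w => A w j k) → (∀ j k, Differentiable ℝ fun w => B w j k) →
        ∀ j k, Differentiable ℝ fun w => (A w * B w) j k := by
      intro A B hA hB j k
      simp only [Matrix.mul_apply]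
      fun_prop
    intro j k
    exact hmul _ _ (hmul _ _ (hmul (fun _ => (b.2.2 : Matrix (Fin 3) (Fin 3) ℝ)) _
      (fun _ _ => differentiable_const _) (hax 5 0)) (hax 6 1)) (hax 7 2) j k
  -- The rational formula holds only for centres different from `x` and nonzero sizes, which is an
  -- open condition around `b`.
  have hev : (fun w => totalMatrix A₀ x (bubbleChart b w) a i) =ᶠ[𝓝 0] fun w =>
      curvatureMatrix (curvature A₀ x) a i + ((bubbleChart b w).2.1 ^ 2 /
        (((bubbleChart b w).2.1 ^ 2 + ‖x - (bubbleChart b w).1‖ ^ 2) ^ 2 *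
          ‖x - (bubbleChart b w).1‖ ^ 2)) *
        ∑ j, ((bubbleChart b w).2.2 : Matrix (Fin 3) (Fin 3) ℝ) j a *
          conjMatrix (x - (bubbleChart b w).1) j i := by
    filter_upwards [hNd.continuous.continuousAt.eventually_ne hN0,
      hld.continuous.continuousAt.eventually_ne hl0] with w hw1 hw2
    have hw : x ≠ (bubbleChart b w).1 := fun h => hw1 (by rw [← h]; simp)
    rw [totalMatrix_eq A₀ hw hw2]
    simp [Matrix.mul_apply]
  refine DifferentiableAt.congr_of_eventuallyEq ?_ hev
  have hden : ((bubbleChart b 0).2.1 ^ 2 + ‖x - (bubbleChart b 0).1‖ ^ 2) ^ 2 *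
          ‖x - (bubbleChart b 0).1‖ ^ 2 ≠ 0 := by
    have : 0 < (bubbleChart b 0).2.1 ^ 2 := by positivity
    positivity
  have hN' := hNd.differentiableAt (x := 0)
  have hl' := hld.differentiableAt (x := 0)
  have hs : DifferentiableAt ℝ (fun w : Fin 8 → ℝ =>
      ∑ j, ((bubbleChart b w).2.2 : Matrix (Fin 3) (Fin 3) ℝ) j a *
        conjMatrix (x - (bubbleChart b w).1) j i) 0 :=
    DifferentiableAt.fun_sum fun j _ =>
      (hR j a).differentiableAt.fun_mul (hC j i).differentiableAt
  have hdn := (((hl'.fun_pow 2).fun_add hN').fun_pow 2).fun_mul hN'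
  have hq := (hl'.fun_pow 2).fun_mul (hdn.inv hden)
  simp only [div_eq_mul_inv]
  exact (differentiableAt_const _).fun_add (hq.fun_mul hs)

/-- The bubble data at parameter `t` on the `c`-th coordinate line of `bubbleChart b`. -/
def coordLine (b : BubbleData) (t : ℝ) : Fin 4 ⊕ Fin 4 → BubbleData :=
  Sum.elim (fun μ => (b.1 + t • e μ, b.2.1, b.2.2))
    ![(b.1, b.2.1 + t, b.2.2), (b.1, b.2.1, b.2.2 * axisRotation t 0),
      (b.1, b.2.1, b.2.2 * axisRotation t 1), (b.1, b.2.1, b.2.2 * axisRotation t 2)]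

theorem bubbleChart_single (b : BubbleData) (t : ℝ) (c : Fin 4 ⊕ Fin 4) :
    bubbleChart b (t • Pi.single (finSumFinEquiv c) 1) = coordLine b t c := by
  have hz : (⟨0, 0, 0, 0⟩ : ℍ) = 0 := rfl
  have he : (⟨t, 0, 0, 0⟩ : ℍ) = t • e 0 ∧ (⟨0, t, 0, 0⟩ : ℍ) = t • e 1 ∧
      (⟨0, 0, t, 0⟩ : ℍ) = t • e 2 ∧ (⟨0, 0, 0, t⟩ : ℍ) = t • e 3 := by
    refine ⟨?_, ?_, ?_, ?_⟩ <;> ext <;> simp [e_zero, e_one_re, e_one_imI, e_one_imJ, e_one_imK,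
      e_two_re, e_two_imI, e_two_imJ, e_two_imK, e_three_re, e_three_imI, e_three_imJ, e_three_imK]
  rcases c with c | c <;> fin_cases c <;>
    simp [bubbleChart, coordLine, axisRotation_zero, finSumFinEquiv, hz, he, Fin.ext_iff] <;>
    exact add_zero b.1

theorem hasDerivAt_conjMatrix (P v : ℍ) (j i : Fin 3) :
    HasDerivAt (fun t : ℝ => conjMatrix (P - t • v) j i)
      (-(conjMatrix (P + v) - conjMatrix P - conjMatrix v) j i) 0 := by
  have h : (fun t : ℝ => conjMatrix (P - t • v) j i) = fun t => conjMatrix P j i -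
      t * (conjMatrix (P + v) - conjMatrix P - conjMatrix v) j i + t ^ 2 * conjMatrix v j i := by
    funext t
    fin_cases i <;> fin_cases j <;> simp [conjMatrix] <;> ring
  rw [h]
  have := ((hasDerivAt_const (0 : ℝ) (conjMatrix P j i)).fun_sub ((hasDerivAt_id' (0 : ℝ)).mul_const
    ((conjMatrix (P + v) - conjMatrix P - conjMatrix v) j i))).fun_add
      (((hasDerivAt_id' (0 : ℝ)).fun_pow 2).mul_const (conjMatrix v j i))
  refine this.congr_deriv ?_
  simp

/-- Write `v = (v P̄ / |P|²) P`. Left multiplication by a quaternion near `1` dilates through its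
real part and rotates through its imaginary part, with the factor `2` of the double cover. The
identity is multiplied by `|P|²` to avoid division. -/
theorem conjMatrix_polarization (P v : ℍ) :
    ‖P‖ ^ 2 • (conjMatrix (P + v) - conjMatrix P - conjMatrix v) =
      (2 * (v * star P).re) • conjMatrix P +
        (2 : ℝ) • (crossMat (imCoord (v * star P)) * conjMatrix P) := by
  rw [norm_sq_eq]
  ext i j
  fin_cases i <;> fin_cases j <;>
    simp [conjMatrix, crossMat, imCoord] <;> ring

theorem hasDerivAt_norm_sq_sub (P v : ℍ) :
    HasDerivAt (fun t : ℝ => ‖P - t • v‖ ^ 2) (-(2 * (v * star P).re)) 0 := by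
  have h : (fun t : ℝ => ‖P - t • v‖ ^ 2) = fun t => ‖P‖ ^ 2 - t * (2 * (v * star P).re) +
      t ^ 2 * ‖v‖ ^ 2 := by
    funext t
    simp only [norm_sq_eq]
    simp
    ring
  rw [h]
  have := ((hasDerivAt_const (0 : ℝ) (‖P‖ ^ 2)).fun_sub ((hasDerivAt_id' (0 : ℝ)).mul_const
    (2 * (v * star P).re))).fun_add (((hasDerivAt_id' (0 : ℝ)).fun_pow 2).mul_const (‖v‖ ^ 2))
  refine this.congr_deriv ?_
  simp

theorem crossMat_smul (c : ℝ) (z : Fin 3 → ℝ) : crossMat (c • z) = c • crossMat z := by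
  ext i j
  fin_cases i <;> fin_cases j <;> simp [crossMat]

/-- The derivative of `totalMatrix` along the coordinates of `bubbleChart`. -/
def totalDeriv (b : BubbleData) (x : ℍ) (c : Fin 4 ⊕ Fin 4) : Matrix (Fin 3) (Fin 3) ℝ :=
  scaleDeriv (x - b.1) b.2.1 c • ((b.2.2⁻¹ * conjSO3 (x - b.1) : SO3) : Matrix (Fin 3) (Fin 3) ℝ) +
    bubbleScale b.2.1 (‖x - b.1‖ ^ 2) • (crossMat (rotationDeriv b.2.2 (x - b.1) c) *
      ((b.2.2⁻¹ * conjSO3 (x - b.1) : SO3) : Matrix (Fin 3) (Fin 3) ℝ))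

theorem hasDerivAt_axisRotation (k j i : Fin 3) :
    HasDerivAt (fun t => (axisRotation t k : Matrix (Fin 3) (Fin 3) ℝ) j i)
      (crossMat (Pi.single k 1) j i) 0 := by
  have hc : HasDerivAt Real.cos 0 0 := by simpa using Real.hasDerivAt_cos 0
  have hs : HasDerivAt Real.sin 1 0 := by simpa using Real.hasDerivAt_sin 0
  have hs' : HasDerivAt (fun t => -Real.sin t) (-1) 0 := hs.fun_neg
  have h : (fun t => (axisRotation t k : Matrix (Fin 3) (Fin 3) ℝ) j i) =
    fun t => axisRotationMatrix t k j i := rfl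
  rw [h]
  fin_cases k <;> fin_cases j <;> fin_cases i <;>
    simp [axisRotationMatrix, crossMat, hc, hs, hs', hasDerivAt_const]

theorem hasDerivAt_coordLine (A₀ : OneForm) {b : BubbleData} {x : ℍ} (hx : b.1 ≠ x)
    (hl : b.2.1 ≠ 0) (c : Fin 4 ⊕ Fin 4) (a i : Fin 3) :
    HasDerivAt (fun t => totalMatrix A₀ x (coordLine b t c) a i) (totalDeriv b x c a i) 0 := by
  obtain ⟨y, lam, m⟩ := b
  simp only at hx hl
  have hP : x - y ≠ 0 := sub_ne_zero.2 hx.symm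
  have hn : ‖x - y‖ ≠ 0 := norm_ne_zero_iff.2 hP
  have hd : lam ^ 2 + ‖x - y‖ ^ 2 ≠ 0 := by positivity
  rcases c with μ | c
  · have hnd := hasDerivAt_norm_sq_sub (x - y) (e μ)
    have hev : (fun t => totalMatrix A₀ x (coordLine (y, lam, m) t (.inl μ)) a i) =ᶠ[𝓝 0] fun t =>
        curvatureMatrix (curvature A₀ x) a i + (lam ^ 2 / ((lam ^ 2 + ‖(x - y) - t • e μ‖ ^ 2) ^ 2 *
          ‖(x - y) - t • e μ‖ ^ 2)) *
        ∑ j, (m : Matrix (Fin 3) (Fin 3) ℝ) j a * conjMatrix ((x - y) - t • e μ) j i := by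
      have hne : ∀ᶠ t : ℝ in 𝓝 0, ‖x - y - t • e μ‖ ^ 2 ≠ 0 :=
        hnd.continuousAt.eventually_ne (by simpa using hP)
      filter_upwards [hne] with t ht
      have hw : x ≠ y + t • e μ := fun h => ht (by rw [sub_sub, ← h]; simp)
      rw [totalMatrix_eq A₀ (b := coordLine (y, lam, m) t (.inl μ)) hw hl]
      simp [coordLine, Matrix.mul_apply, sub_sub]
    refine HasDerivAt.congr_of_eventuallyEq ?_ hev
    have hsum : HasDerivAt (fun t : ℝ => ∑ j, (m : Matrix (Fin 3) (Fin 3) ℝ) j a *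
        conjMatrix ((x - y) - t • e μ) j i) _ 0 :=
      HasDerivAt.fun_sum fun j _ => (hasDerivAt_conjMatrix (x - y) (e μ) j i).const_mul _
    have hg := (hasDerivAt_const (0 : ℝ) (lam ^ 2)).fun_div
      (((hnd.const_add (lam ^ 2)).fun_pow 2).fun_mul hnd) (by simpa using ⟨hd, hP⟩)
    refine ((hg.fun_mul hsum).const_add (curvatureMatrix (curvature A₀ x) a i)).congr_deriv ?_
    have hB : ∀ j, -(conjMatrix (x - y + e μ) - conjMatrix (x - y) - conjMatrix (e μ)) j i =
        -(1 / ‖x - y‖ ^ 2) * ((2 * (e μ * star (x - y)).re) * conjMatrix (x - y) j i +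
        2 * (crossMat (imCoord (e μ * star (x - y))) * conjMatrix (x - y)) j i) := fun j => by
      have := congrFun (congrFun (conjMatrix_polarization (x - y) (e μ)) j) i
      simp only [Matrix.smul_apply, Matrix.add_apply, smul_eq_mul] at this
      rw [← this]; field_simp
    -- The infinitesimal rotation arises between `mᵀ` and `conjMatrix`; moving it to the left of
    -- `mᵀ` rotates its axis by `mᵀ`.
    have hcr := (m⁻¹).crossMat_mul ((-(2 / ‖x - y‖ ^ 2)) • imCoord (e μ * star (x - y)))
    rw [SO3.coe_inv] at hcr
    have hR : totalDeriv (y, lam, m) x (.inl μ) a i =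
        scaleDeriv (x - y) lam (.inl μ) * ((‖x - y‖ ^ 2)⁻¹ *
          ∑ j, (m : Matrix (Fin 3) (Fin 3) ℝ) j a * conjMatrix (x - y) j i) +
        bubbleScale lam (‖x - y‖ ^ 2) * ((‖x - y‖ ^ 2)⁻¹ * (-(2 / ‖x - y‖ ^ 2) *
          ∑ j, (m : Matrix (Fin 3) (Fin 3) ℝ) j a *
            (crossMat (imCoord (e μ * star (x - y))) * conjMatrix (x - y)) j i)) := by
      have hT : ∀ X : Matrix (Fin 3) (Fin 3) ℝ, ((m : Matrix (Fin 3) (Fin 3) ℝ).transpose * X) a i =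
          ∑ j, (m : Matrix (Fin 3) (Fin 3) ℝ) j a * X j i := fun X => by simp [Matrix.mul_apply]
      simp only [totalDeriv, rotationDeriv, Sum.elim_inl, Submonoid.coe_mul, coe_conjSO3 hP,
        SO3.coe_inv, ← Matrix.mul_assoc, hcr]
      simp only [Matrix.mul_assoc, crossMat_smul, Matrix.mul_smul, Matrix.smul_mul,
        Matrix.add_apply, Matrix.smul_apply, smul_eq_mul, hT]
    rw [hR]
    simp only [hB, zero_smul, sub_zero]
    have hS : ∑ j, (m : Matrix (Fin 3) (Fin 3) ℝ) j a * (-(1 / ‖x - y‖ ^ 2) *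
        ((2 * (e μ * star (x - y)).re) * conjMatrix (x - y) j i +
        2 * (crossMat (imCoord (e μ * star (x - y))) * conjMatrix (x - y)) j i)) =
        -(1 / ‖x - y‖ ^ 2) * (2 * (e μ * star (x - y)).re *
          ∑ j, (m : Matrix (Fin 3) (Fin 3) ℝ) j a * conjMatrix (x - y) j i +
          2 * ∑ j, (m : Matrix (Fin 3) (Fin 3) ℝ) j a *
            (crossMat (imCoord (e μ * star (x - y))) * conjMatrix (x - y)) j i) := by
      simp only [Finset.mul_sum, ← Finset.sum_add_distrib]
      exact Finset.sum_congr rfl fun j _ => by ring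
    rw [hS]
    simp only [scaleDeriv, bubbleScale, Sum.elim_inl]
    generalize ∑ j, (m : Matrix (Fin 3) (Fin 3) ℝ) j a * conjMatrix (x - y) j i = S1
    generalize ∑ j, (m : Matrix (Fin 3) (Fin 3) ℝ) j a *
            (crossMat (imCoord (e μ * star (x - y))) * conjMatrix (x - y)) j i = S2
    generalize (e μ * star (x - y)).re = r
    field_simp
    ring
  · have hscale : HasDerivAt (fun t => bubbleScale (lam + t) (‖x - y‖ ^ 2))
        (2 * lam ^ 2 / (lam ^ 2 + ‖x - y‖ ^ 2) ^ 3 * ((‖x - y‖ ^ 2 - lam ^ 2) / lam)) 0 := by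
      have h1 := ((hasDerivAt_id' (0 : ℝ)).const_add lam).fun_pow 2
      have := h1.fun_div ((h1.add_const (‖x - y‖ ^ 2)).fun_pow 2) (by simpa using hd)
      refine this.congr_deriv ?_
      simp only [add_zero]
      field_simp
      ring
    -- Only `m⁻¹` enters the total matrix, so the factor appended to `m` on the right appears
    -- inverted on the left: hence the minus sign of the axis.
    have hrot : ∀ k : Fin 3, HasDerivAt (fun t => totalMatrix A₀ x (y, lam, m * axisRotation t k) a i)
        ((bubbleScale lam (‖x - y‖ ^ 2) • (crossMat (-Pi.single k 1) *
          ((m⁻¹ * conjSO3 (x - y) : SO3) : Matrix (Fin 3) (Fin 3) ℝ))) a i) 0 := by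
      intro k
      have h1 : ∀ t, totalMatrix A₀ x (y, lam, m * axisRotation t k) a i =
          curvatureMatrix (curvature A₀ x) a i + bubbleScale lam (‖x - y‖ ^ 2) *
            ∑ j, (axisRotation t k : Matrix (Fin 3) (Fin 3) ℝ) j a *
              ((m⁻¹ * conjSO3 (x - y) : SO3) : Matrix (Fin 3) (Fin 3) ℝ) j i := fun t => by
        rw [totalMatrix_eq_scale A₀ (b := (y, lam, m * axisRotation t k)) hx hl]
        simp only [mul_inv_rev, mul_assoc, Matrix.add_apply, Matrix.smul_apply, smul_eq_mul]
        congr 2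
      simp only [h1]
      refine (((HasDerivAt.fun_sum fun j _ => (hasDerivAt_axisRotation k j a).mul_const _).const_mul
        _).const_add _).congr_deriv ?_
      rw [Matrix.smul_apply, smul_eq_mul, Matrix.mul_apply]
      congr 1
      refine Finset.sum_congr rfl fun j _ => ?_
      congr 1
      fin_cases j <;> fin_cases a <;> simp [crossMat]
    fin_cases c
    · have h1 : ∀ᶠ t : ℝ in 𝓝 0, lam + t ≠ 0 :=
        (continuousAt_const.add continuousAt_id).eventually_ne (by simpa using hl)
      have hev : (fun t => totalMatrix A₀ x (coordLine (y, lam, m) t (.inr 0)) a i) =ᶠ[𝓝 0] fun t =>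
          curvatureMatrix (curvature A₀ x) a i + bubbleScale (lam + t) (‖x - y‖ ^ 2) *
            ((m⁻¹ * conjSO3 (x - y) : SO3) : Matrix (Fin 3) (Fin 3) ℝ) a i := by
        filter_upwards [h1] with t ht
        change totalMatrix A₀ x (y, lam + t, m) a i = _
        rw [totalMatrix_eq_scale A₀ (b := (y, lam + t, m)) hx ht]
        rfl
      refine (((hscale.mul_const _).const_add _).congr_of_eventuallyEq hev).congr_deriv ?_
      have h0 : crossMat (0 : Fin 3 → ℝ) = 0 := by
        ext i j; fin_cases i <;> fin_cases j <;> simp [crossMat]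
      simp [totalDeriv, scaleDeriv, rotationDeriv, h0]
    · refine (hrot 0).congr_deriv ?_
      simp [totalDeriv, scaleDeriv, rotationDeriv]
    · refine (hrot 1).congr_deriv ?_
      simp [totalDeriv, scaleDeriv, rotationDeriv]
    · refine (hrot 2).congr_deriv ?_
      simp [totalDeriv, scaleDeriv, rotationDeriv]

theorem differential_single (A₀ : OneForm) {b : BubbleData} {x : ℍ} (hx : b.1 ≠ x)
    (hl : b.2.1 ≠ 0) (c : Fin 4 ⊕ Fin 4) :
    differential (totalMatrix A₀ x) b (Pi.single (finSumFinEquiv c) 1) = totalDeriv b x c := by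
  ext a i
  have hd := (differentiableAt_bubbleChart A₀ hx hl a i).hasFDerivAt
  have h1 : HasDerivAt (fun t : ℝ => t • (Pi.single (finSumFinEquiv c) 1 : Fin 8 → ℝ))
      (Pi.single (finSumFinEquiv c) 1) 0 := by
    simpa using (hasDerivAt_id' (0 : ℝ)).smul_const (Pi.single (finSumFinEquiv c) 1 : Fin 8 → ℝ)
  have h2 := hd.comp_hasDerivAt_of_eq (0 : ℝ) h1 (by simp)
  have h3 := hasDerivAt_coordLine A₀ hx hl c a i
  simp only [← bubbleChart_single] at h3
  exact h2.unique h3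

/-! ### Positivity of the determinant of the scale and rotation data. -/

/-- For `V ≠ 0`, right multiplication by `V` has determinant `|V|⁴`. In the coordinates of `w = e
V`, the first row is `Re(w V⁻¹ N̄)`, whose coefficient along `1` is `Re(N V)/|V|²`. -/
theorem det_radial_rows (N V : ℍ) :
    (Matrix.of fun k μ : Fin 4 => (![(e μ * star N).re, imCoord (e μ * V) 0, imCoord (e μ * V) 1,
      imCoord (e μ * V) 2] : Fin 4 → ℝ) k).det = ‖V‖ ^ 2 * (N * V).re := by
  rw [norm_sq_eq]
  simp [Matrix.det_succ_row_zero, Fin.sum_univ_succ, Fin.succAbove, imCoord, e_zero, e_one_re,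
    e_one_imI, e_one_imJ, e_one_imK, e_two_re, e_two_imI, e_two_imJ, e_two_imK, e_three_re,
    e_three_imI, e_three_imJ, e_three_imK]
  ring

theorem det_rotate_rows (A : Matrix (Fin 3) (Fin 3) ℝ) (n : Fin 4 → ℝ) (w : Fin 4 → Fin 3 → ℝ) :
    (Matrix.of fun k μ : Fin 4 => (![n μ, A.mulVec (w μ) 0, A.mulVec (w μ) 1,
      A.mulVec (w μ) 2] : Fin 4 → ℝ) k).det =
    A.det * (Matrix.of fun k μ : Fin 4 => (![n μ, w μ 0, w μ 1, w μ 2] : Fin 4 → ℝ) k).det := by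
  have h : (Matrix.of fun k μ : Fin 4 => (![n μ, A.mulVec (w μ) 0, A.mulVec (w μ) 1,
      A.mulVec (w μ) 2] : Fin 4 → ℝ) k) = !![1, 0, 0, 0; 0, A 0 0, A 0 1, A 0 2;
        0, A 1 0, A 1 1, A 1 2; 0, A 2 0, A 2 1, A 2 2] *
      (Matrix.of fun k μ : Fin 4 => (![n μ, w μ 0, w μ 1, w μ 2] : Fin 4 → ℝ) k) := by
    ext k μ
    fin_cases k <;>
      simp [Matrix.mul_apply, Fin.sum_univ_four, Matrix.mulVec, dotProduct, Fin.sum_univ_three]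
  rw [h, Matrix.det_mul]
  congr 1
  simp [Matrix.det_succ_row_zero, Fin.sum_univ_succ, Fin.succAbove]

/-- Block elimination of the upper right block, possible because diagonal matrices commute. -/
theorem det_fromBlocks_diagonal (A A' : Matrix (Fin 4) (Fin 4) ℝ) (d d' : Fin 4 → ℝ)
    (hd : ∀ i, d' i ≠ 0) :
    (Matrix.fromBlocks A (Matrix.diagonal d) A' (Matrix.diagonal d')).det =
      (Matrix.diagonal d' * A - Matrix.diagonal d * A').det := by
  have h : Matrix.fromBlocks (Matrix.diagonal d') (-Matrix.diagonal d) 0 1 *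
      Matrix.fromBlocks A (Matrix.diagonal d) A' (Matrix.diagonal d') =
      Matrix.fromBlocks (Matrix.diagonal d' * A - Matrix.diagonal d * A') 0 A'
        (Matrix.diagonal d') := by
    rw [Matrix.fromBlocks_multiply]
    congr 1
    · rw [Matrix.neg_mul, sub_eq_add_neg]
    · rw [Matrix.neg_mul, Matrix.diagonal_mul_diagonal, Matrix.diagonal_mul_diagonal,
        ← sub_eq_add_neg, sub_eq_zero]
      congr 1; ext i; exact mul_comm _ _
    · simp
    · simp
  have h2 := congrArg Matrix.det h
  rw [Matrix.det_mul, Matrix.det_fromBlocks_zero₂₁, Matrix.det_fromBlocks_zero₁₂, Matrix.det_one,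
    mul_one, mul_comm] at h2
  refine mul_right_cancel₀ ?_ h2
  rw [Matrix.det_diagonal]
  exact Finset.prod_ne_zero_iff.2 fun i _ => hd i

/-- The derivatives of scale and rotation along the directions `f c`. -/
def pointMatrix (m : SO3) (P : ℍ) (lam : ℝ) (f : Fin 4 → Fin 4 ⊕ Fin 4) :
    Matrix (Fin 4) (Fin 4) ℝ :=
  Matrix.of fun k c => (![scaleDeriv P lam (f c), rotationDeriv m P (f c) 0,
      rotationDeriv m P (f c) 1, rotationDeriv m P (f c) 2] : Fin 4 → ℝ) k

theorem pointMatrix_inr (m : SO3) (P : ℍ) (lam : ℝ) :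
    pointMatrix m P lam .inr = Matrix.diagonal
      ![2 * lam ^ 2 / (lam ^ 2 + ‖P‖ ^ 2) ^ 3 * ((‖P‖ ^ 2 - lam ^ 2) / lam), -1, -1, -1] := by
  ext k c
  fin_cases k <;> fin_cases c <;> simp [pointMatrix, scaleDeriv, rotationDeriv]

/-- The differential of the scales and of the rotations of the bubble at two points. -/
def dataMatrix (b : BubbleData) (p q : ℍ) : Matrix (Fin 4 ⊕ Fin 4) (Fin 4 ⊕ Fin 4) ℝ :=
  Matrix.of fun r c => Sum.elim
    (![scaleDeriv (p - b.1) b.2.1 c, rotationDeriv b.2.2 (p - b.1) c 0,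
      rotationDeriv b.2.2 (p - b.1) c 1, rotationDeriv b.2.2 (p - b.1) c 2] : Fin 4 → ℝ)
    (![scaleDeriv (q - b.1) b.2.1 c, rotationDeriv b.2.2 (q - b.1) c 0,
      rotationDeriv b.2.2 (q - b.1) c 1, rotationDeriv b.2.2 (q - b.1) c 2] : Fin 4 → ℝ) r

/-- The size and gluing directions act diagonally, so they can be eliminated; the centre directions
leave a determinant of the shape in `det_radial_rows`. The two size bounds mean that both scales
increase with `lam`. -/
theorem det_dataMatrix_pos {b : BubbleData} {p q : ℍ} (hl : 0 < b.2.1) (hp : b.2.1 < ‖p - b.1‖)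
    (hq : b.2.1 < ‖q - b.1‖) (hpq : p ≠ q) : 0 < (dataMatrix b p q).det := by
  obtain ⟨y, lam, m⟩ := b
  simp only at hl hp hq
  have hPQ : p - y ≠ q - y := fun h => hpq (sub_left_injective h)
  -- The common factor of the scale derivatives is made opaque: only its positivity matters.
  obtain ⟨c, hc⟩ : ∃ c : ℝ → ℝ, ∀ A, 2 * lam ^ 2 / (lam ^ 2 + A) ^ 3 = c A := ⟨_, fun _ => rfl⟩
  have hdat : dataMatrix (y, lam, m) p q = Matrix.fromBlocks
      (pointMatrix m (p - y) lam .inl) (pointMatrix m (p - y) lam .inr)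
      (pointMatrix m (q - y) lam .inl) (pointMatrix m (q - y) lam .inr) := by
    ext r s
    rcases r with r | r <;> rcases s with s | s <;> rfl
  rw [pointMatrix_inr, pointMatrix_inr] at hdat
  generalize p - y = P at *
  generalize q - y = Q at *
  have hP0 : ‖P‖ ≠ 0 := (hl.trans hp).ne'
  have hQ0 : ‖Q‖ ≠ 0 := (hl.trans hq).ne'
  have hA : lam ^ 2 < ‖P‖ ^ 2 := by gcongr
  have hB : lam ^ 2 < ‖Q‖ ^ 2 := by gcongr
  have hl2 : 0 < lam ^ 2 := by positivity
  have hcA : 0 < c (‖P‖ ^ 2) := by rw [← hc]; positivity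
  have hcB : 0 < c (‖Q‖ ^ 2) := by rw [← hc]; positivity
  have hβQ : 0 < (‖Q‖ ^ 2 - lam ^ 2) / lam := div_pos (by linarith) hl
  simp only [hc] at hdat
  rw [hdat, det_fromBlocks_diagonal]
  swap
  · intro i
    fin_cases i
    · exact (mul_pos hcB hβQ).ne'
    all_goals simp
  have hS : Matrix.diagonal ![c (‖Q‖ ^ 2) * ((‖Q‖ ^ 2 - lam ^ 2) / lam), -1, -1, -1] *
      pointMatrix m P lam .inl -
      Matrix.diagonal ![c (‖P‖ ^ 2) * ((‖P‖ ^ 2 - lam ^ 2) / lam), -1, -1, -1] *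
      pointMatrix m Q lam .inl =
      Matrix.of fun k μ => (![
        (e μ * star ((2 * c (‖P‖ ^ 2) * c (‖Q‖ ^ 2) * ((‖Q‖ ^ 2 - lam ^ 2) / lam)) • P -
          (2 * c (‖P‖ ^ 2) * c (‖Q‖ ^ 2) * ((‖P‖ ^ 2 - lam ^ 2) / lam)) • Q)).re,
        (m : Matrix (Fin 3) (Fin 3) ℝ).transpose.mulVec (imCoord
          (e μ * ((2 / ‖P‖ ^ 2) • star P - (2 / ‖Q‖ ^ 2) • star Q))) 0,
        (m : Matrix (Fin 3) (Fin 3) ℝ).transpose.mulVec (imCoord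
          (e μ * ((2 / ‖P‖ ^ 2) • star P - (2 / ‖Q‖ ^ 2) • star Q))) 1,
        (m : Matrix (Fin 3) (Fin 3) ℝ).transpose.mulVec (imCoord
          (e μ * ((2 / ‖P‖ ^ 2) • star P - (2 / ‖Q‖ ^ 2) • star Q))) 2] : Fin 4 → ℝ) k := by
    have him : ∀ (s t : ℝ) (u v : ℍ), imCoord (s • u - t • v) = s • imCoord u - t • imCoord v :=
      fun s t u v => by
        change imCoordₗ (s • u - t • v) = s • imCoordₗ u - t • imCoordₗ v
        rw [map_sub, map_smul, map_smul]
    ext k μ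
    rw [Matrix.sub_apply, Matrix.diagonal_mul, Matrix.diagonal_mul]
    simp only [pointMatrix, Matrix.of_apply, mul_sub, mul_smul_comm, him, Matrix.mulVec_sub, Matrix.mulVec_smul,
      star_sub, Quaternion.star_smul, scaleDeriv, rotationDeriv, Sum.elim_inl, hc]
    fin_cases k
    · simp
      ring
    all_goals simp
  rw [hS, det_rotate_rows, Matrix.det_transpose, m.det_eq, one_mul, det_radial_rows]
  have hPQ2 : 0 < ‖P - Q‖ ^ 2 := by
    have := norm_pos_iff.2 (sub_ne_zero.2 hPQ)
    positivity
  have hD : ‖P - Q‖ ^ 2 = ‖P‖ ^ 2 + ‖Q‖ ^ 2 - 2 * (P * star Q).re := by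
    simp only [norm_sq_eq]; simp; ring
  -- Inversion in the unit sphere turns the distance `|P - Q|` into `|P - Q| / (|P| |Q|)`.
  have hV : ‖(2 / ‖P‖ ^ 2) • star P - (2 / ‖Q‖ ^ 2) • star Q‖ ^ 2 =
      4 * ‖P - Q‖ ^ 2 / (‖P‖ ^ 2 * ‖Q‖ ^ 2) := by
    have : ‖(2 / ‖P‖ ^ 2) • star P - (2 / ‖Q‖ ^ 2) • star Q‖ ^ 2 = (2 / ‖P‖ ^ 2) ^ 2 * ‖P‖ ^ 2 +
        (2 / ‖Q‖ ^ 2) ^ 2 * ‖Q‖ ^ 2 - 2 * ((2 / ‖P‖ ^ 2) * (2 / ‖Q‖ ^ 2) * (P * star Q).re) := by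
      generalize 2 / ‖P‖ ^ 2 = s
      generalize 2 / ‖Q‖ ^ 2 = t
      simp only [norm_sq_eq]; simp; ring
    rw [this, hD]
    field_simp
    ring
  have hN : ∀ s t s' t' : ℝ, ((s • P - t • Q) * (s' • star P - t' • star Q)).re =
      s * s' * ‖P‖ ^ 2 + t * t' * ‖Q‖ ^ 2 - (s * t' + t * s') * (P * star Q).re := by
    intro s t s' t'
    simp only [norm_sq_eq]; simp; ring
  rw [hV, hN]
  have h1 : (P * star Q).re = (‖P‖ ^ 2 + ‖Q‖ ^ 2 - ‖P - Q‖ ^ 2) / 2 := by linarith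
  rw [h1]
  generalize ‖P - Q‖ ^ 2 = D at *
  generalize ‖P‖ ^ 2 = A at *
  generalize ‖Q‖ ^ 2 = B at *
  have hA0 : 0 < A := by linarith
  have hB0 : 0 < B := by linarith
  refine mul_pos (by positivity) ?_
  -- After the polarization formula for `Re(P Q̄)`, the remaining factor is a positive term
  -- proportional to `D = |P - Q|²` plus a square.
  have : 2 * c A * c B * ((B - lam ^ 2) / lam) * (2 / A) * A +
        2 * c A * c B * ((A - lam ^ 2) / lam) * (2 / B) * B -
      (2 * c A * c B * ((B - lam ^ 2) / lam) * (2 / B) +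
        2 * c A * c B * ((A - lam ^ 2) / lam) * (2 / A)) * ((A + B - D) / 2) =
      (2 * c A * c B) / (lam * A * B) *
        (D * ((B - lam ^ 2) * A + (A - lam ^ 2) * B) + lam ^ 2 * (B - A) ^ 2) := by
    field_simp
    ring
  rw [this]
  have h2 : 0 < B - lam ^ 2 := by linarith
  have h3 : 0 < A - lam ^ 2 := by linarith
  positivity

/-! ### From the sign of a determinant to transversality and the intersection number. -/

theorem exists_isNormalFrame {W : Matrix (Fin 3) (Fin 3) ℝ} (hW : W.rank = 1) :
    ∃ f k, IsNormalFrame W f k := by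
  have key : ∀ A : Matrix (Fin 3) (Fin 3) ℝ, A.rank = 1 →
      ∃ k : Fin 2 → Fin 3 → ℝ, LinearIndependent ℝ k ∧ ∀ j, A.mulVec (k j) = 0 := by
    intro A hA
    have h1 : Module.finrank ℝ (LinearMap.ker A.mulVecLin) = 2 := by
      have := A.mulVecLin.finrank_range_add_finrank_ker
      rw [← Matrix.rank] at this
      simp at this
      omega
    let B := Module.finBasisOfFinrankEq ℝ _ h1
    refine ⟨fun j => B j, ?_, fun j => (B j).2⟩
    exact B.linearIndependent.map' (LinearMap.ker A.mulVecLin).subtype (Submodule.ker_subtype _)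
  obtain ⟨k, hk1, hk2⟩ := key W hW
  obtain ⟨f, hf1, hf2⟩ := key W.transpose (by rw [Matrix.rank_transpose, hW])
  exact ⟨f, k, hf1, hk1, fun i => by rw [← Matrix.mulVec_transpose, hf2], hk2⟩

/-- The vectors annihilated by both forms make up the line of `f 0 × f 1`, and any nonzero value of
`W` spans it. -/
theorem exists_mulVec_eq {W : Matrix (Fin 3) (Fin 3) ℝ} (hW : W.rank = 1)
    {f k : Fin 2 → Fin 3 → ℝ} (h : IsNormalFrame W f k) {v : Fin 3 → ℝ} (hv : ∀ i, f i ⬝ᵥ v = 0) :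
    ∃ c, v = W.mulVec c := by
  have hF := cross_ne_zero_of_linearIndependent h.indep_form
  set F := crossProduct (f 0) (f 1) with hFd
  obtain ⟨u, hu⟩ : ∃ u, W.mulVec u ≠ 0 := by
    by_contra! hc
    have : W = 0 := by
      apply Matrix.ext_of_mulVec_single
      intro i; rw [hc, Matrix.zero_mulVec]
    rw [this, Matrix.rank_zero] at hW
    exact zero_ne_one hW
  have hfu : ∀ i, f i ⬝ᵥ W.mulVec u = 0 := fun i => by
    rw [Matrix.dotProduct_mulVec, h.form_image, zero_dotProduct]
  have hFF : F ⬝ᵥ F ≠ 0 := fun h0 => hF (dotProduct_self_eq_zero.1 h0)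
  have hpar : ∀ z : Fin 3 → ℝ, (∀ i, f i ⬝ᵥ z = 0) → z = ((z ⬝ᵥ F) / (F ⬝ᵥ F)) • F := by
    intro z hz
    have hc := cross_cross_eq_zero (hz 0) (hz 1)
    rw [← sub_eq_zero]
    refine dotProduct_self_eq_zero.1 ?_
    have h1 := fun w => dot_mul_dot_of_cross_eq_zero hc w
    rw [← hFd] at h1
    have h2 : ∀ w, (z - ((z ⬝ᵥ F) / (F ⬝ᵥ F)) • F) ⬝ᵥ w = 0 := fun w => by
      rw [sub_dotProduct, smul_dotProduct, smul_eq_mul, div_mul_eq_mul_div, ← h1 w]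
      field_simp
      ring
    exact h2 _
  have h1 := hpar v hv
  have h2 := hpar _ hfu
  have h3 : (W.mulVec u ⬝ᵥ F) / (F ⬝ᵥ F) ≠ 0 := fun h0 => hu (by rw [h2, h0, zero_smul])
  generalize (W.mulVec u ⬝ᵥ F) / (F ⬝ᵥ F) = s at h2 h3
  refine ⟨(((v ⬝ᵥ F) / (F ⬝ᵥ F)) * s⁻¹) • u, ?_⟩
  rw [Matrix.mulVec_smul, h2, smul_smul, inv_mul_cancel_right₀ h3]
  exact h1

/-- `normalCoord` as a linear map. -/
def normalCoordₗ (f k : Fin 2 → Fin 3 → ℝ) : Matrix (Fin 3) (Fin 3) ℝ →ₗ[ℝ] (Fin 4 → ℝ) where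
  toFun := normalCoord f k
  map_add' X Y := by
    ext r; fin_cases r <;> simp [normalCoord, Matrix.add_mulVec, dotProduct_add]
  map_smul' c X := by
    ext r; fin_cases r <;> simp [normalCoord, Matrix.smul_mulVec]

theorem mem_rankOneTangent_of_normalCoord {W : Matrix (Fin 3) (Fin 3) ℝ} (hW : W.rank = 1)
    {f k : Fin 2 → Fin 3 → ℝ} (h : IsNormalFrame W f k) {X : Matrix (Fin 3) (Fin 3) ℝ}
    (hX : normalCoord f k X = 0) : X ∈ rankOneTangent W := by
  have h00 : f 0 ⬝ᵥ X.mulVec (k 0) = 0 := congrFun hX 0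
  have h01 : f 0 ⬝ᵥ X.mulVec (k 1) = 0 := congrFun hX 1
  have h10 : f 1 ⬝ᵥ X.mulVec (k 0) = 0 := congrFun hX 2
  have h11 : f 1 ⬝ᵥ X.mulVec (k 1) = 0 := congrFun hX 3
  intro v hv
  have hker : Module.finrank ℝ (LinearMap.ker W.mulVecLin) = 2 := by
    have := W.mulVecLin.finrank_range_add_finrank_ker
    rw [← Matrix.rank, hW] at this
    simp at this
    omega
  have hspan : v ∈ Submodule.span ℝ (Set.range k) := by
    have : Submodule.span ℝ (Set.range k) = LinearMap.ker W.mulVecLin := by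
      refine Submodule.eq_of_le_of_finrank_eq ?_ ?_
      · rw [Submodule.span_le]
        rintro _ ⟨j, rfl⟩
        exact h.ker j
      · rw [finrank_span_eq_card h.indep_ker, hker, Fintype.card_fin]
    rw [this]
    exact hv
  obtain ⟨c, hc⟩ := (Submodule.mem_span_range_iff_exists_fun ℝ).1 hspan
  rw [Fin.sum_univ_two] at hc
  refine exists_mulVec_eq hW h fun i => ?_
  rw [← hc, Matrix.mulVec_add, Matrix.mulVec_smul, Matrix.mulVec_smul, dotProduct_add,
    dotProduct_smul, dotProduct_smul]
  fin_cases i <;> simp [h00, h01, h10, h11]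

/-- A nonzero determinant means that the two sets of normal coordinates can be prescribed
simultaneously and arbitrarily. Each factor separately gives smoothness; both together give the sum
of tangent spaces. -/
theorem isTransverseAt_of_det {E E' : BubbleData → Matrix (Fin 3) (Fin 3) ℝ} {b : BubbleData}
    (hE : (E b).rank = 1) (hE' : (E' b).rank = 1) {f k f' k' : Fin 2 → Fin 3 → ℝ}
    (h : IsNormalFrame (E b) f k) (h' : IsNormalFrame (E' b) f' k')
    (hdet : (intersectionMatrix E E' b f k f' k').det ≠ 0) : IsTransverseAt E E' b := by
  have happly : ∀ v : Fin 8 → ℝ, (intersectionMatrix E E' b f k f' k').mulVec v =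
      (Fin.append (normalCoord f k (differential E b v))
        (normalCoord f' k' (differential E' b v)) : Fin (4 + 4) → ℝ) := by
    intro v
    let Φ : (Fin 8 → ℝ) →ₗ[ℝ] (Fin (4 + 4) → ℝ) :=
      { toFun := fun v => Fin.append (normalCoordₗ f k (differential E b v))
          (normalCoordₗ f' k' (differential E' b v))
        map_add' := fun v w => by
          rw [map_add, map_add, map_add, map_add]
          ext r; refine Fin.addCases (fun i => ?_) (fun i => ?_) r <;> simp [-Fin.natAdd_eq_addNat]
        map_smul' := fun c v => by
          rw [map_smul, map_smul, map_smul, map_smul]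
          ext r; refine Fin.addCases (fun i => ?_) (fun i => ?_) r <;> simp [-Fin.natAdd_eq_addNat] }
    have : (intersectionMatrix E E' b f k f' k').mulVecLin = Φ := by
      refine LinearMap.pi_ext' fun c => ?_
      ext r
      simp only [LinearMap.comp_apply, Matrix.mulVecLin_apply, LinearMap.single_apply,
        Matrix.mulVec_single_one]
      rfl
    exact LinearMap.congr_fun this v
  have hinj : ∀ x : Fin 4 → ℝ, ∀ x' : Fin 4 → ℝ, ∃ v, normalCoord f k (differential E b v) = x ∧
      normalCoord f' k' (differential E' b v) = x' := by
    intro x x'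
    have hs : Function.Surjective (intersectionMatrix E E' b f k f' k').mulVec :=
      Matrix.mulVec_surjective_iff_isUnit.2
        ((Matrix.isUnit_iff_isUnit_det _).2 (isUnit_iff_ne_zero.2 hdet))
    obtain ⟨v, hv⟩ := hs (Fin.append x x' : Fin (4 + 4) → ℝ)
    rw [happly] at hv
    refine ⟨v, ?_, ?_⟩
    · ext i
      have := congrFun hv (Fin.castAdd 4 i)
      rwa [Fin.append_left, Fin.append_left] at this
    · ext i
      have := congrFun hv (Fin.natAdd 4 i)
      rwa [Fin.append_right, Fin.append_right] at this
  have hsm : ∀ {E : BubbleData → Matrix (Fin 3) (Fin 3) ℝ} {f k : Fin 2 → Fin 3 → ℝ},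
      (E b).rank = 1 → IsNormalFrame (E b) f k →
      (∀ x, ∃ v, normalCoord f k (differential E b v) = x) → IsSmoothPoint E b := by
    intro E f k hE h hs
    refine ⟨hE, eq_top_iff.2 fun X _ => ?_⟩
    obtain ⟨v, hv⟩ := hs (normalCoord f k X)
    refine Submodule.mem_sup.2 ⟨differential E b v, ⟨v, rfl⟩, X - differential E b v, ?_, by abel⟩
    refine mem_rankOneTangent_of_normalCoord hE h ?_
    change normalCoordₗ f k _ = 0
    rw [map_sub, sub_eq_zero]
    exact hv.symm
  refine ⟨hsm hE h fun x => (hinj x 0).imp fun v hv => hv.1,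
    hsm hE' h' fun x => (hinj 0 x).imp fun v hv => hv.2, eq_top_iff.2 fun v _ => ?_⟩
  -- The vector `w` is tangent to the first set and has the second normal coordinates of `v`, so `v
  -- - w` is tangent to the second set.
  obtain ⟨w, hw1, hw2⟩ := hinj 0 (normalCoord f' k' (differential E' b v))
  refine Submodule.mem_sup.2 ⟨w, mem_rankOneTangent_of_normalCoord hE h hw1, v - w, ?_, by abel⟩
  refine mem_rankOneTangent_of_normalCoord hE' h' ?_
  change normalCoordₗ f' k' _ = 0
  rw [map_sub, map_sub, sub_eq_zero]
  exact hw2.symm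

/-- The chain rule through the scale and rotation variations at the two points gives three
determinants, of signs `-`, `-` and `+`. -/
theorem intersectionMatrix_det_pos (A₀ : OneForm) {b : BubbleData} {p q : ℍ} (hl : 0 < b.2.1)
    (hp : b.2.1 < ‖p - b.1‖) (hq : b.2.1 < ‖q - b.1‖) (hpq : p ≠ q)
    (hMp : HasSimpleSpectrum (curvatureMatrix (curvature A₀ p)))
    (hMq : HasSimpleSpectrum (curvatureMatrix (curvature A₀ q))) {f k f' k' : Fin 2 → Fin 3 → ℝ}
    (h : IsNormalFrame (totalMatrix A₀ p b) f k) (h' : IsNormalFrame (totalMatrix A₀ q b) f' k') :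
    0 < (intersectionMatrix (totalMatrix A₀ p) (totalMatrix A₀ q) b f k f' k').det := by
  have hp0 : 0 < ‖p - b.1‖ := hl.trans hp
  have hq0 : 0 < ‖q - b.1‖ := hl.trans hq
  have hbp : b.1 ≠ p := fun h => by simp [h] at hp0
  have hbq : b.1 ≠ q := fun h => by simp [h] at hq0
  have hsc : ∀ r : ℝ, 0 < r → 0 < bubbleScale b.2.1 (r ^ 2) := fun r hr => by
    unfold bubbleScale; positivity
  rw [totalMatrix_eq_scale A₀ hbp hl.ne'] at h
  rw [totalMatrix_eq_scale A₀ hbq hl.ne'] at h'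
  have d1 := det_normalMatrix_neg hMp (hsc _ hp0) _ h
  have d2 := det_normalMatrix_neg hMq (hsc _ hq0) _ h'
  have d3 := det_dataMatrix_pos hl hp hq hpq
  have hfac : (intersectionMatrix (totalMatrix A₀ p) (totalMatrix A₀ q) b f k f' k').submatrix
      finSumFinEquiv finSumFinEquiv = Matrix.fromBlocks
      (normalMatrix (bubbleScale b.2.1 (‖p - b.1‖ ^ 2)) f
        fun j => ((b.2.2⁻¹ * conjSO3 (p - b.1) : SO3) : Matrix (Fin 3) (Fin 3) ℝ).mulVec (k j)) 0 0
      (normalMatrix (bubbleScale b.2.1 (‖q - b.1‖ ^ 2)) f'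
        fun j => ((b.2.2⁻¹ * conjSO3 (q - b.1) : SO3) : Matrix (Fin 3) (Fin 3) ℝ).mulVec (k' j)) *
      dataMatrix b p q := by
    ext r c
    rw [Matrix.submatrix_apply, intersectionMatrix, Matrix.of_apply,
      differential_single A₀ hbp hl.ne', differential_single A₀ hbq hl.ne', totalDeriv, totalDeriv,
      normalCoord_eq, normalCoord_eq, Matrix.mul_apply, Fintype.sum_sum_type]
    rcases r with r | r
    · rw [finSumFinEquiv_apply_left, Fin.append_left]
      simp only [Matrix.fromBlocks_apply₁₁, Matrix.fromBlocks_apply₁₂, Matrix.zero_apply, zero_mul,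
        Finset.sum_const_zero, add_zero]
      rfl
    · rw [finSumFinEquiv_apply_right, Fin.append_right]
      simp only [Matrix.fromBlocks_apply₂₁, Matrix.fromBlocks_apply₂₂, Matrix.zero_apply, zero_mul,
        Finset.sum_const_zero, zero_add]
      rfl
  have hdet := congrArg Matrix.det hfac
  rw [Matrix.det_submatrix_equiv_self, Matrix.det_mul, Matrix.det_fromBlocks_zero₂₁] at hdet
  rw [hdet]
  exact mul_pos (mul_pos_of_neg_of_neg d1 d2) d3

theorem hasLocalIntersectionNumber_one (A₀ : OneForm) {b : BubbleData} {p q : ℍ} (hl : 0 < b.2.1)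
    (hp : b.2.1 < ‖p - b.1‖) (hq : b.2.1 < ‖q - b.1‖) (hpq : p ≠ q)
    (hMp : HasSimpleSpectrum (curvatureMatrix (curvature A₀ p)))
    (hMq : HasSimpleSpectrum (curvatureMatrix (curvature A₀ q)))
    (hrp : (totalMatrix A₀ p b).rank ≤ 1) (hrq : (totalMatrix A₀ q b).rank ≤ 1) :
    HasLocalIntersectionNumber (totalMatrix A₀ p) (totalMatrix A₀ q) b 1 := by
  have hrank : ∀ x, b.1 ≠ x → HasSimpleSpectrum (curvatureMatrix (curvature A₀ x)) →
      (totalMatrix A₀ x b).rank ≤ 1 → (totalMatrix A₀ x b).rank = 1 := by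
    intro x hx hM hr
    refine le_antisymm hr (Nat.one_le_iff_ne_zero.2 fun h0 => ?_)
    have : totalMatrix A₀ x b ≠ 0 := by
      rw [totalMatrix_eq_scale A₀ hx hl.ne']
      exact add_smul_ne_zero hM _ _
    have h1 := LinearMap.range_eq_bot.1 (Submodule.finrank_eq_zero.1 h0)
    refine this (Matrix.ext_of_mulVec_single fun i => ?_)
    rw [Matrix.zero_mulVec]
    exact LinearMap.congr_fun h1 _
  have hbp : b.1 ≠ p := fun h => by simp [h] at hp; linarith
  have hbq : b.1 ≠ q := fun h => by simp [h] at hq; linarith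
  have hp1 := hrank p hbp hMp hrp
  have hq1 := hrank q hbq hMq hrq
  obtain ⟨f, k, h⟩ := exists_isNormalFrame hp1
  obtain ⟨f', k', h'⟩ := exists_isNormalFrame hq1
  refine ⟨isTransverseAt_of_det hp1 hq1 h h'
    (intersectionMatrix_det_pos A₀ hl hp hq hpq hMp hMq h h').ne', fun f k f' k' h h' => ?_⟩
  rw [sign_pos (intersectionMatrix_det_pos A₀ hl hp hq hpq hMp hMq h h')]
  rfl

/-! ### The two rotations `Q` for which `M + s Q` has rank one. -/

theorem rank_le_one_iff (W : Matrix (Fin 3) (Fin 3) ℝ) :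
    W.rank ≤ 1 ↔ ∃ x y, crossProduct x y ≠ 0 ∧ W.mulVec x = 0 ∧ W.mulVec y = 0 := by
  have hrn := W.mulVecLin.finrank_range_add_finrank_ker
  rw [← Matrix.rank] at hrn
  simp only [Module.finrank_fintype_fun_eq_card, Fintype.card_fin] at hrn
  constructor
  · intro h
    obtain ⟨k, hk⟩ := exists_linearIndependent_of_le_finrank
      (show 2 ≤ Module.finrank ℝ (LinearMap.ker W.mulVecLin) by omega)
    have h1 := hk.map' (LinearMap.ker W.mulVecLin).subtype (Submodule.ker_subtype _)
    exact ⟨k 0, k 1, cross_ne_zero_of_linearIndependent h1, (k 0).2, (k 1).2⟩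
  · rintro ⟨x, y, hxy, hx, hy⟩
    rw [crossProduct_ne_zero_iff_linearIndependent] at hxy
    have h2 : Module.finrank ℝ (Submodule.span ℝ (Set.range ![x, y])) = 2 := by
      rw [finrank_span_eq_card hxy, Fintype.card_fin]
    have h3 : Submodule.span ℝ (Set.range ![x, y]) ≤ LinearMap.ker W.mulVecLin := by
      rw [Submodule.span_le]
      rintro _ ⟨j, rfl⟩
      fin_cases j
      exacts [hx, hy]
    have h4 := Submodule.finrank_mono h3
    omega

/-- `v` is an orthonormal basis of eigenvectors of `Mᵀ M`, with eigenvalues `μ 0 > μ 1 > μ 2`. -/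
structure IsSpectralFrame (M : Matrix (Fin 3) (Fin 3) ℝ) (v : Fin 3 → Fin 3 → ℝ)
    (μ : Fin 3 → ℝ) : Prop where
  ortho : ∀ i j, v i ⬝ᵥ v j = if i = j then 1 else 0
  eig : ∀ i, (M.transpose * M).mulVec (v i) = μ i • v i
  lt01 : μ 1 < μ 0
  lt12 : μ 2 < μ 1

namespace IsSpectralFrame

variable {M : Matrix (Fin 3) (Fin 3) ℝ} {v : Fin 3 → Fin 3 → ℝ} {μ : Fin 3 → ℝ}

theorem expand (h : IsSpectralFrame M v μ) (z : Fin 3 → ℝ) :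
    z = (v 0 ⬝ᵥ z) • v 0 + (v 1 ⬝ᵥ z) • v 1 + (v 2 ⬝ᵥ z) • v 2 := by
  have h1 : Matrix.of v * (Matrix.of v).transpose = 1 := by
    ext i j
    rw [Matrix.one_apply, ← h.ortho i j]
    rfl
  have h2 : (Matrix.of v).transpose * Matrix.of v = 1 := mul_eq_one_comm.1 h1
  have h3 : ((Matrix.of v).transpose * Matrix.of v).mulVec z = z := by rw [h2, Matrix.one_mulVec]
  rw [← Matrix.mulVec_mulVec] at h3
  conv_lhs => rw [← h3]
  ext i
  simp [Matrix.mulVec, dotProduct, Fin.sum_univ_three]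
  ring

theorem dot_mulVec (h : IsSpectralFrame M v μ) (i j : Fin 3) :
    M.mulVec (v i) ⬝ᵥ M.mulVec (v j) = if i = j then μ i else 0 := by
  rw [← dot_transpose_mul_self, h.eig, dotProduct_smul, h.ortho]
  split_ifs with hij <;> simp [hij]

theorem nonneg (h : IsSpectralFrame M v μ) (i : Fin 3) : 0 ≤ μ i := by
  have h1 := h.dot_mulVec i i
  rw [if_pos rfl] at h1
  rw [← h1]
  simp only [dotProduct]
  exact Finset.sum_nonneg fun j _ => mul_self_nonneg _

theorem pos (h : IsSpectralFrame M v μ) : 0 < μ 1 := (h.nonneg 2).trans_lt h.lt12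

theorem hasSimpleSpectrum (h : IsSpectralFrame M v μ) : HasSimpleSpectrum M := by
  intro s u w hu hw
  have key : ∀ z, (M.transpose * M).mulVec z = s • z → ∀ i, (μ i - s) * (v i ⬝ᵥ z) = 0 := by
    intro z hz i
    have h1 : v i ⬝ᵥ (M.transpose * M).mulVec z = μ i * (v i ⬝ᵥ z) := by
      rw [dot_transpose_mul_self, dotProduct_comm, ← dot_transpose_mul_self, h.eig,
        dotProduct_smul, smul_eq_mul, dotProduct_comm]
    rw [hz, dotProduct_smul, smul_eq_mul] at h1
    linear_combination -h1
  have h01 := h.lt01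
  have h12 := h.lt12
  have hz : ∀ i, μ i ≠ s → ∀ z, (M.transpose * M).mulVec z = s • z → v i ⬝ᵥ z = 0 :=
    fun i hi z hz => (mul_eq_zero.1 (key z hz i)).resolve_left (sub_ne_zero.2 hi)
  rw [h.expand u, h.expand w]
  rcases eq_or_ne (μ 0) s with h0 | h0
  · have h1 : μ 1 ≠ s := by rw [← h0]; exact h01.ne
    have h2 : μ 2 ≠ s := by rw [← h0]; exact (h12.trans h01).ne
    simp [hz 1 h1 u hu, hz 1 h1 w hw, hz 2 h2 u hu, hz 2 h2 w hw]
  · rw [hz 0 h0 u hu, hz 0 h0 w hw]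
    rcases eq_or_ne (μ 1) s with h1 | h1
    · have h2 : μ 2 ≠ s := by rw [← h1]; exact h12.ne
      simp [hz 2 h2 u hu, hz 2 h2 w hw]
    · simp [hz 1 h1 u hu, hz 1 h1 w hw]

end IsSpectralFrame

/-- The matrix with columns `x`, `y`, `x × y`. -/
def frameMat (x y : Fin 3 → ℝ) : Matrix (Fin 3) (Fin 3) ℝ :=
  (Matrix.of ![x, y, crossProduct x y]).transpose

theorem frameMat_mem {x y : Fin 3 → ℝ} (hx : x ⬝ᵥ x = 1) (hy : y ⬝ᵥ y = 1) (hxy : x ⬝ᵥ y = 0) :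
    frameMat x y ∈ Matrix.specialOrthogonalGroup (Fin 3) ℝ := by
  have hc : crossProduct x y ⬝ᵥ crossProduct x y = 1 := by
    rw [cross_dot_cross, hx, hy, hxy, dotProduct_comm y x, hxy]; simp
  have h1 : x ⬝ᵥ crossProduct x y = 0 := dot_self_cross x y
  have h2 : y ⬝ᵥ crossProduct x y = 0 := dot_cross_self x y
  rw [Matrix.mem_specialOrthogonalGroup_iff, Matrix.mem_orthogonalGroup_iff']
  refine ⟨?_, ?_⟩
  · change (frameMat x y).transpose * frameMat x y = 1
    have h : ∀ i j, ((frameMat x y).transpose * frameMat x y) i j =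
      (![x, y, crossProduct x y] i) ⬝ᵥ (![x, y, crossProduct x y] j) := fun i j => rfl
    ext i j
    rw [h]
    fin_cases i <;> fin_cases j <;> simp [hx, hy, hxy, hc, h1, h2, dotProduct_comm y x,
      dotProduct_comm (crossProduct x y)]
  · rw [frameMat, Matrix.det_transpose]
    simp [dotProduct, Fin.sum_univ_three, cross_apply] at hc
    simp [Matrix.det_fin_three, cross_apply]
    linear_combination hc

/-- The rotation with columns `x`, `y`, `x × y`. -/
def frameSO3 {x y : Fin 3 → ℝ} (hx : x ⬝ᵥ x = 1) (hy : y ⬝ᵥ y = 1) (hxy : x ⬝ᵥ y = 0) : SO3 :=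
  ⟨frameMat x y, frameMat_mem hx hy hxy⟩

theorem frameMat_mulVec_zero (x y : Fin 3 → ℝ) : (frameMat x y).mulVec (Pi.single 0 1) = x := by
  ext i; simp [frameMat]

theorem frameMat_mulVec_one (x y : Fin 3 → ℝ) : (frameMat x y).mulVec (Pi.single 1 1) = y := by
  ext i; simp [frameMat]

theorem SO3.mul_frameMat (Q : SO3) (x y : Fin 3 → ℝ) :
    (Q : Matrix (Fin 3) (Fin 3) ℝ) * frameMat x y =
      frameMat ((Q : Matrix (Fin 3) (Fin 3) ℝ).mulVec x) ((Q : Matrix (Fin 3) (Fin 3) ℝ).mulVec y) := by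
  apply Matrix.ext_of_mulVec_single
  intro i
  rw [← Matrix.mulVec_mulVec]
  fin_cases i
  · exact (congrArg _ (frameMat_mulVec_zero x y)).trans (frameMat_mulVec_zero _ _).symm
  · exact (congrArg _ (frameMat_mulVec_one x y)).trans (frameMat_mulVec_one _ _).symm
  · have h : ∀ x y, (frameMat x y).mulVec (Pi.single 2 1) = crossProduct x y := fun x y => by
      ext i; simp [frameMat]
    exact (congrArg _ (h x y)).trans ((Q.cross_mulVec x y).symm.trans (h _ _).symm)

/-- The second vector of the kernel plane; `v 1` is the first one. -/
def kerVec (v : Fin 3 → Fin 3 → ℝ) (μ : Fin 3 → ℝ) (ε : ℝ) : Fin 3 → ℝ :=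
  √((μ 1 - μ 2) / (μ 0 - μ 2)) • v 0 + (ε * √((μ 0 - μ 1) / (μ 0 - μ 2))) • v 2

/-- The rotation `Q` for which `M + √(μ 1) Q` has the kernel spanned by `v 1` and `kerVec`. -/
def rotMat (M : Matrix (Fin 3) (Fin 3) ℝ) (v : Fin 3 → Fin 3 → ℝ) (μ : Fin 3 → ℝ) (ε : ℝ) :
    Matrix (Fin 3) (Fin 3) ℝ :=
  frameMat (-(√(μ 1))⁻¹ • M.mulVec (v 1)) (-(√(μ 1))⁻¹ • M.mulVec (kerVec v μ ε)) *
    (frameMat (v 1) (kerVec v μ ε)).transpose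

namespace IsSpectralFrame

variable {M : Matrix (Fin 3) (Fin 3) ℝ} {v : Fin 3 → Fin 3 → ℝ} {μ : Fin 3 → ℝ} {ε : ℝ}

/-- The two weights express `μ 1` as a convex combination of `μ 0` and `μ 2`. They are chosen so
that `M` stretches `kerVec` by the same factor `√(μ 1)` as `v 1`, making it a similarity on the
plane they span. -/
theorem cos_sq_add_sin_sq (h : IsSpectralFrame M v μ) :
    √((μ 1 - μ 2) / (μ 0 - μ 2)) ^ 2 + √((μ 0 - μ 1) / (μ 0 - μ 2)) ^ 2 = 1 ∧
    √((μ 1 - μ 2) / (μ 0 - μ 2)) ^ 2 * μ 0 + √((μ 0 - μ 1) / (μ 0 - μ 2)) ^ 2 * μ 2 = μ 1 ∧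
    0 < √((μ 1 - μ 2) / (μ 0 - μ 2)) ∧ 0 < √((μ 0 - μ 1) / (μ 0 - μ 2)) := by
  have h01 := h.lt01
  have h12 := h.lt12
  have h1 : 0 < μ 0 - μ 2 := by linarith
  have h2 : 0 < (μ 1 - μ 2) / (μ 0 - μ 2) := div_pos (by linarith) h1
  have h3 : 0 < (μ 0 - μ 1) / (μ 0 - μ 2) := div_pos (by linarith) h1
  rw [Real.sq_sqrt h2.le, Real.sq_sqrt h3.le]
  refine ⟨?_, ?_, Real.sqrt_pos.2 h2, Real.sqrt_pos.2 h3⟩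
  · field_simp; ring
  · field_simp; ring

theorem kerVec_dot (h : IsSpectralFrame M v μ) (hε : ε ^ 2 = 1) :
    kerVec v μ ε ⬝ᵥ kerVec v μ ε = 1 ∧ v 1 ⬝ᵥ kerVec v μ ε = 0 ∧
    M.mulVec (kerVec v μ ε) ⬝ᵥ M.mulVec (kerVec v μ ε) = μ 1 ∧
    M.mulVec (v 1) ⬝ᵥ M.mulVec (kerVec v μ ε) = 0 := by
  obtain ⟨h1, h2, -, -⟩ := h.cos_sq_add_sin_sq
  unfold kerVec
  generalize √((μ 1 - μ 2) / (μ 0 - μ 2)) = c at *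
  generalize √((μ 0 - μ 1) / (μ 0 - μ 2)) = s at *
  simp [Matrix.mulVec_add, Matrix.mulVec_smul, h.ortho, h.dot_mulVec]
  constructor
  · linear_combination h1 + s ^ 2 * hε
  · linear_combination h2 + s ^ 2 * μ 2 * hε

/-- The matrix carries the orthonormal pair `v 1`, `kerVec` to the pair of vectors `-M v / √(μ 1)`,
each completed to a positive frame by the cross product. -/
theorem rotMat_mem (h : IsSpectralFrame M v μ) (hε : ε ^ 2 = 1) :
    rotMat M v μ ε ∈ Matrix.specialOrthogonalGroup (Fin 3) ℝ := by
  obtain ⟨h1, h2, h3, h4⟩ := h.kerVec_dot hε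
  have hμ := h.pos
  have hs : √(μ 1) * √(μ 1) = μ 1 := Real.mul_self_sqrt hμ.le
  have hs0 : √(μ 1) ≠ 0 := (Real.sqrt_pos.2 hμ).ne'
  have h11 : v 1 ⬝ᵥ v 1 = 1 := by rw [h.ortho, if_pos rfl]
  have hM11 : M.mulVec (v 1) ⬝ᵥ M.mulVec (v 1) = μ 1 := by rw [h.dot_mulVec, if_pos rfl]
  have a1 : (-(√(μ 1))⁻¹ • M.mulVec (v 1)) ⬝ᵥ (-(√(μ 1))⁻¹ • M.mulVec (v 1)) = 1 := by
    rw [dotProduct_smul, smul_dotProduct, hM11, smul_eq_mul, smul_eq_mul]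
    field_simp
    rw [sq, hs]
  have a2 : (-(√(μ 1))⁻¹ • M.mulVec (kerVec v μ ε)) ⬝ᵥ (-(√(μ 1))⁻¹ • M.mulVec (kerVec v μ ε)) = 1 := by
    rw [dotProduct_smul, smul_dotProduct, h3, smul_eq_mul, smul_eq_mul]
    field_simp
    rw [sq, hs]
  have a3 : (-(√(μ 1))⁻¹ • M.mulVec (v 1)) ⬝ᵥ (-(√(μ 1))⁻¹ • M.mulVec (kerVec v μ ε)) = 0 := by
    rw [dotProduct_smul, smul_dotProduct, h4, smul_zero, smul_zero]
  exact (frameSO3 a1 a2 a3 * (frameSO3 h11 h1 h2)⁻¹).2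

/-- `rotMat` as a rotation. -/
def rot (h : IsSpectralFrame M v μ) (hε : ε ^ 2 = 1) : SO3 := ⟨rotMat M v μ ε, h.rotMat_mem hε⟩

theorem rot_mulVec (h : IsSpectralFrame M v μ) (hε : ε ^ 2 = 1) :
    (M + √(μ 1) • (h.rot hε : Matrix (Fin 3) (Fin 3) ℝ)).mulVec (v 1) = 0 ∧
    (M + √(μ 1) • (h.rot hε : Matrix (Fin 3) (Fin 3) ℝ)).mulVec (kerVec v μ ε) = 0 := by
  obtain ⟨h1, h2, h3, h4⟩ := h.kerVec_dot hε
  have h11 : v 1 ⬝ᵥ v 1 = 1 := by rw [h.ortho, if_pos rfl]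
  have hs0 : √(μ 1) ≠ 0 := (Real.sqrt_pos.2 h.pos).ne'
  have hF := SO3.transpose_mul_self (frameSO3 h11 h1 h2)
  change (frameMat (v 1) (kerVec v μ ε)).transpose * frameMat (v 1) (kerVec v μ ε) = 1 at hF
  have e0 : (frameMat (v 1) (kerVec v μ ε)).transpose.mulVec (v 1) = Pi.single 0 1 := by
    have := congrArg (fun A => A.mulVec (Pi.single 0 1)) hF
    simpa only [← Matrix.mulVec_mulVec, frameMat_mulVec_zero, Matrix.one_mulVec] using this
  have e1 : (frameMat (v 1) (kerVec v μ ε)).transpose.mulVec (kerVec v μ ε) = Pi.single 1 1 := by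
    have := congrArg (fun A => A.mulVec (Pi.single 1 1)) hF
    simpa only [← Matrix.mulVec_mulVec, frameMat_mulVec_one, Matrix.one_mulVec] using this
  constructor
  · rw [Matrix.add_mulVec, Matrix.smul_mulVec]
    change _ + √(μ 1) • (rotMat M v μ ε).mulVec _ = 0
    rw [rotMat, ← Matrix.mulVec_mulVec, e0, frameMat_mulVec_zero, smul_smul]
    rw [mul_neg, mul_inv_cancel₀ hs0]
    simp
  · rw [Matrix.add_mulVec, Matrix.smul_mulVec]
    change _ + √(μ 1) • (rotMat M v μ ε).mulVec _ = 0
    rw [rotMat, ← Matrix.mulVec_mulVec, e1, frameMat_mulVec_one, smul_smul]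
    rw [mul_neg, mul_inv_cancel₀ hs0]
    simp

/-- If they agreed, one matrix `M + √(μ 1) Q` would kill two distinct planes and so vanish, which
`add_smul_ne_zero` forbids. -/
theorem rot_one_ne_rot_neg_one (h : IsSpectralFrame M v μ) (hε : (1 : ℝ) ^ 2 = 1)
    (hε' : (-1 : ℝ) ^ 2 = 1) : h.rot hε ≠ h.rot hε' := by
  intro heq
  obtain ⟨h1, h2⟩ := h.rot_mulVec hε
  obtain ⟨-, h3⟩ := h.rot_mulVec hε'
  rw [← heq] at h3
  obtain ⟨-, -, hc, hs⟩ := h.cos_sq_add_sin_sq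
  refine add_smul_ne_zero h.hasSimpleSpectrum (√(μ 1)) (h.rot hε) ?_
  generalize M + √(μ 1) • (h.rot hε : Matrix (Fin 3) (Fin 3) ℝ) = W at *
  have h4 : kerVec v μ 1 + kerVec v μ (-1) = (2 * √((μ 1 - μ 2) / (μ 0 - μ 2))) • v 0 := by
    unfold kerVec; module
  have h5 : kerVec v μ 1 - kerVec v μ (-1) = (2 * √((μ 0 - μ 1) / (μ 0 - μ 2))) • v 2 := by
    unfold kerVec; module
  have h6 : W.mulVec (v 0) = 0 := by
    have := congrArg W.mulVec h4
    rw [Matrix.mulVec_add, h2, h3, add_zero, Matrix.mulVec_smul] at this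
    exact (smul_eq_zero.1 this.symm).resolve_left (by positivity)
  have h7 : W.mulVec (v 2) = 0 := by
    have := congrArg W.mulVec h5
    rw [Matrix.mulVec_sub, h2, h3, sub_zero, Matrix.mulVec_smul] at this
    exact (smul_eq_zero.1 this.symm).resolve_left (by positivity)
  apply Matrix.ext_of_mulVec_single
  intro i
  rw [Matrix.zero_mulVec, h.expand (Pi.single i 1)]
  simp [Matrix.mulVec_add, Matrix.mulVec_smul, h6, h1, h7]

theorem rank_rot_le (h : IsSpectralFrame M v μ) (hε : ε ^ 2 = 1) :
    (M + √(μ 1) • (h.rot hε : Matrix (Fin 3) (Fin 3) ℝ)).rank ≤ 1 := by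
  obtain ⟨h1, h2, -, -⟩ := h.kerVec_dot hε
  have h11 : v 1 ⬝ᵥ v 1 = 1 := by rw [h.ortho, if_pos rfl]
  obtain ⟨h5, h6⟩ := h.rot_mulVec hε
  refine (rank_le_one_iff _).2 ⟨_, _, fun h0 => ?_, h5, h6⟩
  have := cross_dot_cross (v 1) (kerVec v μ ε) (v 1) (kerVec v μ ε)
  rw [h0, h11, h1, h2] at this
  simp at this

/-- Let `n` be normal to a plane killed by `M + s Q`. On this plane `|M z|² = s² |z|²`; tested on
three vectors of it, this becomes equations in the squared coordinates of `n` in the frame `v`. They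
force `n` to be orthogonal to `v 1`, `s² = μ 1`, and the plane to be one of two. -/
theorem eq_of_rank_le (h : IsSpectralFrame M v μ) {s : ℝ} (hs : 0 < s) {Q : SO3}
    (hr : (M + s • (Q : Matrix (Fin 3) (Fin 3) ℝ)).rank ≤ 1) :
    s = √(μ 1) ∧ ∃ (ε : ℝ) (hε : ε ^ 2 = 1), Q = h.rot hε := by
  obtain ⟨k₀, k₁, hn, hk₀, hk₁⟩ := (rank_le_one_iff _).1 hr
  set n := crossProduct k₀ k₁ with hnd
  set W := M + s • (Q : Matrix (Fin 3) (Fin 3) ℝ) with hW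
  have hnW : ∀ z, W.mulVec (crossProduct n z) = 0 := fun z => by
    rw [hnd, cross_cross_eq_smul_sub_smul, Matrix.mulVec_sub, Matrix.mulVec_smul,
      Matrix.mulVec_smul, hk₀, hk₁]
    simp
  have hMQ : ∀ z, W.mulVec z = 0 → M.mulVec z = -(s • (Q : Matrix (Fin 3) (Fin 3) ℝ).mulVec z) := by
    intro z hz
    rw [hW, Matrix.add_mulVec, Matrix.smul_mulVec] at hz
    exact eq_neg_of_add_eq_zero_left hz
  have hdot : ∀ z w, W.mulVec z = 0 → W.mulVec w = 0 →
      M.mulVec z ⬝ᵥ M.mulVec w = s ^ 2 * (z ⬝ᵥ w) := by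
    intro z w hz hw
    rw [hMQ z hz, hMQ w hw, neg_dotProduct_neg, smul_dotProduct, dotProduct_smul, Q.dot_mulVec]
    simp only [smul_eq_mul]; ring
  -- These are the vectors `n × (v j × v i)`, which lie in the plane orthogonal to `n`.
  have hv : ∀ i j, W.mulVec ((n ⬝ᵥ v i) • v j - (n ⬝ᵥ v j) • v i) = 0 := fun i j => by
    have := hnW (crossProduct (v j) (v i))
    rwa [cross_cross_eq_smul_sub_smul', dotProduct_comm n (v j), dotProduct_comm n (v i)] at *
  have hq : ∀ i j k l, (M.mulVec ((n ⬝ᵥ v i) • v j - (n ⬝ᵥ v j) • v i)) ⬝ᵥ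
      (M.mulVec ((n ⬝ᵥ v k) • v l - (n ⬝ᵥ v l) • v k)) =
      s ^ 2 * (((n ⬝ᵥ v i) • v j - (n ⬝ᵥ v j) • v i) ⬝ᵥ ((n ⬝ᵥ v k) • v l - (n ⬝ᵥ v l) • v k)) :=
    fun i j k l => hdot _ _ (hv i j) (hv k l)
  have hexp := h.expand n
  have hn0 : ¬ (n ⬝ᵥ v 0 = 0 ∧ n ⬝ᵥ v 1 = 0 ∧ n ⬝ᵥ v 2 = 0) := by
    rintro ⟨a0, a1, a2⟩
    rw [dotProduct_comm (v 0), dotProduct_comm (v 1), dotProduct_comm (v 2), a0, a1, a2] at hexp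
    exact hn (by rw [hexp]; simp)
  have q1 := hq 0 1 0 1
  have q2 := hq 0 2 0 2
  have q3 := hq 1 2 1 2
  simp only [Matrix.mulVec_sub, Matrix.mulVec_smul, sub_dotProduct, dotProduct_sub,
    smul_dotProduct, dotProduct_smul, h.dot_mulVec, h.ortho, smul_eq_mul] at q1 q2 q3
  simp at q1 q2 q3
  obtain ⟨hcs, hcs2, hc, hsn⟩ := h.cos_sq_add_sin_sq
  have h01 := h.lt01
  have h12 := h.lt12
  have hker : ∀ z, n ⬝ᵥ z = 0 → W.mulVec z = 0 := fun z hz => by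
    have h1 := hnW (crossProduct z n)
    rw [cross_cross_eq_smul_sub_smul', dotProduct_comm z n, hz, zero_smul, sub_zero,
      Matrix.mulVec_smul] at h1
    exact (smul_eq_zero.1 h1).resolve_left fun h0 => hn (dotProduct_self_eq_zero.1 h0)
  have hkv : ∀ ε, n ⬝ᵥ kerVec v μ ε = √((μ 1 - μ 2) / (μ 0 - μ 2)) * (n ⬝ᵥ v 0) +
      ε * √((μ 0 - μ 1) / (μ 0 - μ 2)) * (n ⬝ᵥ v 2) := fun ε => by
    simp [kerVec]
  generalize √((μ 1 - μ 2) / (μ 0 - μ 2)) = c at *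
  generalize √((μ 0 - μ 1) / (μ 0 - μ 2)) = t at *
  have hfin : n ⬝ᵥ v 1 = 0 ∧ s ^ 2 = μ 1 ∧ (c * (n ⬝ᵥ v 0)) ^ 2 = (t * (n ⬝ᵥ v 2)) ^ 2 := by
    generalize n ⬝ᵥ v 0 = n0 at *
    generalize n ⬝ᵥ v 1 = n1 at *
    generalize n ⬝ᵥ v 2 = n2 at *
    generalize μ 0 = a at *
    generalize μ 1 = b at *
    generalize μ 2 = d at *
    generalize s ^ 2 = r at *
    have p1 : n0 ^ 2 * (b - r) + n1 ^ 2 * (a - r) = 0 := by linear_combination q1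
    have p2 : n0 ^ 2 * (d - r) + n2 ^ 2 * (a - r) = 0 := by linear_combination q2
    have p3 : n1 ^ 2 * (d - r) + n2 ^ 2 * (b - r) = 0 := by linear_combination q3
    -- With `a > b > d`, a nonzero `n1` makes the left side of `p3` negative if `r ≥ b`, and that of
    -- `p1` positive if `r < b`.
    have hn1 : n1 = 0 := by
      by_contra hne
      have hsq : 0 < n1 ^ 2 := by positivity
      rcases lt_trichotomy b r with hb | hb | hb
      · have : n1 ^ 2 * (d - r) < 0 := mul_neg_of_pos_of_neg hsq (by linarith)
        have : n2 ^ 2 * (b - r) ≤ 0 := mul_nonpos_of_nonneg_of_nonpos (sq_nonneg _) (by linarith)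
        linarith
      · have : n1 ^ 2 * (d - r) < 0 := mul_neg_of_pos_of_neg hsq (by linarith)
        have : n2 ^ 2 * (b - r) = 0 := by rw [hb]; ring
        linarith
      · have : 0 < n1 ^ 2 * (a - r) := mul_pos hsq (by linarith)
        have : 0 ≤ n0 ^ 2 * (b - r) := mul_nonneg (sq_nonneg _) (by linarith)
        linarith
    subst hn1
    have hb : r = b := by
      by_contra hne
      have hbr : b - r ≠ 0 := fun h0 => hne (by linarith)
      have m0 : n0 = 0 := by
        have : n0 ^ 2 * (b - r) = 0 := by linarith
        simpa [hbr] using this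
      have m2 : n2 = 0 := by
        have : n2 ^ 2 * (b - r) = 0 := by linarith
        simpa [hbr] using this
      exact hn0 ⟨m0, rfl, m2⟩
    subst hb
    refine ⟨rfl, rfl, ?_⟩
    have had : a - d ≠ 0 := by linarith
    have hc2 : c ^ 2 * (a - d) = r - d := by linear_combination hcs2 - d * hcs
    have ht2 : t ^ 2 * (a - d) = a - r := by linear_combination a * hcs - hcs2
    refine mul_right_cancel₀ had ?_
    linear_combination n0 ^ 2 * hc2 - n2 ^ 2 * ht2 - p2
  obtain ⟨hn1, hsμ, hn02⟩ := hfin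
  have hsb : s = √(μ 1) := by rw [← hsμ, Real.sqrt_sq hs.le]
  refine ⟨hsb, ?_⟩
  obtain ⟨ε, hε, hεn⟩ : ∃ ε : ℝ, ε ^ 2 = 1 ∧ n ⬝ᵥ kerVec v μ ε = 0 := by
    rcases sq_eq_sq_iff_eq_or_eq_neg.1 hn02 with h0 | h0
    · exact ⟨-1, by norm_num, by rw [hkv]; linarith⟩
    · exact ⟨1, by norm_num, by rw [hkv]; linarith⟩
  refine ⟨ε, hε, ?_⟩
  obtain ⟨r1, r2⟩ := h.rot_mulVec hε
  obtain ⟨d1, d2, -, -⟩ := h.kerVec_dot hε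
  have h11 : v 1 ⬝ᵥ v 1 = 1 := by rw [h.ortho, if_pos rfl]
  have w1 := hker _ hn1
  have w2 := hker _ hεn
  rw [hW, hsb] at w1 w2
  have heq : ∀ z, (M + √(μ 1) • (Q : Matrix (Fin 3) (Fin 3) ℝ)).mulVec z = 0 →
      (M + √(μ 1) • (h.rot hε : Matrix (Fin 3) (Fin 3) ℝ)).mulVec z = 0 →
      (Q : Matrix (Fin 3) (Fin 3) ℝ).mulVec z = (h.rot hε : Matrix (Fin 3) (Fin 3) ℝ).mulVec z := by
    intro z hz hz'
    rw [← hz', Matrix.add_mulVec, Matrix.add_mulVec, Matrix.smul_mulVec, Matrix.smul_mulVec] at hz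
    exact smul_right_injective _ (Real.sqrt_pos.2 h.pos).ne' (add_left_cancel hz)
  -- Agreement on an orthonormal pair suffices, since the third column of the frame is their cross
  -- product.
  have hF : Q * frameSO3 h11 d1 d2 = h.rot hε * frameSO3 h11 d1 d2 := by
    apply Subtype.ext
    change (Q : Matrix (Fin 3) (Fin 3) ℝ) * frameMat (v 1) (kerVec v μ ε) =
      (h.rot hε : Matrix (Fin 3) (Fin 3) ℝ) * frameMat (v 1) (kerVec v μ ε)
    rw [SO3.mul_frameMat, SO3.mul_frameMat, heq _ w1 r1, heq _ w2 r2]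
  exact mul_right_cancel hF

end IsSpectralFrame

/-! ### Differentiable dependence of eigenvectors and of the two rotations on the base point. -/

/-- The equations for a unit eigenvector. -/
def eigenEq (z : (Fin 3 → Fin 3 → ℝ) × ((Fin 3 → ℝ) × ℝ)) : (Fin 3 → ℝ) × ℝ :=
  (fun i => ∑ j, z.1 i j * z.2.1 j - z.2.2 * z.2.1 i, ∑ j, z.2.1 j * z.2.1 j - 1)

theorem contDiff_eigenEq : ContDiff ℝ 1 eigenEq := by
  unfold eigenEq
  fun_prop

/-- The implicit function theorem applies to `(G w - ν w, |w|² - 1)` in the unknowns `(w, ν)`: at a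
simple eigenvalue of a symmetric matrix the partial derivative is injective. The solutions are
defined for all nearby matrices, symmetric or not. -/
theorem exists_eigenvector_function {G₀ : Fin 3 → Fin 3 → ℝ} (hsymm : ∀ i j, G₀ i j = G₀ j i)
    {w₀ : Fin 3 → ℝ} {ν₀ : ℝ} (hw : w₀ ⬝ᵥ w₀ = 1) (hν : (Matrix.of G₀).mulVec w₀ = ν₀ • w₀)
    (hsimple : ∀ u, (Matrix.of G₀).mulVec u = ν₀ • u → u ⬝ᵥ w₀ = 0 → u = 0) :
    ∃ (W : (Fin 3 → Fin 3 → ℝ) → Fin 3 → ℝ) (N : (Fin 3 → Fin 3 → ℝ) → ℝ),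
      DifferentiableAt ℝ W G₀ ∧ DifferentiableAt ℝ N G₀ ∧ W G₀ = w₀ ∧ N G₀ = ν₀ ∧
      ∀ᶠ G in 𝓝 G₀, (Matrix.of G).mulVec (W G) = N G • W G ∧ W G ⬝ᵥ W G = 1 := by
  set z₀ : (Fin 3 → Fin 3 → ℝ) × ((Fin 3 → ℝ) × ℝ) := (G₀, w₀, ν₀) with hz₀
  have hstrict : HasStrictFDerivAt eigenEq (fderiv ℝ eigenEq z₀) z₀ :=
    contDiff_eigenEq.contDiffAt.hasStrictFDerivAt one_ne_zero
  have hpart : ∀ u c, fderiv ℝ eigenEq z₀ (0, u, c) =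
      ((Matrix.of G₀).mulVec u - ν₀ • u - c • w₀, 2 * (u ⬝ᵥ w₀)) := by
    intro u c
    have h1 : HasDerivAt (fun t : ℝ => z₀ + t • ((0, u, c) : (Fin 3 → Fin 3 → ℝ) × ((Fin 3 → ℝ) × ℝ)))
        (0, u, c) 0 := by
      simpa using ((hasDerivAt_id' (0 : ℝ)).smul_const
        ((0, u, c) : (Fin 3 → Fin 3 → ℝ) × ((Fin 3 → ℝ) × ℝ))).const_add z₀
    have h2 := hstrict.hasFDerivAt.comp_hasDerivAt_of_eq (0 : ℝ) h1 (by simp)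
    refine h2.unique ?_
    have hid := hasDerivAt_id' (0 : ℝ)
    have hw' : ∀ j, HasDerivAt (fun t : ℝ => w₀ j + t * u j) (u j) 0 := fun j => by
      simpa using (hid.mul_const (u j)).const_add (w₀ j)
    have hν' : HasDerivAt (fun t : ℝ => ν₀ + t * c) c 0 := by
      simpa using (hid.mul_const c).const_add ν₀
    have hfun : eigenEq ∘ (fun t : ℝ => z₀ + t • ((0, u, c) : (Fin 3 → Fin 3 → ℝ) × ((Fin 3 → ℝ) × ℝ))) =
        fun t : ℝ => (fun i => ∑ j, G₀ i j * (w₀ j + t * u j) - (ν₀ + t * c) * (w₀ i + t * u i),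
          ∑ j, (w₀ j + t * u j) * (w₀ j + t * u j) - 1) := by
      funext t
      simp [eigenEq, hz₀]
    rw [hfun]
    refine HasDerivAt.prodMk ?_ ?_
    · rw [hasDerivAt_pi]
      intro i
      refine ((HasDerivAt.fun_sum fun j _ => (hw' j).const_mul (G₀ i j)).fun_sub
        (hν'.fun_mul (hw' i))).congr_deriv ?_
      simp [Matrix.mulVec, dotProduct]
      ring
    · refine ((HasDerivAt.fun_sum fun j _ => (hw' j).fun_mul (hw' j)).sub_const 1).congr_deriv ?_
      simp [dotProduct, Fin.sum_univ_three]
      ring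
  have hinj : Function.Injective
      (fderiv ℝ eigenEq z₀ ∘L ContinuousLinearMap.inr ℝ (Fin 3 → Fin 3 → ℝ) ((Fin 3 → ℝ) × ℝ)) := by
    rw [injective_iff_map_eq_zero]
    rintro ⟨u, c⟩ h
    change fderiv ℝ eigenEq z₀ (0, u, c) = 0 at h
    rw [hpart, Prod.mk_eq_zero] at h
    obtain ⟨h1, h2⟩ := h
    have h3 : u ⬝ᵥ w₀ = 0 := by linarith
    -- Pairing with `w₀` removes the `u` terms by symmetry and isolates `c`.
    have hc : c = 0 := by
      have h4 := congrArg (fun z => w₀ ⬝ᵥ z) h1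
      have h5 : w₀ ⬝ᵥ (Matrix.of G₀).mulVec u = ν₀ * (u ⬝ᵥ w₀) := by
        have : (Matrix.of G₀).transpose = Matrix.of G₀ := by ext i j; exact hsymm j i
        rw [Matrix.dotProduct_mulVec, ← Matrix.mulVec_transpose, this, hν, smul_dotProduct,
          dotProduct_comm, smul_eq_mul]
      simp only [dotProduct_sub, dotProduct_smul, h5, h3, hw, dotProduct_comm w₀ u,
        smul_eq_mul, mul_zero, mul_one, sub_zero, zero_sub, dotProduct_zero] at h4
      linarith
    subst hc
    rw [zero_smul, sub_zero, sub_eq_zero] at h1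
    rw [hsimple u h1 h3]
    rfl
  have hinv : (fderiv ℝ eigenEq z₀ ∘L
      ContinuousLinearMap.inr ℝ (Fin 3 → Fin 3 → ℝ) ((Fin 3 → ℝ) × ℝ)).IsInvertible := by
    refine ⟨(LinearEquiv.ofInjectiveEndo _ hinj).toContinuousLinearEquiv, ?_⟩
    ext x <;> rfl
  set φ := hstrict.implicitFunctionOfProdDomain hinv with hφ
  have hd : DifferentiableAt ℝ φ G₀ :=
    (hstrict.hasStrictFDerivAt_implicitFunctionOfProdDomain hinv).hasFDerivAt.differentiableAt
  have hφ0 : φ G₀ = (w₀, ν₀) :=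
    (hstrict.eventually_apply_eq_iff_implicitFunctionOfProdDomain hinv).self_of_nhds.1 rfl
  refine ⟨fun G => (φ G).1, fun G => (φ G).2, hd.fst, hd.snd, congrArg Prod.fst hφ0,
    congrArg Prod.snd hφ0, ?_⟩
  filter_upwards [hstrict.eventually_apply_implicitFunctionOfProdDomain hinv] with G hG
  have h0 : eigenEq z₀ = 0 := by
    refine Prod.ext ?_ ?_
    · ext i
      have := congrFun hν i
      simp only [Matrix.mulVec, dotProduct, Matrix.of_apply, Pi.smul_apply, smul_eq_mul] at this
      simp [eigenEq, hz₀, this]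
    · simp only [dotProduct] at hw
      simp [eigenEq, hz₀, hw]
  rw [h0] at hG
  obtain ⟨hG1, hG2⟩ := Prod.mk_eq_zero.1 hG
  constructor
  · ext i
    have := congrFun hG1 i
    simp only [Pi.zero_apply, sub_eq_zero] at this
    exact this
  · exact sub_eq_zero.1 hG2

/-- The three eigenvectors are continued separately; they stay orthogonal because they belong to
distinct eigenvalues of a symmetric matrix, and continuity keeps the order. Differentiability at the
single parameter `0` is enough for the `O(L)` estimates. -/
theorem exists_spectralFrame_curve {M : ℝ → Matrix (Fin 3) (Fin 3) ℝ}
    (hM : ∀ i j, DifferentiableAt ℝ (fun L => M L i j) 0) {v : Fin 3 → Fin 3 → ℝ} {μ : Fin 3 → ℝ}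
    (h : IsSpectralFrame (M 0) v μ) :
    ∃ (V : ℝ → Fin 3 → Fin 3 → ℝ) (N : ℝ → Fin 3 → ℝ), V 0 = v ∧ N 0 = μ ∧
      (∀ i j, DifferentiableAt ℝ (fun L => V L i j) 0) ∧
      (∀ i, DifferentiableAt ℝ (fun L => N L i) 0) ∧
      ∀ᶠ L in 𝓝 (0 : ℝ), IsSpectralFrame (M L) (V L) (N L) := by
  set G : ℝ → Fin 3 → Fin 3 → ℝ := fun L i j => ((M L).transpose * M L) i j with hG
  have hGd : DifferentiableAt ℝ G 0 := by
    rw [differentiableAt_pi]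
    intro i
    rw [differentiableAt_pi]
    intro j
    simp only [hG, Matrix.mul_apply, Matrix.transpose_apply]
    exact DifferentiableAt.fun_sum fun k _ => (hM k i).fun_mul (hM k j)
  have hsymm : ∀ L i j, G L i j = G L j i := fun L i j => by
    simp only [hG, Matrix.mul_apply, Matrix.transpose_apply]
    exact Finset.sum_congr rfl fun k _ => mul_comm _ _
  have key : ∀ i, ∃ (W : (Fin 3 → Fin 3 → ℝ) → Fin 3 → ℝ) (N : (Fin 3 → Fin 3 → ℝ) → ℝ),
      DifferentiableAt ℝ W (G 0) ∧ DifferentiableAt ℝ N (G 0) ∧ W (G 0) = v i ∧ N (G 0) = μ i ∧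
      ∀ᶠ g in 𝓝 (G 0), (Matrix.of g).mulVec (W g) = N g • W g ∧ W g ⬝ᵥ W g = 1 := fun i => by
    refine exists_eigenvector_function (hsymm 0) (by rw [h.ortho, if_pos rfl]) (h.eig i) ?_
    intro u hu hu0
    have h1 := h.hasSimpleSpectrum _ _ _ hu (h.eig i)
    have h2 := dot_mul_dot_of_cross_eq_zero h1 u
    rw [h.ortho, if_pos rfl, one_mul, hu0, zero_mul] at h2
    exact dotProduct_self_eq_zero.1 h2
  choose W N hW hN hW0 hN0 hev using key
  have hVd : ∀ i, DifferentiableAt ℝ (fun L => W i (G L)) 0 := fun i => (hW i).comp 0 hGd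
  have hNd : ∀ i, DifferentiableAt ℝ (fun L => N i (G L)) 0 := fun i => (hN i).comp 0 hGd
  refine ⟨fun L i => W i (G L), fun L i => N i (G L), funext hW0, funext hN0,
    fun i j => (differentiableAt_pi.1 (hVd i)) j, hNd, ?_⟩
  have hlt : ∀ i j, μ i < μ j → ∀ᶠ L in 𝓝 (0 : ℝ), N i (G L) < N j (G L) := fun i j hij =>
    (hNd i).continuousAt.eventually_lt (hNd j).continuousAt (by rwa [hN0, hN0])
  have hev' : ∀ i, ∀ᶠ L in 𝓝 (0 : ℝ), ((M L).transpose * M L).mulVec (W i (G L)) =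
      N i (G L) • W i (G L) ∧ W i (G L) ⬝ᵥ W i (G L) = 1 := fun i =>
    hGd.continuousAt.eventually (hev i)
  filter_upwards [hev' 0, hev' 1, hev' 2, hlt 1 0 h.lt01, hlt 2 1 h.lt12] with L h0 h1 h2 h01 h12
  have he : ∀ i, ((M L).transpose * M L).mulVec (W i (G L)) = N i (G L) • W i (G L) ∧
      W i (G L) ⬝ᵥ W i (G L) = 1 := fun i => by fin_cases i; exacts [h0, h1, h2]
  refine ⟨fun i j => ?_, fun i => (he i).1, h01, h12⟩
  rcases eq_or_ne i j with rfl | hij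
  · rw [if_pos rfl]; exact (he i).2
  · rw [if_neg hij]
    have hne : N i (G L) ≠ N j (G L) := by
      have h02 := h12.trans h01
      fin_cases i <;> fin_cases j <;> simp_all <;>
        first | exact h01.ne' | exact h01.ne | exact h12.ne | exact h12.ne' | exact h02.ne | exact h02.ne'
    have h3 : N j (G L) * (W i (G L) ⬝ᵥ W j (G L)) = N i (G L) * (W i (G L) ⬝ᵥ W j (G L)) := by
      have a1 := dot_transpose_mul_self (M L) (W i (G L)) (W j (G L))
      have a2 := dot_transpose_mul_self (M L) (W j (G L)) (W i (G L))
      rw [(he j).1, dotProduct_smul, smul_eq_mul] at a1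
      rw [(he i).1, dotProduct_smul, smul_eq_mul, dotProduct_comm (W j (G L)),
        dotProduct_comm ((M L).mulVec _)] at a2
      rw [a1, a2]
    have h4 : (N j (G L) - N i (G L)) * (W i (G L) ⬝ᵥ W j (G L)) = 0 := by linarith
    exact (mul_eq_zero.1 h4).resolve_left (sub_ne_zero.2 hne.symm)

theorem exists_spectralFrame {M : Matrix (Fin 3) (Fin 3) ℝ}
    (hσ : Function.Injective (singularValues M)) : ∃ v μ, IsSpectralFrame M v μ := by
  set T := Matrix.toEuclideanLin M with hT
  have hn : Module.finrank ℝ (EuclideanSpace ℝ (Fin 3)) = 3 := by simp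
  have hS := T.isSymmetric_adjoint_comp_self
  have hadj : LinearMap.adjoint T = Matrix.toEuclideanLin M.transpose := by
    rw [hT, ← Matrix.toEuclideanLin_conjTranspose_eq_adjoint, Matrix.conjTranspose_eq_transpose_of_trivial]
  have hsq : ∀ i : Fin 3, hS.eigenvalues hn i = singularValues M i ^ 2 := fun i =>
    (T.sq_singularValues_fin hn i).symm
  have hlt : ∀ i j : Fin 3, i < j → hS.eigenvalues hn j < hS.eigenvalues hn i := by
    intro i j hij
    have h1 : singularValues M j ≤ singularValues M i := T.singularValues_antitone hij.le
    have h2 : singularValues M j ≠ singularValues M i := fun h => hij.ne' (hσ h)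
    have h3 : 0 ≤ singularValues M j := T.singularValues_nonneg j
    rw [hsq, hsq]
    exact pow_lt_pow_left₀ (lt_of_le_of_ne h1 h2) h3 two_ne_zero
  refine ⟨fun i => (hS.eigenvectorBasis hn i).ofLp, hS.eigenvalues hn, fun i j => ?_, fun i => ?_,
    hlt 0 1 (by decide), hlt 1 2 (by decide)⟩
  · have h1 := orthonormal_iff_ite.1 (hS.eigenvectorBasis hn).orthonormal i j
    rw [EuclideanSpace.inner_eq_star_dotProduct, star_trivial, dotProduct_comm] at h1
    exact h1
  · have h1 := hS.apply_eigenvectorBasis hn i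
    have h2 := congrArg WithLp.ofLp
      ((LinearMap.congr_fun hadj (T (hS.eigenvectorBasis hn i))).symm.trans h1)
    rw [← Matrix.mulVec_mulVec]
    exact h2

theorem differentiableAt_curvatureMatrix {A₀ : OneForm} {R : ℝ} (hR : 0 < R)
    (hA₀ : IsASDConnectionOn A₀ (Metric.ball 0 R)) (a i : Fin 3) :
    DifferentiableAt ℝ (fun L : ℝ => curvatureMatrix (curvature A₀ ((L : ℍ))) a i) 0 := by
  have hA : ∀ μ, ContDiffAt ℝ ∞ (A₀ μ) 0 := fun μ =>
    (hA₀.smooth μ).contDiffAt (Metric.isOpen_ball.mem_nhds (Metric.mem_ball_self hR))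
  have hF : ∀ μ ν, DifferentiableAt ℝ (fun x => curvature A₀ x μ ν) 0 := by
    intro μ ν
    have hd : ∀ μ, DifferentiableAt ℝ (A₀ μ) 0 := fun μ => (hA μ).differentiableAt (by simp)
    have hf : ∀ μ v, DifferentiableAt ℝ (fun x => fderiv ℝ (A₀ μ) x v) 0 := fun μ v =>
      (((hA μ).fderiv_right (m := 1)
        (WithTop.coe_le_coe.2 (le_top : (1 + 1 : ℕ∞) ≤ ⊤))).differentiableAt one_ne_zero).clm_apply
        (differentiableAt_const v)
    unfold curvature
    exact ((hf ν _).fun_sub (hf μ _)).fun_add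
      (((hd μ).fun_mul (hd ν)).fun_sub ((hd ν).fun_mul (hd μ)))
  have hL : DifferentiableAt ℝ (fun L : ℝ => (L : ℍ)) 0 := by
    have : (fun L : ℝ => (L : ℍ)) = fun L => L • (1 : ℍ) := by
      funext L; rw [← Quaternion.coe_one, Quaternion.smul_coe, mul_one]
    rw [this]; fun_prop
  have hF' : ∀ μ ν, DifferentiableAt ℝ (fun L : ℝ => curvature A₀ (L : ℍ) μ ν) 0 := fun μ ν =>
    DifferentiableAt.comp (g := fun x => curvature A₀ x μ ν) (0 : ℝ) (by simpa using hF μ ν) hL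
  let c : ℍ →L[ℝ] ℝ := ((LinearMap.proj a).comp imCoordₗ).toContinuousLinearMap
  have hc : ∀ L : ℝ, curvatureMatrix (curvature A₀ ((L : ℍ))) a i = (1 / 4) *
      c (![curvature A₀ (L : ℍ) 0 1 - curvature A₀ (L : ℍ) 2 3,
        curvature A₀ (L : ℍ) 0 2 - curvature A₀ (L : ℍ) 3 1,
        curvature A₀ (L : ℍ) 0 3 - curvature A₀ (L : ℍ) 1 2] i) := fun L =>
    curvatureMatrix_apply _ (fun μ ν => by simp only [curvature]; abel) a i
  simp only [hc]
  refine DifferentiableAt.const_mul (c.differentiableAt.comp (0 : ℝ) ?_) _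
  fin_cases i
  · exact (hF' 0 1).fun_sub (hF' 2 3)
  · exact (hF' 0 2).fun_sub (hF' 3 1)
  · exact (hF' 0 3).fun_sub (hF' 1 2)

theorem isSkewIm_curvature_of_mem {A₀ : OneForm} {R : ℝ}
    (hA₀ : IsASDConnectionOn A₀ (Metric.ball 0 R)) {x : ℍ} (hx : x ∈ Metric.ball (0 : ℍ) R) :
    IsSkewIm (curvature A₀ x) := by
  have hnhds := Metric.isOpen_ball.mem_nhds hx
  refine isSkewIm_curvature (fun μ => ((hA₀.smooth μ).contDiffAt hnhds).differentiableAt (by simp))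
    fun μ => ?_
  filter_upwards [hnhds] with z hz using hA₀.imaginary μ z hz

/-- All radicands are positive at `0`, by the strict ordering of the eigenvalues. -/
theorem differentiableAt_rotMat {M : ℝ → Matrix (Fin 3) (Fin 3) ℝ} {V : ℝ → Fin 3 → Fin 3 → ℝ}
    {N : ℝ → Fin 3 → ℝ} (hM : ∀ i j, DifferentiableAt ℝ (fun L => M L i j) 0)
    (hV : ∀ i j, DifferentiableAt ℝ (fun L => V L i j) 0)
    (hN : ∀ i, DifferentiableAt ℝ (fun L => N L i) 0) (h : IsSpectralFrame (M 0) (V 0) (N 0))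
    (ε : ℝ) (i j : Fin 3) : DifferentiableAt ℝ (fun L => rotMat (M L) (V L) (N L) ε i j) 0 := by
  have h01 := h.lt01
  have h12 := h.lt12
  have h02 : 0 < N 0 0 - N 0 2 := by linarith
  have hsq : DifferentiableAt ℝ (fun L => (√(N L 1))⁻¹) 0 :=
    ((hN 1).sqrt h.pos.ne').inv (Real.sqrt_pos.2 h.pos).ne'
  have hc : DifferentiableAt ℝ (fun L => √((N L 1 - N L 2) / (N L 0 - N L 2))) 0 :=
    (((hN 1).fun_sub (hN 2)).fun_div ((hN 0).fun_sub (hN 2)) h02.ne').sqrt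
      (div_pos (by linarith) h02).ne'
  have hs : DifferentiableAt ℝ (fun L => √((N L 0 - N L 1) / (N L 0 - N L 2))) 0 :=
    (((hN 0).fun_sub (hN 1)).fun_div ((hN 0).fun_sub (hN 2)) h02.ne').sqrt
      (div_pos (by linarith) h02).ne'
  have hk : ∀ j, DifferentiableAt ℝ (fun L => kerVec (V L) (N L) ε j) 0 := fun j => by
    simp only [kerVec, Pi.add_apply, Pi.smul_apply, smul_eq_mul]
    exact (hc.fun_mul (hV 0 j)).fun_add ((hs.const_mul ε).fun_mul (hV 2 j))
  have hMv : ∀ w : ℝ → Fin 3 → ℝ, (∀ j, DifferentiableAt ℝ (fun L => w L j) 0) → ∀ i,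
      DifferentiableAt ℝ (fun L => (-(√(N L 1))⁻¹ • (M L).mulVec (w L)) i) 0 := by
    intro w hw i
    simp only [Pi.smul_apply, smul_eq_mul, Matrix.mulVec, dotProduct]
    exact hsq.fun_neg.fun_mul (DifferentiableAt.fun_sum fun k _ => (hM i k).fun_mul (hw k))
  have hfr : ∀ x y : ℝ → Fin 3 → ℝ, (∀ j, DifferentiableAt ℝ (fun L => x L j) 0) →
      (∀ j, DifferentiableAt ℝ (fun L => y L j) 0) → ∀ i j,
      DifferentiableAt ℝ (fun L => frameMat (x L) (y L) i j) 0 := by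
    intro x y hx hy i j
    have hcr : ∀ a b, DifferentiableAt ℝ (fun L => x L a * y L b - x L b * y L a) 0 := fun a b =>
      ((hx a).fun_mul (hy b)).fun_sub ((hx b).fun_mul (hy a))
    fin_cases j
    · exact hx i
    · exact hy i
    · fin_cases i
      · simpa [frameMat, cross_apply] using hcr 1 2
      · simpa [frameMat, cross_apply] using hcr 2 0
      · simpa [frameMat, cross_apply] using hcr 0 1
  simp only [rotMat, Matrix.mul_apply, Matrix.transpose_apply]
  exact DifferentiableAt.fun_sum fun k _ =>
    (hfr _ _ (hMv _ (hV 1)) (hMv _ hk) i k).fun_mul (hfr _ _ (hV 1) hk j k)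

/-! ### The double cover of `SO(3)` by unit quaternions. -/

theorem conjSO3_mul {u v : ℍ} (hu : u ≠ 0) (hv : v ≠ 0) :
    conjSO3 (u * v) = conjSO3 u * conjSO3 v := by
  apply Subtype.ext
  rw [Submonoid.coe_mul, coe_conjSO3 (mul_ne_zero hu hv), coe_conjSO3 hu, coe_conjSO3 hv,
    conjMatrix_mul, norm_mul, Matrix.smul_mul, Matrix.mul_smul, smul_smul, mul_pow, mul_inv]

theorem conjSO3_smul {t : ℝ} (ht : t ≠ 0) (u : ℍ) : conjSO3 (t • u) = conjSO3 u := by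
  by_cases hu : u = 0
  · simp [hu]
  apply Subtype.ext
  rw [coe_conjSO3 (smul_ne_zero ht hu), coe_conjSO3 hu, conjMatrix_smul, smul_smul, norm_smul,
    mul_pow, Real.norm_eq_abs, sq_abs]
  congr 1
  field_simp

theorem trace_conjSO3 {u : ℍ} (hu : u ≠ 0) :
    (conjSO3 u : Matrix (Fin 3) (Fin 3) ℝ).trace = 4 * u.re ^ 2 / ‖u‖ ^ 2 - 1 := by
  have hn : ‖u‖ ^ 2 ≠ 0 := pow_ne_zero 2 (norm_ne_zero_iff.2 hu)
  have h : (conjMatrix u).trace = 4 * u.re ^ 2 - ‖u‖ ^ 2 := by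
    rw [norm_sq_eq, Matrix.trace_fin_three]
    simp [conjMatrix]
    ring
  rw [coe_conjSO3 hu, Matrix.trace_smul, h, smul_eq_mul]
  field_simp

theorem conjSO3_one : conjSO3 1 = 1 := by
  apply Subtype.ext
  rw [coe_conjSO3 one_ne_zero, conjMatrix_one]
  simp

theorem conjSO3_inv {u : ℍ} (hu : u ≠ 0) : conjSO3 u⁻¹ = (conjSO3 u)⁻¹ := by
  rw [eq_inv_iff_mul_eq_one, ← conjSO3_mul (inv_ne_zero hu) hu, inv_mul_cancel₀ hu, conjSO3_one]

/-- The quotient `u v⁻¹` acts trivially, so its trace is `3`; the trace formula then leaves no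
imaginary part. -/
theorem exists_smul_of_conjSO3_eq {u v : ℍ} (hu : u ≠ 0) (hv : v ≠ 0)
    (h : conjSO3 u = conjSO3 v) : ∃ t : ℝ, t ≠ 0 ∧ u = t • v := by
  set w := u * v⁻¹ with hw
  have hw0 : w ≠ 0 := mul_ne_zero hu (inv_ne_zero hv)
  have h1 : conjSO3 w = 1 := by
    rw [hw, conjSO3_mul hu (inv_ne_zero hv), conjSO3_inv hv, h, mul_inv_cancel]
  have hn : ‖w‖ ^ 2 ≠ 0 := pow_ne_zero 2 (norm_ne_zero_iff.2 hw0)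
  have h2 := trace_conjSO3 hw0
  rw [h1] at h2
  have h3 : w.re ^ 2 = ‖w‖ ^ 2 := by
    have : (((1 : SO3) : Matrix (Fin 3) (Fin 3) ℝ)).trace = 3 := by simp
    rw [this] at h2
    field_simp at h2
    linarith
  have h4 : w = (w.re : ℍ) := by
    have h5 := norm_sq_eq w
    have hI : w.imI = 0 := by nlinarith [sq_nonneg w.imI, sq_nonneg w.imJ, sq_nonneg w.imK]
    have hJ : w.imJ = 0 := by nlinarith [sq_nonneg w.imI, sq_nonneg w.imJ, sq_nonneg w.imK]
    have hK : w.imK = 0 := by nlinarith [sq_nonneg w.imI, sq_nonneg w.imJ, sq_nonneg w.imK]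
    ext <;> simp [hI, hJ, hK]
  refine ⟨w.re, fun h0 => hw0 (by rw [h4, h0]; rfl), ?_⟩
  rw [← Quaternion.coe_mul_eq_smul, ← h4, hw, inv_mul_cancel_right₀ hv]

/-- The witness has real part `1 + tr Q` and as imaginary part the vector of `Q - Qᵀ`. For `Q =
Ad(g)` with `g` a unit quaternion, this is `4 Re(g) g`, nonzero exactly when `tr Q ≠ -1`. -/
theorem exists_conjSO3_eq_of_trace (Q : SO3)
    (hQ : 1 + (Q : Matrix (Fin 3) (Fin 3) ℝ).trace ≠ 0) : ∃ u : ℍ, u ≠ 0 ∧ conjSO3 u = Q := by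
  obtain ⟨m, hm⟩ : ∃ m : Matrix (Fin 3) (Fin 3) ℝ, m = Q := ⟨_, rfl⟩
  have hadj := SO3.adjugate Q
  have h1 := SO3.mul_transpose_self Q
  have h2 := SO3.transpose_mul_self Q
  rw [← hm] at hadj hQ h1 h2
  have hc : ∀ i j, m.adjugate i j = m j i := fun i j => by rw [hadj]; rfl
  have hr : ∀ i j, (m * m.transpose) i j = (1 : Matrix (Fin 3) (Fin 3) ℝ) i j := fun i j => by
    rw [h1]
  have hl : ∀ i j, (m.transpose * m) i j = (1 : Matrix (Fin 3) (Fin 3) ℝ) i j := fun i j => by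
    rw [h2]
  simp only [Matrix.mul_apply, Matrix.transpose_apply, Fin.sum_univ_three] at hr hl
  rw [Matrix.adjugate_fin_three] at hc
  have c00 := hc 0 0
  have c01 := hc 0 1
  have c02 := hc 0 2
  have c10 := hc 1 0
  have c11 := hc 1 1
  have c12 := hc 1 2
  have c20 := hc 2 0
  have c21 := hc 2 1
  have c22 := hc 2 2
  have r00 := hr 0 0
  have r01 := hr 0 1
  have r02 := hr 0 2
  have r11 := hr 1 1
  have r12 := hr 1 2
  have r22 := hr 2 2
  have l00 := hl 0 0
  have l01 := hl 0 1
  have l02 := hl 0 2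
  have l11 := hl 1 1
  have l12 := hl 1 2
  have l22 := hl 2 2
  simp at c00 c01 c02 c10 c11 c12 c20 c21 c22 r00 r01 r02 r11 r12 r22 l00 l01 l02 l11 l12 l22
  rw [Matrix.trace_fin_three] at hQ
  set u : ℍ := ⟨1 + (m 0 0 + m 1 1 + m 2 2), m 2 1 - m 1 2, m 0 2 - m 2 0, m 1 0 - m 0 1⟩ with hu
  have hu0 : u ≠ 0 := fun h => hQ (congrArg QuaternionAlgebra.re h)
  have hn : ‖u‖ ^ 2 = 4 * (1 + (m 0 0 + m 1 1 + m 2 2)) := by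
    rw [norm_sq_eq]
    change (1 + (m 0 0 + m 1 1 + m 2 2)) ^ 2 + (m 2 1 - m 1 2) ^ 2 + (m 0 2 - m 2 0) ^ 2 +
      (m 1 0 - m 0 1) ^ 2 = _
    linear_combination r00 + r11 + r22 + 2 * c00 + 2 * c11 + 2 * c22
  have hd0 : conjMatrix u = ‖u‖ ^ 2 • m := by
    rw [hn]
    have h01 : (m 2 1 - m 1 2) * (m 0 2 - m 2 0) = (1 + (m 0 0 + m 1 1 + m 2 2)) * (m 0 1 + m 1 0) := by
      linear_combination (-1) * r01 - l01 + c01 + c10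
    have h02 : (m 2 1 - m 1 2) * (m 1 0 - m 0 1) = (1 + (m 0 0 + m 1 1 + m 2 2)) * (m 0 2 + m 2 0) := by
      linear_combination (-1) * r02 - l02 + c02 + c20
    have h12 : (m 0 2 - m 2 0) * (m 1 0 - m 0 1) = (1 + (m 0 0 + m 1 1 + m 2 2)) * (m 1 2 + m 2 1) := by
      linear_combination (-1) * r12 - l12 + c12 + c21
    ext i j
    fin_cases i <;> fin_cases j <;> simp [conjMatrix, hu]
    · linear_combination (r11 + r22 + l11 + l22) / 2 - 3 / 2 * (r00 + l00) + 2 * c00 - 2 * c11 - 2 * c22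
    · linear_combination 2 * h01
    · linear_combination 2 * h02
    · linear_combination 2 * h01
    · linear_combination (r00 + r22 + l00 + l22) / 2 - 3 / 2 * (r11 + l11) + 2 * c11 - 2 * c00 - 2 * c22
    · linear_combination 2 * h12
    · linear_combination 2 * h02
    · linear_combination 2 * h12
    · linear_combination (r00 + r11 + l00 + l11) / 2 - 3 / 2 * (r22 + l22) + 2 * c22 - 2 * c00 - 2 * c11
  refine ⟨u, hu0, Subtype.ext ?_⟩
  rw [coe_conjSO3 hu0, hd0, smul_smul, inv_mul_cancel₀ (pow_ne_zero 2 (norm_ne_zero_iff.2 hu0)),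
    one_smul, hm]

theorem exists_conjSO3_eq (Q : SO3) : ∃ g : ℍ, ‖g‖ = 1 ∧ 0 ≤ g.re ∧ conjSO3 g = Q := by
  have key : ∃ u : ℍ, u ≠ 0 ∧ conjSO3 u = Q := by
    by_contra! hno
    -- The rotations of `1, i, j, k` add up to zero, so the four numbers `1 + tr(Q Ad(e i))` have
    -- sum `4` and cannot all vanish.
    have hz : ∀ v : ℍ, v ≠ 0 → 1 + ((Q * conjSO3 v : SO3) : Matrix (Fin 3) (Fin 3) ℝ).trace = 0 := by
      intro v hv
      by_contra hne
      obtain ⟨u, hu, huv⟩ := exists_conjSO3_eq_of_trace _ hne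
      exact hno (u * v⁻¹) (mul_ne_zero hu (inv_ne_zero hv)) (by
        rw [conjSO3_mul hu (inv_ne_zero hv), conjSO3_inv hv, huv, mul_inv_cancel_right])
    have ne : ∀ i, e i ≠ 0 := fun i h => by
      fin_cases i
      · exact one_ne_zero (congrArg QuaternionAlgebra.re h)
      · exact one_ne_zero (congrArg QuaternionAlgebra.imI h)
      · exact one_ne_zero (congrArg QuaternionAlgebra.imJ h)
      · exact one_ne_zero (congrArg QuaternionAlgebra.imK h)
    have hs := fun i => hz (e i) (ne i)
    simp only [Submonoid.coe_mul, coe_conjSO3 (ne _), norm_sq_eq, Matrix.trace_fin_three,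
      Matrix.mul_apply, Fin.sum_univ_three] at hs
    have h0 := hs 0
    have h1 := hs 1
    have h2 := hs 2
    have h3 := hs 3
    simp [e, conjMatrix] at h0 h1 h2 h3
    linarith
  obtain ⟨u, hu, rfl⟩ := key
  have hn : ‖u‖ ≠ 0 := norm_ne_zero_iff.2 hu
  -- Both `u` and `-u` induce the same rotation, so the sign of the real part is free.
  rcases le_total 0 u.re with h | h
  · refine ⟨‖u‖⁻¹ • u, by rw [norm_smul, norm_inv, norm_norm, inv_mul_cancel₀ hn], ?_,
      conjSO3_smul (inv_ne_zero hn) u⟩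
    rw [Quaternion.re_smul]
    exact mul_nonneg (by positivity) h
  · refine ⟨(-‖u‖⁻¹) • u, by rw [norm_smul, norm_neg, norm_inv, norm_norm, inv_mul_cancel₀ hn], ?_,
      conjSO3_smul (neg_ne_zero.2 (inv_ne_zero hn)) u⟩
    rw [Quaternion.re_smul]
    exact mul_nonneg_of_nonpos_of_nonpos (by simp) h

/-! ### The triangle equation for the size of the bubble. -/

/-- The squared length of the third side of a triangle, two of whose sides have squared lengths
`lam * (a - lam)` and `lam * (b - lam)` and enclose an angle with cosine `c`. -/
def sideSq (a b c lam : ℝ) : ℝ :=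
  lam * (a - lam) + lam * (b - lam) - 2 * c * (√(lam * (a - lam)) * √(lam * (b - lam)))

/-- For `c ≤ 1` this splits the side into two nonnegative pieces: one measures the inequality of `a`
and `b`, the other the opening of the angle. -/
theorem sideSq_eq {a b c lam : ℝ} (hl : 0 ≤ lam) (ha : lam ≤ a) (hb : lam ≤ b) :
    sideSq a b c lam = lam * ((√(a - lam) - √(b - lam)) ^ 2 +
      2 * (1 - c) * (√(a - lam) * √(b - lam))) := by
  have hx := Real.sq_sqrt (sub_nonneg.2 ha)
  have hy := Real.sq_sqrt (sub_nonneg.2 hb)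
  have h0 := Real.sq_sqrt hl
  rw [sideSq, Real.sqrt_mul hl, Real.sqrt_mul hl]
  linear_combination (-2 * c * √(a - lam) * √(b - lam)) * h0 - lam * hx - lam * hy

theorem continuous_sideSq (a b c : ℝ) : Continuous (sideSq a b c) := by
  unfold sideSq
  fun_prop

/-- Below `a / 2` and `b / 2` the products `lam * (a - lam)` and `lam * (b - lam)` increase, which
handles the angle term. In the other, the difference of the roots is `(a - b)` over their sum, and
the sum decreases. -/
theorem sideSq_lt {a b c lam lam' : ℝ} (hl : 0 < lam) (hlt : lam < lam') (ha : lam' ≤ a / 2)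
    (hb : lam' ≤ b / 2) (hc : c < 1) : sideSq a b c lam < sideSq a b c lam' := by
  rw [sideSq_eq hl.le (by linarith) (by linarith),
    sideSq_eq (by linarith) (by linarith) (by linarith)]
  have h1 : 0 < a - lam' := by linarith
  have h2 : 0 < b - lam' := by linarith
  have h1' : 0 < a - lam := by linarith
  have h2' : 0 < b - lam := by linarith
  have hx := Real.sq_sqrt h1'.le
  have hy := Real.sq_sqrt h2'.le
  have hx' := Real.sq_sqrt h1.le
  have hy' := Real.sq_sqrt h2.le
  have px := Real.sqrt_pos.2 h1'
  have py := Real.sqrt_pos.2 h2'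
  have px' := Real.sqrt_pos.2 h1
  have py' := Real.sqrt_pos.2 h2
  have lx : √(a - lam') ≤ √(a - lam) := Real.sqrt_le_sqrt (by linarith)
  have ly : √(b - lam') ≤ √(b - lam) := Real.sqrt_le_sqrt (by linarith)
  set x := √(a - lam)
  set y := √(b - lam)
  set x' := √(a - lam')
  set y' := √(b - lam')
  have hl' : 0 < lam' := hl.trans hlt
  have hxy : lam * (x * y) < lam' * (x' * y') := by
    have e1 : lam * (a - lam) < lam' * (a - lam') := by nlinarith
    have e2 : lam * (b - lam) < lam' * (b - lam') := by nlinarith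
    refine lt_of_pow_lt_pow_left₀ 2 (by positivity) ?_
    have : (lam * (x * y)) ^ 2 = (lam * (a - lam)) * (lam * (b - lam)) := by
      rw [← hx, ← hy]; ring
    have h' : (lam' * (x' * y')) ^ 2 = (lam' * (a - lam')) * (lam' * (b - lam')) := by
      rw [← hx', ← hy']; ring
    rw [this, h']
    exact mul_lt_mul'' e1 e2 (mul_nonneg hl.le h1'.le) (mul_nonneg hl.le h2'.le)
  have hsq : (x - y) ^ 2 ≤ (x' - y') ^ 2 := by
    have hd : (x - y) * (x + y) = (x' - y') * (x' + y') := by linear_combination hx - hy - hx' + hy'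
    have hd2 : (x - y) ^ 2 * (x + y) ^ 2 = (x' - y') ^ 2 * (x' + y') ^ 2 := by
      rw [← mul_pow, hd, mul_pow]
    have hs : (x' + y') ^ 2 ≤ (x + y) ^ 2 := pow_le_pow_left₀ (by positivity) (by linarith) 2
    have hp : 0 < (x + y) ^ 2 := by positivity
    refine le_of_mul_le_mul_right ?_ hp
    rw [hd2]
    exact mul_le_mul_of_nonneg_left hs (sq_nonneg _)
  have k1 : lam * (x - y) ^ 2 ≤ lam' * (x' - y') ^ 2 :=
    mul_le_mul hlt.le hsq (sq_nonneg _) (by linarith)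
  have k2 : (1 - c) * (lam * (x * y)) < (1 - c) * (lam' * (x' * y')) :=
    mul_lt_mul_of_pos_left hxy (by linarith)
  linarith

/-- For `c` away from `1` the side grows at least linearly in `lam`: this forces a solution. -/
theorem le_sideSq {a b c r lam : ℝ} (hl : 0 ≤ lam) (ha : lam ≤ a / 2) (hb : lam ≤ b / 2)
    (hc : c ≤ 1) (hr : 0 ≤ r) (hra : r ≤ a) (hrb : r ≤ b) : (1 - c) * r * lam ≤ sideSq a b c lam := by
  rw [sideSq_eq hl (by linarith) (by linarith)]
  have h : r / 2 ≤ √(a - lam) * √(b - lam) := by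
    rw [← Real.sqrt_mul (by linarith)]
    refine Real.le_sqrt_of_sq_le ?_
    rw [pow_two]
    exact mul_le_mul (by linarith) (by linarith) (by linarith) (by linarith)
  have h1 : (1 - c) * (r / 2) ≤ (1 - c) * (√(a - lam) * √(b - lam)) :=
    mul_le_mul_of_nonneg_left h (by linarith)
  nlinarith [mul_nonneg hl (sq_nonneg (√(a - lam) - √(b - lam)))]

/-- For `a` close to `b` and `c` close to `1` the slope in `lam` is small: this excludes a solution.
-/
theorem sideSq_le {a b c lam : ℝ} (ha0 : 0 < a) (hl : 0 ≤ lam) (ha : lam ≤ a / 2) (hb : lam ≤ b / 2)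
    (hc : c ≤ 1) : sideSq a b c lam ≤ lam * (2 * (a - b) ^ 2 / a + (1 - c) * (a + b)) := by
  rw [sideSq_eq hl (by linarith) (by linarith)]
  refine mul_le_mul_of_nonneg_left ?_ hl
  have h1 : 0 ≤ a - lam := by linarith
  have h2 : 0 ≤ b - lam := by linarith
  have hx := Real.sq_sqrt h1
  have hy := Real.sq_sqrt h2
  have px := Real.sqrt_nonneg (a - lam)
  have py := Real.sqrt_nonneg (b - lam)
  set x := √(a - lam)
  set y := √(b - lam)
  have k1 : (x - y) ^ 2 ≤ 2 * (a - b) ^ 2 / a := by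
    rw [le_div_iff₀ ha0]
    have hd : (a - b) ^ 2 = (x - y) ^ 2 * (x + y) ^ 2 := by
      rw [← mul_pow]; congr 1; linear_combination hy - hx
    have hs : a ≤ 2 * (x + y) ^ 2 := by nlinarith [mul_nonneg px py]
    rw [hd]
    nlinarith [mul_le_mul_of_nonneg_left hs (sq_nonneg (x - y))]
  have k2 : 2 * (x * y) ≤ a + b := by nlinarith [sq_nonneg (x - y)]
  nlinarith [mul_le_mul_of_nonneg_left k2 (sub_nonneg.2 hc)]

theorem exists_sideSq_eq {a b c r lam : ℝ} (hl : 0 < lam) (hr : 0 < r) (hlt : r < sideSq a b c lam) :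
    ∃ l, 0 < l ∧ l < lam ∧ sideSq a b c l = r := by
  have h0 : sideSq a b c 0 = 0 := by simp [sideSq]
  obtain ⟨l, ⟨hl0, hl1⟩, h⟩ := intermediate_value_Ioo hl.le (continuous_sideSq a b c).continuousOn
    (show r ∈ Set.Ioo (sideSq a b c 0) (sideSq a b c lam) from ⟨h0.symm ▸ hr, hlt⟩)
  exact ⟨l, hl0, hl1, h⟩

/-! ### Bubbles with prescribed scale and rotation at two points. -/

/-- At which distance the scale of the curvature is `s`. -/
theorem bubbleScale_eq_iff {lam N s : ℝ} (hl : 0 < lam) (hN : 0 ≤ N) (hs : 0 < s) :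
    bubbleScale lam N = s ↔ N = lam * ((√s)⁻¹ - lam) := by
  have hs' := Real.sqrt_pos.2 hs
  have h2 := Real.sq_sqrt hs.le
  have hp : 0 < lam ^ 2 + N := by positivity
  rw [bubbleScale, ← div_pow]
  constructor
  · intro h
    have h3 : lam / (lam ^ 2 + N) = √s := by
      rw [← h, Real.sqrt_sq (by positivity)]
    rw [← h3]
    field_simp
    ring
  · rintro rfl
    have : lam ^ 2 + lam * ((√s)⁻¹ - lam) = lam / √s := by field_simp; ring
    rw [this, div_div_cancel₀ hl.ne', h2]

/-- At `x`, the curvature of the standard instanton with data `b` has scale `s` and direction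
`R`. -/
structure IsMatched (x : ℍ) (s : ℝ) (R : SO3) (b : BubbleData) : Prop where
  ne : b.1 ≠ x
  pos : 0 < b.2.1
  scale : bubbleScale b.2.1 (‖x - b.1‖ ^ 2) = s
  rot : b.2.2⁻¹ * conjSO3 (x - b.1) = R

/-- The distance from the centre at which an instanton of size `lam` has scale `s`. -/
def bubbleRadius (s lam : ℝ) : ℝ := √(lam * ((√s)⁻¹ - lam))

namespace IsMatched

variable {x : ℍ} {s : ℝ} {R : SO3} {b : BubbleData}

theorem scale_pos (h : IsMatched x s R b) : 0 < s := by
  rw [← h.scale, bubbleScale]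
  have := h.pos
  positivity

theorem norm_sq_eq (h : IsMatched x s R b) :
    ‖x - b.1‖ ^ 2 = b.2.1 * ((√s)⁻¹ - b.2.1) :=
  (bubbleScale_eq_iff h.pos (sq_nonneg _) h.scale_pos).1 h.scale

theorem norm_eq (h : IsMatched x s R b) : ‖x - b.1‖ = bubbleRadius s b.2.1 := by
  rw [bubbleRadius, ← h.norm_sq_eq, Real.sqrt_sq (norm_nonneg _)]

end IsMatched

/-- The law of cosines: for a unit quaternion `g`, the angle between `u g` and `u` has cosine `Re
g`. -/
theorem norm_smul_mul_sub_sq (t : ℝ) (u g : ℍ) :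
    ‖t • (u * g) - u‖ ^ 2 = ‖t • (u * g)‖ ^ 2 + ‖u‖ ^ 2 - 2 * (t * ‖u‖ ^ 2 * g.re) := by
  simp only [norm_sq_eq, Quaternion.re_sub, Quaternion.imI_sub, Quaternion.imJ_sub,
    Quaternion.imK_sub, Quaternion.re_smul, Quaternion.imI_smul, Quaternion.imJ_smul,
    Quaternion.imK_smul, Quaternion.re_mul, Quaternion.imI_mul, Quaternion.imJ_mul,
    Quaternion.imK_mul, smul_eq_mul]
  ring

section

variable {p q g : ℍ} {s s' d σ lam : ℝ} {R R' : SO3}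

/-- With `t = σ r / r'`, the required relation `p - y = t (q - y) g` is equivalent to `(q - y)(t g -
1) = d`. The triangle equation says that `|t g - 1| = d / r'`, so the centre so obtained has the
right distances to both points. The gluing angle is then read off at `q`. -/
theorem exists_isMatched (hd : 0 < d) (hpq : p - q = (d : ℍ)) (hg : ‖g‖ = 1)
    (hR : R' * conjSO3 g = R) (hs : 0 < s) (hs' : 0 < s') (hl : 0 < lam) (hls : lam < (√s)⁻¹)
    (hls' : lam < (√s')⁻¹) (hσ : σ ^ 2 = 1)
    (hside : sideSq (√s)⁻¹ (√s')⁻¹ (σ * g.re) lam = d ^ 2) :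
    ∃ b : BubbleData, b.2.1 = lam ∧ IsMatched p s R b ∧ IsMatched q s' R' b ∧
      p - b.1 = (σ * (bubbleRadius s lam / bubbleRadius s' lam)) • ((q - b.1) * g) := by
  have hr2 : bubbleRadius s lam ^ 2 = lam * ((√s)⁻¹ - lam) :=
    Real.sq_sqrt (mul_nonneg hl.le (by linarith))
  have hr2' : bubbleRadius s' lam ^ 2 = lam * ((√s')⁻¹ - lam) :=
    Real.sq_sqrt (mul_nonneg hl.le (by linarith))
  have hr : 0 < bubbleRadius s lam := Real.sqrt_pos.2 (mul_pos hl (by linarith))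
  have hr' : 0 < bubbleRadius s' lam := Real.sqrt_pos.2 (mul_pos hl (by linarith))
  rw [sideSq, ← hr2, ← hr2', Real.sqrt_sq hr.le, Real.sqrt_sq hr'.le] at hside
  set r := bubbleRadius s lam
  set r' := bubbleRadius s' lam
  have hg0 : g ≠ 0 := norm_ne_zero_iff.1 (by rw [hg]; exact one_ne_zero)
  have ht2 : (σ * (r / r')) ^ 2 = (r / r') ^ 2 := by rw [mul_pow, hσ, one_mul]
  have ht0 : σ * (r / r') ≠ 0 := fun h => by
    rw [h] at ht2
    have : 0 < (r / r') ^ 2 := by positivity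
    linarith
  have htn : ‖(σ * (r / r')) • g‖ ^ 2 = (r / r') ^ 2 := by
    rw [norm_smul, hg, mul_one, Real.norm_eq_abs, sq_abs, ht2]
  set w : ℍ := (σ * (r / r')) • g - 1 with hw
  have hwn : ‖w‖ ^ 2 = (d / r') ^ 2 := by
    have := norm_smul_mul_sub_sq (σ * (r / r')) 1 g
    rw [one_mul, htn, norm_one] at this
    rw [hw, this, div_pow d, ← hside]
    field_simp
  have hwn' : ‖w‖ = d / r' := by
    rw [← Real.sqrt_sq (norm_nonneg w), hwn, Real.sqrt_sq (by positivity)]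
  have hw0 : w ≠ 0 := norm_ne_zero_iff.1 (by rw [hwn']; positivity)
  set u : ℍ := d • w⁻¹ with hu
  have hun : ‖u‖ = r' := by
    rw [hu, norm_smul, norm_inv, hwn', Real.norm_of_nonneg hd.le]
    field_simp
  have hu0 : u ≠ 0 := norm_ne_zero_iff.1 (by rw [hun]; exact hr'.ne')
  have huw : (σ * (r / r')) • (u * g) = p - q + u := by
    have h1 : u * w = p - q := by
      rw [hu, smul_mul_assoc, inv_mul_cancel₀ hw0, hpq, ← Quaternion.coe_one, Quaternion.smul_coe,
        mul_one]
    rw [← h1, hw, mul_sub, mul_smul_comm, mul_one, sub_add_cancel]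
  have hp : p - (q - u) = (σ * (r / r')) • (u * g) := by rw [huw]; abel
  have hq : q - (q - u) = u := by abel
  have hpn : ‖p - (q - u)‖ = r := by
    rw [hp, norm_smul, norm_mul u g, hg, hun, mul_one, Real.norm_eq_abs, ← Real.sqrt_sq_eq_abs, ht2,
      Real.sqrt_sq (by positivity), div_mul_cancel₀ _ hr'.ne']
  refine ⟨(q - u, lam, conjSO3 u * R'⁻¹), rfl, ⟨?_, hl, ?_, ?_⟩, ⟨?_, hl, ?_, ?_⟩, ?_⟩
  · exact fun h => hr.ne' (by rw [← hpn, ← show q - u = p from h, sub_self, norm_zero])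
  · exact (bubbleScale_eq_iff hl (sq_nonneg _) hs).2 (by rw [← hr2, ← hpn])
  · change (conjSO3 u * R'⁻¹)⁻¹ * conjSO3 (p - (q - u)) = R
    rw [hp, conjSO3_smul ht0, conjSO3_mul hu0 hg0, mul_inv_rev, inv_inv, mul_assoc,
      inv_mul_cancel_left, hR]
  · exact fun h => hu0 (by rw [← hq, show q - u = q from h, sub_self])
  · exact (bubbleScale_eq_iff hl (sq_nonneg _) hs').2 (by
      rw [← hr2', ← hun]; change ‖q - (q - u)‖ ^ 2 = _; rw [hq])
  · change (conjSO3 u * R'⁻¹)⁻¹ * conjSO3 (q - (q - u)) = R'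
    rw [hq, mul_inv_rev, inv_inv, mul_assoc, inv_mul_cancel, mul_one]
  · change p - (q - u) = (σ * (r / r')) • ((q - (q - u)) * g)
    rw [hq, hp]

/-- Eliminating the gluing angle shows that `p - y` and `(q - y) g` induce the same rotation, so
they differ by a nonzero real factor. Its modulus is the ratio of the radii; only its sign is free.
-/
theorem IsMatched.exists_sign {b : BubbleData} (hpq : p - q = (d : ℍ)) (hg : ‖g‖ = 1)
    (hR : R' * conjSO3 g = R) (h : IsMatched p s R b) (h' : IsMatched q s' R' b) :
    ∃ σ : ℝ, σ ^ 2 = 1 ∧ p - b.1 =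
      (σ * (bubbleRadius s b.2.1 / bubbleRadius s' b.2.1)) • ((q - b.1) * g) ∧
      sideSq (√s)⁻¹ (√s')⁻¹ (σ * g.re) b.2.1 = d ^ 2 := by
  have hg0 : g ≠ 0 := norm_ne_zero_iff.1 (by rw [hg]; exact one_ne_zero)
  have hP : p - b.1 ≠ 0 := sub_ne_zero.2 h.ne.symm
  have hQ : q - b.1 ≠ 0 := sub_ne_zero.2 h'.ne.symm
  have hrot : conjSO3 (p - b.1) = conjSO3 ((q - b.1) * g) := by
    rw [conjSO3_mul hQ hg0, ← mul_right_inj (b.2.2⁻¹), ← mul_assoc, h.rot, h'.rot, hR]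
  obtain ⟨t, ht0, ht⟩ := exists_smul_of_conjSO3_eq hP (mul_ne_zero hQ hg0) hrot
  have hr : 0 < ‖p - b.1‖ := norm_pos_iff.2 hP
  have hr' : 0 < ‖q - b.1‖ := norm_pos_iff.2 hQ
  have htn : ‖p - b.1‖ = |t| * ‖q - b.1‖ := by
    conv_lhs => rw [ht]
    rw [norm_smul, norm_mul, hg, mul_one, Real.norm_eq_abs]
  have hσ : t / |t| * (‖p - b.1‖ / ‖q - b.1‖) = t := by
    rw [htn]
    have := abs_pos.2 ht0
    field_simp
  refine ⟨t / |t|, by rw [div_pow, sq_abs, div_self (pow_ne_zero 2 ht0)], ?_, ?_⟩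
  · rw [← h.norm_eq, ← h'.norm_eq, hσ, ← ht]
  · have hd : ‖t • ((q - b.1) * g) - (q - b.1)‖ ^ 2 = d ^ 2 := by
      rw [← ht, sub_sub_sub_cancel_right, hpq, Quaternion.norm_coe, Real.norm_eq_abs, sq_abs]
    rw [norm_smul_mul_sub_sq, ← ht] at hd
    rw [sideSq]
    change _ - 2 * _ * (bubbleRadius s b.2.1 * bubbleRadius s' b.2.1) = _
    rw [← h.norm_sq_eq, ← h'.norm_sq_eq, ← h.norm_eq, ← h'.norm_eq, ← hd]
    nth_rw 3 [← hσ]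
    field_simp

theorem IsMatched.eq_of_smul_eq {b b' : BubbleData} {t : ℝ} (hpq : p ≠ q) (h : IsMatched q s' R' b)
    (h' : IsMatched q s' R' b') (hl : b.2.1 = b'.2.1) (ht : p - b.1 = t • ((q - b.1) * g))
    (ht' : p - b'.1 = t • ((q - b'.1) * g)) : b = b' := by
  have hw : ∀ y : ℍ, p - y = t • ((q - y) * g) → (q - y) * (t • g - 1) = p - q := fun y hy => by
    rw [mul_sub, mul_smul_comm, ← hy, mul_one]; abel
  have h1 := hw _ ht
  have hw0 : t • g - 1 ≠ 0 := fun h0 => hpq (sub_eq_zero.1 (by rw [← h1, h0, mul_zero]))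
  have h2 : b.1 = b'.1 := sub_right_injective (mul_right_cancel₀ hw0 (h1.trans (hw _ ht').symm))
  have h3 : b.2.2 = b'.2.2 := by
    have := h.rot.trans h'.rot.symm
    rw [h2] at this
    exact inv_injective (mul_right_cancel this)
  exact Prod.ext h2 (Prod.ext hl h3)

end

/-! ### The count of six. -/

/-- The sign `±1` of a Boolean. -/
def boolSign (i : Bool) : ℝ := if i then 1 else -1

theorem boolSign_sq (i : Bool) : boolSign i ^ 2 = 1 := by cases i <;> norm_num [boolSign]

theorem exists_boolSign_eq {σ : ℝ} (hσ : σ ^ 2 = 1) : ∃ i, σ = boolSign i := by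
  rcases mul_self_eq_one_iff.1 ((pow_two σ).symm.trans hσ) with h | h
  · exact ⟨true, h⟩
  · exact ⟨false, h⟩

/-- A solution is labelled by its rotation at `p`, its rotation at `q` and the sign of the real
factor. Each of the six labels other than equal indices with sign `+` carries exactly one bubble, by
the intermediate value theorem and monotonicity in the size; the other two carry none. -/
theorem ncard_isMatched {p q : ℍ} {s s' d Λ : ℝ} {R R' : Bool → SO3} {g : Bool → Bool → ℍ}
    (hd : 0 < d) (hpq : p - q = (d : ℍ)) (hg : ∀ i j, ‖g i j‖ = 1)
    (hR : ∀ i j, R' j * conjSO3 (g i j) = R i) (hinj : Function.Injective R)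
    (hinj' : Function.Injective R') (hs : 0 < s) (hs' : 0 < s') (hΛ : 0 < Λ)
    (hΛs : Λ ≤ (√s)⁻¹ / 2) (hΛs' : Λ ≤ (√s')⁻¹ / 2)
    (hvalid : ∀ i j k, (i ≠ j ∨ k = false) → boolSign k * (g i j).re < 1 ∧
      d ^ 2 < sideSq (√s)⁻¹ (√s')⁻¹ (boolSign k * (g i j).re) (Λ / 2))
    (hinvalid : ∀ i lam, 0 < lam → lam < Λ → sideSq (√s)⁻¹ (√s')⁻¹ (g i i).re lam < d ^ 2) :
    {b : BubbleData | b.2.1 < Λ ∧ ∃ i j, IsMatched p s (R i) b ∧ IsMatched q s' (R' j) b}.ncard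
      = 6 := by
  set V : Finset (Bool × Bool × Bool) :=
    Finset.univ.filter fun τ => τ.1 ≠ τ.2.1 ∨ τ.2.2 = false with hV
  have hVcard : V.card = 6 := by decide
  set S : Bool × Bool × Bool → Set BubbleData := fun τ =>
    {b | b.2.1 < Λ ∧ IsMatched p s (R τ.1) b ∧ IsMatched q s' (R' τ.2.1) b ∧
      p - b.1 = (boolSign τ.2.2 * (bubbleRadius s b.2.1 / bubbleRadius s' b.2.1)) •
        ((q - b.1) * g τ.1 τ.2.1)} with hS
  have hpq' : p ≠ q := fun h => by
    rw [h, sub_self] at hpq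
    exact hd.ne' (congrArg QuaternionAlgebra.re hpq).symm
  have hside : ∀ τ, ∀ b ∈ S τ, sideSq (√s)⁻¹ (√s')⁻¹ (boolSign τ.2.2 * (g τ.1 τ.2.1).re) b.2.1
      = d ^ 2 := by
    rintro τ b ⟨-, h, h', e⟩
    obtain ⟨σ, -, e', hside⟩ := h.exists_sign hpq (hg _ _) (hR _ _) h'
    have hne : (q - b.1) * g τ.1 τ.2.1 ≠ 0 := mul_ne_zero (sub_ne_zero.2 h'.ne.symm)
      (norm_ne_zero_iff.1 (by rw [hg]; exact one_ne_zero))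
    have hr : bubbleRadius s b.2.1 / bubbleRadius s' b.2.1 ≠ 0 := by
      rw [← h.norm_eq, ← h'.norm_eq]
      exact div_ne_zero (norm_ne_zero_iff.2 (sub_ne_zero.2 h.ne.symm))
        (norm_ne_zero_iff.2 (sub_ne_zero.2 h'.ne.symm))
    -- Two expressions for `p - y` as a multiple of one nonzero quaternion identify the sign of the
    -- label with the sign in the triangle equation.
    rw [e] at e'
    rw [mul_right_cancel₀ hr (smul_left_injective ℝ hne e')]
    exact hside
  have hex : ∀ τ ∈ V, ∃ b, b ∈ S τ := by
    intro τ hτ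
    obtain ⟨-, hlt⟩ := hvalid τ.1 τ.2.1 τ.2.2 (Finset.mem_filter.1 hτ).2
    obtain ⟨l, hl0, hl1, hl⟩ := exists_sideSq_eq (half_pos hΛ) (pow_pos hd 2) hlt
    obtain ⟨b, rfl, h, h', e⟩ := exists_isMatched hd hpq (hg _ _) (hR _ _) hs hs' hl0
      (by linarith) (by linarith) (boolSign_sq _) hl
    exact ⟨b, by linarith, h, h', e⟩
  choose! f hf using hex
  have huniq : ∀ τ ∈ V, ∀ b ∈ S τ, b = f τ := by
    intro τ hτ b hb
    have hfb := hf τ hτ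
    obtain ⟨hc, -⟩ := hvalid τ.1 τ.2.1 τ.2.2 (Finset.mem_filter.1 hτ).2
    have h1 := (hside τ b hb).trans (hside τ _ hfb).symm
    have hl : b.2.1 = (f τ).2.1 := by
      rcases lt_trichotomy b.2.1 (f τ).2.1 with h | h | h
      · exact absurd h1 (sideSq_lt hb.2.1.pos h (by linarith [hfb.1]) (by linarith [hfb.1]) hc).ne
      · exact h
      · exact absurd h1 (sideSq_lt hfb.2.1.pos h (by linarith [hb.1]) (by linarith [hb.1]) hc).ne'
    refine hb.2.2.1.eq_of_smul_eq hpq' hfb.2.2.1 hl hb.2.2.2 ?_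
    rw [hl]
    exact hfb.2.2.2
  have himage : {b : BubbleData | b.2.1 < Λ ∧ ∃ i j, IsMatched p s (R i) b ∧ IsMatched q s' (R' j) b}
      = f '' (V : Set (Bool × Bool × Bool)) := by
    ext b
    constructor
    · rintro ⟨hb, i, j, h, h'⟩
      obtain ⟨σ, hσ, e, hσs⟩ := h.exists_sign hpq (hg _ _) (hR _ _) h'
      obtain ⟨k, rfl⟩ := exists_boolSign_eq hσ
      have hτ : (i, j, k) ∈ V := by
        rw [hV, Finset.mem_filter]
        refine ⟨Finset.mem_univ _, ?_⟩
        by_contra! hno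
        obtain ⟨rfl, hk⟩ : i = j ∧ k = true := by simpa using hno
        rw [hk, boolSign, if_pos rfl, one_mul] at hσs
        exact (hinvalid i _ h.pos hb).ne hσs
      exact ⟨_, hτ, (huniq _ hτ b ⟨hb, h, h', e⟩).symm⟩
    · rintro ⟨τ, hτ, rfl⟩
      obtain ⟨hb, h, h', -⟩ := hf τ hτ
      exact ⟨hb, _, _, h, h'⟩
  have hfinj : Set.InjOn f (V : Set (Bool × Bool × Bool)) := by
    rintro ⟨i, j, k⟩ hτ ⟨i', j', k'⟩ hτ' he
    have h := hf _ hτ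
    have h' := hf _ hτ'
    rw [← he] at h'
    obtain rfl : i = i' := hinj (h.2.1.rot.symm.trans h'.2.1.rot)
    obtain rfl : j = j' := hinj' (h.2.2.1.rot.symm.trans h'.2.2.1.rot)
    have e := h.2.2.2.symm.trans h'.2.2.2
    have hne : (q - (f (i, j, k)).1) * g i j ≠ 0 := mul_ne_zero (sub_ne_zero.2 h.2.2.1.ne.symm)
      (norm_ne_zero_iff.1 (by rw [hg]; exact one_ne_zero))
    have hr : bubbleRadius s (f (i, j, k)).2.1 / bubbleRadius s' (f (i, j, k)).2.1 ≠ 0 := by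
      rw [← h.2.1.norm_eq, ← h.2.2.1.norm_eq]
      exact div_ne_zero (norm_ne_zero_iff.2 (sub_ne_zero.2 h.2.1.ne.symm))
        (norm_ne_zero_iff.2 (sub_ne_zero.2 h.2.2.1.ne.symm))
    have hk := mul_right_cancel₀ hr (smul_left_injective ℝ hne e)
    have : k = k' := by
      cases k <;> cases k' <;> first | rfl | (norm_num [boolSign] at hk)
    rw [this]
  rw [himage, hfinj.ncard_image, Set.ncard_coe_finset, hVcard]

/-! ### Asymptotics as `L` tends to zero. -/

theorem tendsto_const_mul_rpow {K α : ℝ} (hα : 0 < α) :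
    Tendsto (fun L : ℝ => K * L ^ α) (𝓝[>] 0) (𝓝 0) := by
  have h : Tendsto (fun L : ℝ => L ^ α) (𝓝 0) (𝓝 (0 ^ α)) :=
    (Real.continuousAt_rpow_const 0 α (Or.inr hα.le)).tendsto
  rw [Real.zero_rpow hα.ne'] at h
  simpa using (h.mono_left nhdsWithin_le_nhds).const_mul K

theorem eventually_sq_lt_mul_rpow {C α : ℝ} (hC : 0 < C) (hα : α < 2) :
    ∀ᶠ L : ℝ in 𝓝[>] 0, (2 * L) ^ 2 < C * L ^ α := by
  have h := (tendsto_const_mul_rpow (K := 4) (sub_pos.2 hα)).eventually (gt_mem_nhds hC)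
  filter_upwards [h, self_mem_nhdsWithin] with L hL (hL0 : 0 < L)
  have h1 : L ^ (2 - α) * L ^ α = L ^ 2 := by
    rw [← Real.rpow_add hL0, sub_add_cancel, Real.rpow_two]
  have h2 := mul_lt_mul_of_pos_right hL (Real.rpow_pos_of_pos hL0 α)
  nlinarith

theorem tendsto_neg_nhdsGT_zero : Tendsto (fun L : ℝ => -L) (𝓝[>] 0) (𝓝 0) := by
  have : Tendsto (fun L : ℝ => -L) (𝓝 0) (𝓝 (-0)) := continuous_neg.tendsto 0
  rw [neg_zero] at this
  exact this.mono_left nhdsWithin_le_nhds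

theorem exists_abs_sub_le {f g : ℝ → ℝ} (hf : DifferentiableAt ℝ f 0) (hg : DifferentiableAt ℝ g 0)
    (h : f 0 = g 0) : ∃ C, 0 ≤ C ∧ ∀ᶠ L in 𝓝[>] (0 : ℝ), |f L - g (-L)| ≤ C * L := by
  obtain ⟨C, hC⟩ := hf.isBigO_sub.bound
  obtain ⟨D, hD⟩ := hg.isBigO_sub.bound
  refine ⟨|C| + |D|, by positivity, ?_⟩
  filter_upwards [nhdsWithin_le_nhds hC, tendsto_neg_nhdsGT_zero.eventually hD,
    self_mem_nhdsWithin] with L h1 h2 (hL : 0 < L)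
  simp only [Real.norm_eq_abs, sub_zero, abs_neg, abs_of_pos hL] at h1 h2
  have h3 : |f L - g (-L)| ≤ |f L - f 0| + |g (-L) - g 0| := by
    rw [h, show f L - g (-L) = (f L - g 0) - (g (-L) - g 0) by ring]
    exact abs_sub _ _
  have h4 : C * L ≤ |C| * L := mul_le_mul_of_nonneg_right (le_abs_self C) hL.le
  have h5 : D * L ≤ |D| * L := mul_le_mul_of_nonneg_right (le_abs_self D) hL.le
  linarith

theorem eventually_between {a : ℝ → ℝ} (ha : ContinuousAt a 0) (ha0 : 0 < a 0) :
    ∀ᶠ L in 𝓝[>] (0 : ℝ), (a 0 / 2 < a L ∧ a L < 2 * a 0) ∧ a 0 / 2 < a (-L) ∧ a (-L) < 2 * a 0 := by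
  have h : ∀ᶠ L in 𝓝 (0 : ℝ), a 0 / 2 < a L ∧ a L < 2 * a 0 :=
    (ha.eventually (lt_mem_nhds (by linarith))).and (ha.eventually (gt_mem_nhds (by linarith)))
  exact (h.filter_mono nhdsWithin_le_nhds).and (tendsto_neg_nhdsGT_zero.eventually h)

theorem eventually_le_half {a : ℝ → ℝ} (ha : ContinuousAt a 0) (ha0 : 0 < a 0) {K α : ℝ}
    (hα : 0 < α) : ∀ᶠ L in 𝓝[>] (0 : ℝ), K * L ^ α ≤ a L / 2 ∧ K * L ^ α ≤ a (-L) / 2 := by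
  filter_upwards [eventually_between ha ha0, (tendsto_const_mul_rpow (K := K) hα).eventually
    (gt_mem_nhds (show 0 < a 0 / 4 by linarith))] with L h1 h2
  exact ⟨by linarith [h1.1.1], by linarith [h1.2.1]⟩

/-- At half the maximal size the side is at least a constant times `L ^ α`, which dominates `L²`
since `α < 2`. -/
theorem eventually_lt_sideSq {a : ℝ → ℝ} (ha : ContinuousAt a 0) (ha0 : 0 < a 0) {K α κ : ℝ}
    (hK : 0 < K) (hα : 0 < α) (hα₂ : α < 2) (hκ : 0 < κ) :
    ∀ᶠ L in 𝓝[>] (0 : ℝ), ∀ c ≤ 1 - κ, (2 * L) ^ 2 < sideSq (a L) (a (-L)) c (K * L ^ α / 2) := by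
  filter_upwards [eventually_between ha ha0, eventually_le_half (K := K) ha ha0 hα,
    eventually_sq_lt_mul_rpow (C := κ * (a 0 / 2) * (K / 2)) (by positivity) hα₂,
    self_mem_nhdsWithin] with L h1 h2 h3 (hL : 0 < L) c hc
  have hp : 0 < K * L ^ α := mul_pos hK (Real.rpow_pos_of_pos hL α)
  have h4 := le_sideSq (a := a L) (b := a (-L)) (c := c) (r := a 0 / 2) (half_pos hp).le
    (by linarith) (by linarith) (by linarith) (by linarith) h1.1.1.le h1.2.1.le
  have h5 : κ * (a 0 / 2 * (K * L ^ α / 2)) ≤ (1 - c) * (a 0 / 2 * (K * L ^ α / 2)) :=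
    mul_le_mul_of_nonneg_right (by linarith) (by positivity)
  linarith

/-- Both the squared difference of `a L` and `a (-L)` and the defect `1 - c` are `O(L²)`, so the
side is at most `lam` times `O(L²)`. The size bound makes `lam` tend to zero, which beats the
constant `4`. -/
theorem eventually_sideSq_lt {a : ℝ → ℝ} (ha : DifferentiableAt ℝ a 0) (ha0 : 0 < a 0) {K α C : ℝ}
    (hα : 0 < α) (hC : 0 ≤ C) : ∀ᶠ L in 𝓝[>] (0 : ℝ), ∀ c ≤ 1, 1 - c ≤ C * L ^ 2 →
      ∀ lam, 0 < lam → lam < K * L ^ α → sideSq (a L) (a (-L)) c lam < (2 * L) ^ 2 := by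
  obtain ⟨D, hD0, hD⟩ := exists_abs_sub_le ha ha rfl
  filter_upwards [eventually_between ha.continuousAt ha0,
    eventually_le_half (K := K) ha.continuousAt ha0 hα, hD,
    (tendsto_const_mul_rpow (K := (4 * D ^ 2 / a 0 + C * (4 * a 0)) * K) hα).eventually
    (gt_mem_nhds (show (0 : ℝ) < 4 by norm_num)), self_mem_nhdsWithin]
    with L h1 h2 h3 h4 (hL : 0 < L) c hc hcL lam hl hlL
  refine (sideSq_le (by linarith [h1.1.1]) hl.le (by linarith) (by linarith) hc).trans_lt ?_
  have k1 : 2 * (a L - a (-L)) ^ 2 / a L ≤ 4 * D ^ 2 / a 0 * L ^ 2 := by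
    have h5 : (a L - a (-L)) ^ 2 ≤ (D * L) ^ 2 := by
      rw [← sq_abs]
      exact pow_le_pow_left₀ (abs_nonneg _) h3 2
    calc 2 * (a L - a (-L)) ^ 2 / a L ≤ 2 * (D * L) ^ 2 / (a 0 / 2) :=
          div_le_div₀ (by positivity) (by linarith) (by positivity) h1.1.1.le
      _ = _ := by field_simp; ring
  have k2 : (1 - c) * (a L + a (-L)) ≤ C * L ^ 2 * (4 * a 0) :=
    mul_le_mul hcL (by linarith [h1.1.2, h1.2.2]) (by linarith [h1.1.1, h1.2.1]) (by positivity)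
  have k3 : lam * (4 * D ^ 2 / a 0 + C * (4 * a 0)) < 4 := by
    refine lt_of_le_of_lt ?_ h4
    have h6 : 0 ≤ 4 * D ^ 2 / a 0 + C * (4 * a 0) := by positivity
    have h7 := mul_le_mul_of_nonneg_left hlL.le h6
    linarith
  calc _ ≤ lam * (4 * D ^ 2 / a 0 * L ^ 2 + C * L ^ 2 * (4 * a 0)) :=
        mul_le_mul_of_nonneg_left (add_le_add k1 k2) hl.le
    _ = lam * (4 * D ^ 2 / a 0 + C * (4 * a 0)) * L ^ 2 := by ring
    _ < 4 * L ^ 2 := mul_lt_mul_of_pos_right k3 (by positivity)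
    _ = _ := by ring

/-- The squared distance, in the Hilbert–Schmidt norm, between two matrices. -/
def distSq (A B : Matrix (Fin 3) (Fin 3) ℝ) : ℝ := ∑ i, ∑ j, (A i j - B i j) ^ 2

theorem SO3.distSq_eq (A B : SO3) :
    distSq A B = 6 - 2 * ((B⁻¹ * A : SO3) : Matrix (Fin 3) (Fin 3) ℝ).trace := by
  have h : ∀ Q : SO3, ∑ i, ∑ j, (Q : Matrix (Fin 3) (Fin 3) ℝ) i j ^ 2 = 3 := fun Q => by
    have h1 := congrArg Matrix.trace (SO3.mul_transpose_self Q)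
    rw [Matrix.trace_one, Fintype.card_fin] at h1
    simpa [Matrix.trace, Matrix.mul_apply, pow_two] using h1
  have hA := h A
  have hB := h B
  rw [Submonoid.coe_mul, SO3.coe_inv, distSq, Matrix.trace_fin_three]
  simp only [Matrix.mul_apply, Matrix.transpose_apply, Fin.sum_univ_three] at hA hB ⊢
  linear_combination hA + hB

/-- This converts closeness or separation of rotations into closeness or separation of `Re g` from
`1`. -/
theorem distSq_eq_of_conjSO3 {g : ℍ} (hg : ‖g‖ = 1) {A B : SO3} (h : B * conjSO3 g = A) :
    distSq A B = 8 * (1 - g.re ^ 2) := by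
  have hg0 : g ≠ 0 := norm_ne_zero_iff.1 (by rw [hg]; exact one_ne_zero)
  rw [SO3.distSq_eq, ← h, inv_mul_cancel_left, trace_conjSO3 hg0, hg]
  ring

theorem distSq_pos {A B : Matrix (Fin 3) (Fin 3) ℝ} (h : A ≠ B) : 0 < distSq A B := by
  rw [distSq]
  by_contra! hle
  refine h (Matrix.ext fun i j => ?_)
  have h0 : ∑ i, ∑ j, (A i j - B i j) ^ 2 = 0 :=
    le_antisymm hle (Finset.sum_nonneg fun _ _ => Finset.sum_nonneg fun _ _ => sq_nonneg _)
  rw [Finset.sum_eq_zero_iff_of_nonneg fun _ _ => Finset.sum_nonneg fun _ _ => sq_nonneg _] at h0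
  have h1 := h0 i (Finset.mem_univ _)
  rw [Finset.sum_eq_zero_iff_of_nonneg fun _ _ => sq_nonneg _] at h1
  exact sub_eq_zero.1 (pow_eq_zero_iff two_ne_zero |>.1 (h1 j (Finset.mem_univ _)))

theorem eventually_lt_distSq {A B : ℝ → Matrix (Fin 3) (Fin 3) ℝ}
    (hA : ∀ i j, ContinuousAt (fun L => A L i j) 0) (hB : ∀ i j, ContinuousAt (fun L => B L i j) 0)
    (h : A 0 ≠ B 0) : ∃ κ, 0 < κ ∧ ∀ᶠ L in 𝓝[>] (0 : ℝ), κ < distSq (A L) (B (-L)) := by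
  have hpos := distSq_pos h
  refine ⟨distSq (A 0) (B 0) / 2, half_pos hpos, ?_⟩
  have ht : Tendsto (fun L => distSq (A L) (B (-L))) (𝓝[>] 0) (𝓝 (distSq (A 0) (B 0))) := by
    unfold distSq
    refine tendsto_finsetSum _ fun i _ => tendsto_finsetSum _ fun j _ => Tendsto.pow ?_ 2
    exact ((hA i j).tendsto.mono_left nhdsWithin_le_nhds).sub
      ((hB i j).tendsto.comp tendsto_neg_nhdsGT_zero)
  exact ht.eventually (lt_mem_nhds (half_lt_self hpos))

theorem eventually_distSq_le {A : ℝ → Matrix (Fin 3) (Fin 3) ℝ}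
    (hA : ∀ i j, DifferentiableAt ℝ (fun L => A L i j) 0) :
    ∃ C, 0 ≤ C ∧ ∀ᶠ L in 𝓝[>] (0 : ℝ), distSq (A L) (A (-L)) ≤ C * L ^ 2 := by
  choose C hC0 hC using fun i j => exists_abs_sub_le (hA i j) (hA i j) rfl
  refine ⟨∑ i, ∑ j, C i j ^ 2, Finset.sum_nonneg fun _ _ => Finset.sum_nonneg fun _ _ => sq_nonneg _,
    ?_⟩
  filter_upwards [eventually_all.2 fun i => eventually_all.2 fun j => hC i j] with L h
  rw [distSq, Finset.sum_mul]
  refine Finset.sum_le_sum fun i _ => ?_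
  rw [Finset.sum_mul]
  refine Finset.sum_le_sum fun j _ => ?_
  rw [← mul_pow, ← sq_abs]
  exact pow_le_pow_left₀ (abs_nonneg _) (h i j) 2

/-! ### Assembly of the count and of the signs. -/

/-- The `μ i` are squared singular values, so the scale to be matched is `√(μ 1)`, and the constant
in the distance formula is `(√√(μ 1))⁻¹`. -/
theorem mem_nu_iff {A₀ : OneForm} {R : ℝ} (hA₀ : IsASDConnectionOn A₀ (Metric.ball 0 R)) {x : ℍ}
    (hx : x ∈ Metric.ball (0 : ℍ) R) {v : Fin 3 → Fin 3 → ℝ} {μ : Fin 3 → ℝ}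
    (h : IsSpectralFrame (curvatureMatrix (curvature A₀ x)) v μ) {K α L : ℝ} {b : BubbleData} :
    b ∈ nu A₀ (Metric.ball 0 R) K α L x ↔ b.1 ∈ Metric.ball (0 : ℍ) R ∧ b.2.1 < K * L ^ α ∧
      ∃ i, IsMatched x (√(μ 1)) (h.rot (boolSign_sq i)) b := by
  have hred : b.1 ≠ x → 0 < b.2.1 →
      (IsReducible (curvature A₀ x + Fstd b x) ↔ (totalMatrix A₀ x b).rank ≤ 1) := fun hb hl =>
    isReducible_iff_rank ((isSkewIm_curvature_of_mem hA₀ hx).add (isSkewIm_Fstd hb.symm hl.ne'))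
  constructor
  · rintro ⟨⟨hU, hl, hlt⟩, hb, hr⟩
    refine ⟨hU, hlt, ?_⟩
    rw [hred hb hl, totalMatrix_eq_scale A₀ hb hl.ne'] at hr
    have hs : 0 < bubbleScale b.2.1 (‖x - b.1‖ ^ 2) := by rw [bubbleScale]; positivity
    obtain ⟨hs', ε, hε, hQ⟩ := h.eq_of_rank_le hs hr
    obtain ⟨i, rfl⟩ := exists_boolSign_eq hε
    exact ⟨i, hb, hl, hs', hQ⟩
  · rintro ⟨hU, hlt, i, hm⟩
    refine ⟨⟨hU, hm.pos, hlt⟩, hm.ne, ?_⟩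
    rw [hred hm.ne hm.pos, totalMatrix_eq_scale A₀ hm.ne hm.pos.ne', hm.scale, hm.rot]
    exact h.rank_rot_le _

/-- The squared distance is `λ(a - λ)`, which exceeds `λ²` when `λ < a / 2`. This is the size
condition behind the positive sign in `det_dataMatrix_pos`. -/
theorem IsMatched.lt_norm {x : ℍ} {s : ℝ} {R : SO3} {b : BubbleData} (h : IsMatched x s R b)
    (hs : b.2.1 < (√s)⁻¹ / 2) : b.2.1 < ‖x - b.1‖ := by
  have h1 := h.norm_sq_eq
  have h2 := h.pos
  refine lt_of_pow_lt_pow_left₀ 2 (norm_nonneg _) ?_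
  rw [h1]
  nlinarith

/-- A matched centre is within `√(λ a)` of `x`, so for small bubbles the condition that it lies in
the ball is automatic. -/
theorem IsMatched.norm_lt {x : ℍ} {s r : ℝ} {R : SO3} {b : BubbleData} (h : IsMatched x s R b)
    (hr : 0 ≤ r) (hs : b.2.1 * (√s)⁻¹ ≤ r ^ 2) : ‖b.1‖ < ‖x‖ + r := by
  have h1 : ‖x - b.1‖ < r := by
    refine lt_of_pow_lt_pow_left₀ 2 hr ?_
    rw [h.norm_sq_eq]
    nlinarith [h.pos]
  have h2 : ‖b.1‖ ≤ ‖x‖ + ‖x - b.1‖ := by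
    have := norm_sub_le x (x - b.1)
    rwa [sub_sub_cancel] at this
  linarith

namespace IsSpectralFrame

variable {M : Matrix (Fin 3) (Fin 3) ℝ} {v : Fin 3 → Fin 3 → ℝ} {μ : Fin 3 → ℝ}

theorem rot_injective (h : IsSpectralFrame M v μ) :
    Function.Injective fun i => h.rot (boolSign_sq i) := by
  have hne := h.rot_one_ne_rot_neg_one (boolSign_sq true) (boolSign_sq false)
  intro i j hij
  cases i <;> cases j <;> first | rfl | exact absurd hij hne | exact absurd hij.symm hne

end IsSpectralFrame

theorem ncard_nu_inter {A₀ : OneForm} {R : ℝ} (hA₀ : IsASDConnectionOn A₀ (Metric.ball 0 R))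
    {K α L κ C : ℝ} (hL : 0 < L) (hLR : L < R / 2) (hK : 0 < K)
    {v v' : Fin 3 → Fin 3 → ℝ} {μ μ' : Fin 3 → ℝ}
    (h : IsSpectralFrame (curvatureMatrix (curvature A₀ (L : ℍ))) v μ)
    (h' : IsSpectralFrame (curvatureMatrix (curvature A₀ ((-L : ℝ) : ℍ))) v' μ')
    (hΛ : K * L ^ α ≤ (√√(μ 1))⁻¹ / 2) (hΛ' : K * L ^ α ≤ (√√(μ' 1))⁻¹ / 2)
    (hball : K * L ^ α * (√√(μ 1))⁻¹ ≤ (R / 2) ^ 2)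
    (hκ : 0 < κ) (hκ₁ : κ ≤ 1)
    (hlt : ∀ c ≤ 1 - κ, (2 * L) ^ 2 < sideSq (√√(μ 1))⁻¹ (√√(μ' 1))⁻¹ c (K * L ^ α / 2))
    (hgt : ∀ c ≤ 1, 1 - c ≤ C * L ^ 2 → ∀ lam, 0 < lam → lam < K * L ^ α →
      sideSq (√√(μ 1))⁻¹ (√√(μ' 1))⁻¹ c lam < (2 * L) ^ 2)
    (hne : ∀ i j, i ≠ j →
      16 * κ ≤ distSq (h.rot (boolSign_sq i)) (h'.rot (boolSign_sq j)))
    (heq : ∀ i, distSq (h.rot (boolSign_sq i)) (h'.rot (boolSign_sq i)) ≤ 8 * (C * L ^ 2)) :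
    (nu A₀ (Metric.ball 0 R) K α L (L : ℍ) ∩
      nu A₀ (Metric.ball 0 R) K α L ((-L : ℝ) : ℍ)).ncard = 6 := by
  have hnp : ‖(L : ℍ)‖ = L := by rw [Quaternion.norm_coe, Real.norm_of_nonneg hL.le]
  have hnq : ‖((-L : ℝ) : ℍ)‖ = L := by
    rw [Quaternion.norm_coe, Real.norm_eq_abs, abs_neg, abs_of_pos hL]
  have hp : (L : ℍ) ∈ Metric.ball (0 : ℍ) R := by rw [mem_ball_zero_iff, hnp]; linarith
  have hq : ((-L : ℝ) : ℍ) ∈ Metric.ball (0 : ℍ) R := by rw [mem_ball_zero_iff, hnq]; linarith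
  choose g hg1 hg0 hgR using fun i j =>
    exists_conjSO3_eq ((h'.rot (boolSign_sq j))⁻¹ * h.rot (boolSign_sq i))
  have hR : ∀ i j, h'.rot (boolSign_sq j) * conjSO3 (g i j) = h.rot (boolSign_sq i) := fun i j => by
    rw [hgR, mul_inv_cancel_left]
  have hdist := fun i j => distSq_eq_of_conjSO3 (hg1 i j) (hR i j)
  have hre : ∀ i j, (g i j).re ≤ 1 := fun i j => by
    have h1 := norm_sq_eq (g i j)
    rw [hg1] at h1
    nlinarith [sq_nonneg (g i j).imI, sq_nonneg (g i j).imJ, sq_nonneg (g i j).imK]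
  have hset : nu A₀ (Metric.ball 0 R) K α L (L : ℍ) ∩ nu A₀ (Metric.ball 0 R) K α L ((-L : ℝ) : ℍ) =
      {b : BubbleData | b.2.1 < K * L ^ α ∧ ∃ i j,
        IsMatched (L : ℍ) (√(μ 1)) (h.rot (boolSign_sq i)) b ∧
        IsMatched ((-L : ℝ) : ℍ) (√(μ' 1)) (h'.rot (boolSign_sq j)) b} := by
    ext b
    rw [Set.mem_inter_iff, mem_nu_iff hA₀ hp h, mem_nu_iff hA₀ hq h']
    constructor
    · rintro ⟨⟨-, hlt, i, hi⟩, -, -, j, hj⟩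
      exact ⟨hlt, i, j, hi, hj⟩
    · rintro ⟨hlt, i, j, hi, hj⟩
      have hb : b.1 ∈ Metric.ball (0 : ℍ) R := by
        have h1 : b.2.1 * (√√(μ 1))⁻¹ ≤ K * L ^ α * (√√(μ 1))⁻¹ :=
          mul_le_mul_of_nonneg_right hlt.le (by positivity)
        have h2 := hi.norm_lt (by linarith) (h1.trans hball)
        rw [mem_ball_zero_iff]
        linarith
      exact ⟨⟨hb, hlt, i, hi⟩, hb, hlt, j, hj⟩
  rw [hset]
  refine ncard_isMatched (d := 2 * L) (g := g) (by linarith) ?_ hg1 hR h.rot_injective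
    h'.rot_injective (Real.sqrt_pos.2 h.pos) (Real.sqrt_pos.2 h'.pos)
    (mul_pos hK (Real.rpow_pos_of_pos hL α)) hΛ hΛ' ?_ ?_
  · rw [← Quaternion.coe_sub]
    congr 1
    ring
  · intro i j k hv
    have hc : boolSign k * (g i j).re ≤ 1 - κ := by
      cases k with
      | false =>
        rw [boolSign, if_neg Bool.false_ne_true]
        linarith [hg0 i j]
      | true =>
        -- Separation gives `1 - (Re g)² ≥ 2 κ`; since `0 ≤ Re g ≤ 1`, the left side is at most `2
        -- (1 - Re g)`.
        have hij := hne i j (hv.resolve_right Bool.true_eq_false_eq_False)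
        rw [hdist] at hij
        rw [boolSign, if_pos rfl, one_mul]
        nlinarith [hre i j, hg0 i j]
    exact ⟨by linarith, hlt _ hc⟩
  · intro i lam
    refine hgt _ (hre i i) ?_ lam
    -- Here `1 - Re g ≤ 1 - (Re g)² ≤ C L²`, again by `0 ≤ Re g ≤ 1`.
    have hii := heq i
    rw [hdist] at hii
    nlinarith [hre i i, hg0 i i]

theorem hasLocalIntersectionNumber_of_mem_nu {A₀ : OneForm} {R : ℝ}
    (hA₀ : IsASDConnectionOn A₀ (Metric.ball 0 R)) {p q : ℍ} (hpq : p ≠ q)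
    (hp : p ∈ Metric.ball (0 : ℍ) R) (hq : q ∈ Metric.ball (0 : ℍ) R)
    {v v' : Fin 3 → Fin 3 → ℝ} {μ μ' : Fin 3 → ℝ} {K α L : ℝ}
    (h : IsSpectralFrame (curvatureMatrix (curvature A₀ p)) v μ)
    (h' : IsSpectralFrame (curvatureMatrix (curvature A₀ q)) v' μ')
    (hΛ : K * L ^ α ≤ (√√(μ 1))⁻¹ / 2) (hΛ' : K * L ^ α ≤ (√√(μ' 1))⁻¹ / 2) {b : BubbleData}
    (hb : b ∈ nu A₀ (Metric.ball 0 R) K α L p ∩ nu A₀ (Metric.ball 0 R) K α L q) :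
    HasLocalIntersectionNumber (totalMatrix A₀ p) (totalMatrix A₀ q) b 1 := by
  obtain ⟨-, hlt, i, hi⟩ := (mem_nu_iff hA₀ hp h).1 hb.1
  obtain ⟨-, -, j, hj⟩ := (mem_nu_iff hA₀ hq h').1 hb.2
  refine hasLocalIntersectionNumber_one A₀ hi.pos (hi.lt_norm (by linarith))
    (hj.lt_norm (by linarith)) hpq h.hasSimpleSpectrum h'.hasSimpleSpectrum ?_ ?_
  · rw [totalMatrix_eq_scale A₀ hi.ne hi.pos.ne', hi.scale, hi.rot]
    exact h.rank_rot_le _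
  · rw [totalMatrix_eq_scale A₀ hj.ne hj.pos.ne', hj.scale, hj.rot]
    exact h'.rank_rot_le _

theorem eventually_nu_inter {A₀ : OneForm} {R K α : ℝ} (hK : 0 < K) (hα₀ : 0 < α) (hα₂ : α < 2)
    (hR : 0 < R) (hA₀ : IsASDConnectionOn A₀ (Metric.ball 0 R))
    (hσ : Function.Injective (singularValues (curvatureMatrix (curvature A₀ 0)))) :
    ∀ᶠ L : ℝ in 𝓝[>] 0,
      (nu A₀ (Metric.ball 0 R) K α L (L : ℍ) ∩
        nu A₀ (Metric.ball 0 R) K α L ((-L : ℝ) : ℍ)).ncard = 6 ∧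
      ∀ b ∈ nu A₀ (Metric.ball 0 R) K α L (L : ℍ) ∩ nu A₀ (Metric.ball 0 R) K α L ((-L : ℝ) : ℍ),
        HasLocalIntersectionNumber (totalMatrix A₀ (L : ℍ)) (totalMatrix A₀ ((-L : ℝ) : ℍ)) b 1 := by
  obtain ⟨M, hM⟩ : ∃ M : ℝ → Matrix (Fin 3) (Fin 3) ℝ,
    M = fun L : ℝ => curvatureMatrix (curvature A₀ (L : ℍ)) := ⟨_, rfl⟩
  have hMd : ∀ i j, DifferentiableAt ℝ (fun L => M L i j) 0 := fun i j => by
    rw [hM]; exact differentiableAt_curvatureMatrix hR hA₀ i j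
  have hM0 : M 0 = curvatureMatrix (curvature A₀ 0) := by rw [hM]; rfl
  obtain ⟨v, μ, h0⟩ := exists_spectralFrame (M := M 0) (by rw [hM0]; exact hσ)
  obtain ⟨V, N, rfl, rfl, hVd, hNd, hfr⟩ := exists_spectralFrame_curve hMd h0
  have hρ : ∀ i a b, DifferentiableAt ℝ
      (fun L => rotMat (M L) (V L) (N L) (boolSign i) a b) 0 := fun i =>
    differentiableAt_rotMat hMd hVd hNd h0 (boolSign i)
  have hsqrt : 0 < √(N 0 1) := Real.sqrt_pos.2 h0.pos
  have ha : DifferentiableAt ℝ (fun L => (√√(N L 1))⁻¹) 0 :=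
    (((hNd 1).sqrt h0.pos.ne').sqrt hsqrt.ne').inv (Real.sqrt_pos.2 hsqrt).ne'
  have ha0 : 0 < (√√(N 0 1))⁻¹ := inv_pos.2 (Real.sqrt_pos.2 hsqrt)
  choose C hC0 hC using fun i => eventually_distSq_le (hρ i)
  have hρ0 : ∀ i, rotMat (M 0) (V 0) (N 0) (boolSign i) ≠ rotMat (M 0) (V 0) (N 0) (boolSign !i) :=
    fun i hi => by
      have := h0.rot_injective (Subtype.ext hi : h0.rot (boolSign_sq i) = h0.rot (boolSign_sq !i))
      cases i <;> simp at this
  choose δ hδ0 hδ using fun i => eventually_lt_distSq (fun a b => (hρ i a b).continuousAt)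
    (fun a b => (hρ (!i) a b).continuousAt) (hρ0 i)
  -- One gap for both pairs of distinct rotations. The bound `κ ≤ 1` serves the sign `-`, where the
  -- cosine is only known to be at most `0`.
  obtain ⟨κ, hκ0, hκ1, hκ⟩ : ∃ κ : ℝ, 0 < κ ∧ κ ≤ 1 ∧ ∀ i, 16 * κ ≤ δ i := by
    refine ⟨min 1 (min (δ true / 16) (δ false / 16)), ?_, min_le_left _ _, fun i => ?_⟩
    · have := hδ0 true
      have := hδ0 false
      positivity
    · have h1 := min_le_right 1 (min (δ true / 16) (δ false / 16))
      have h2 := min_le_left (δ true / 16) (δ false / 16)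
      have h3 := min_le_right (δ true / 16) (δ false / 16)
      cases i <;> linarith
  filter_upwards [hfr.filter_mono nhdsWithin_le_nhds, tendsto_neg_nhdsGT_zero.eventually hfr,
    eventually_all.2 hC, eventually_all.2 hδ, eventually_le_half (K := K) ha.continuousAt ha0 hα₀,
    eventually_between ha.continuousAt ha0,
    (tendsto_const_mul_rpow (K := 2 * (√√(N 0 1))⁻¹ * K) hα₀).eventually
      (gt_mem_nhds (show (0 : ℝ) < (R / 2) ^ 2 by positivity)),
    eventually_lt_sideSq ha.continuousAt ha0 hK hα₀ hα₂ hκ0,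
    eventually_sideSq_lt ha ha0 (K := K) hα₀ (add_nonneg (hC0 true) (hC0 false)),
    nhdsWithin_le_nhds (gt_mem_nhds (half_pos hR)), self_mem_nhdsWithin]
    with L h h' hCL hδL hΛ hab hball hlt hgt hLR (hL : 0 < L)
  have hfp : IsSpectralFrame (curvatureMatrix (curvature A₀ (L : ℍ))) (V L) (N L) := by
    rw [hM] at h; exact h
  have hfq : IsSpectralFrame (curvatureMatrix (curvature A₀ ((-L : ℝ) : ℍ))) (V (-L)) (N (-L)) := by
    rw [hM] at h'; exact h'
  have hp : (L : ℍ) ∈ Metric.ball (0 : ℍ) R := by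
    rw [mem_ball_zero_iff, Quaternion.norm_coe, Real.norm_of_nonneg hL.le]; linarith
  have hq : ((-L : ℝ) : ℍ) ∈ Metric.ball (0 : ℍ) R := by
    rw [mem_ball_zero_iff, Quaternion.norm_coe, Real.norm_eq_abs, abs_neg, abs_of_pos hL]; linarith
  have hpq : (L : ℍ) ≠ ((-L : ℝ) : ℍ) := fun he => by
    have := Quaternion.coe_injective he
    linarith
  subst hM
  refine ⟨ncard_nu_inter hA₀ hL hLR hK hfp hfq hΛ.1 hΛ.2 ?_ hκ0 hκ1 hlt hgt ?_ ?_,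
    fun b hb => hasLocalIntersectionNumber_of_mem_nu hA₀ hpq hp hq hfp hfq hΛ.1 hΛ.2 hb⟩
  · have := mul_le_mul_of_nonneg_left hab.1.2.le (mul_pos hK (Real.rpow_pos_of_pos hL α)).le
    linarith
  · intro i j hij
    obtain rfl : j = !i := by cases i <;> cases j <;> simp_all
    exact (hκ i).trans (hδL i).le
  · intro i
    refine (hCL i).trans ?_
    have h1 : C i ≤ C true + C false := by cases i <;> linarith [hC0 true, hC0 false]
    have h2 := mul_le_mul_of_nonneg_right h1 (sq_nonneg L)
    have h3 : 0 ≤ (C true + C false) * L ^ 2 :=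
      mul_nonneg (add_nonneg (hC0 true) (hC0 false)) (sq_nonneg L)
    linarith

end

end BubbleModel

theorem theorem2p1 (K α R : ℝ) (hK : 0 < K) (hα₀ : 0 < α) (hα₂ : α < 2) (hR : 0 < R)
    (A₀ : OneForm) (hA₀ : IsASDConnectionOn A₀ (Metric.ball 0 R))
    (hσ : Function.Injective (singularValues (curvatureMatrix (curvature A₀ 0)))) :
    ∀ᶠ L : ℝ in 𝓝[>] 0, ∀ p q : ℍ, p = ⟨L, 0, 0, 0⟩ → q = ⟨-L, 0, 0, 0⟩ →
      (nu A₀ (Metric.ball 0 R) K α L p ∩ nu A₀ (Metric.ball 0 R) K α L q).ncard = 6 ∧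
      ∀ b ∈ nu A₀ (Metric.ball 0 R) K α L p ∩ nu A₀ (Metric.ball 0 R) K α L q,
        IsTransverseAt (totalMatrix A₀ p) (totalMatrix A₀ q) b ∧
        HasLocalIntersectionNumber (totalMatrix A₀ p) (totalMatrix A₀ q) b 1 := by
  filter_upwards [eventually_nu_inter hK hα₀ hα₂ hR hA₀ hσ] with L hL p q hp hq
  subst hp hq
  exact ⟨hL.1, fun b hb => ⟨(hL.2 b hb).1, hL.2 b hb⟩⟩
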